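/- **Families.** All families are sets of finite subsets of $\mathbb N$. A family is *compact* if it is closed in $\{0,1\}^{\mathbb N}$ (finite sets being identified with their characteristic functions), *hereditary* if it is closed under subsets, *spreading* if $\{s_1<\dots<s_d\}\in\mathcal F$ and $s_i\le t_i$, $t_1<\dots<t_d$ imply $\{t_1,\dots,t_d\}\in\mathcal F$, and *regular* if it is compact, hereditary and spreading. The index $\iota(\mathcal F)$ of a compact family is the least ordinal $\alpha$ such that the $\alpha$-th Cantor–Bendixson derivative $\partial^{(\alpha)}\mathcal F$ is contained in $\{\emptyset\}$. **Norms.** Finite nonempty sets $E_1<\dots<E_n$ are *$\mathcal F$-admissible* if there is $\{m_1<\dots<m_n\}\in\mathcal F$ with $m_1\le \min E_1\le\max E_1<m_2\le\min E_2\le\dots<m_n\le\min E_n$. For compact hereditary families $\mathcal F_i$ and $0<\theta_i<1$ ($1\le i\le r$), the norm of $T[(\mathcal F_i,\theta_i)_{i=1}^r]$ on $c_{00}$ is the norm determined by $$\|x\|_{(\mathcal F_i,\theta_i)_{i=1}^r}=\max\Big\{\|x\|_\infty,\ \sup\Big\{\theta_i\sum_{j=1}^n\|E_jx\|_{(\mathcal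 F_i,\theta_i)_{i=1}^r}:\ 1\le i\le r,\ (E_j)_{j=1}^n\ \mathcal F_i\text{-admissible}\Big\}\Big\};$$ equivalently, $\|x\|=\sup\{f(x): f\in K\}$, where $K\subseteq c_{00}$ is the smallest set that contains all $\pm e_n^*$ and contains $\theta_i(f_1+\dots+f_n)$ whenever $1\le i\le r$, $f_1,\dots,f_n\in K$ and the supports of $f_1,\dots,f_n$ are $\mathcal F_i$-admissible. For a single pair $(\mathcal F,\theta)$ the norm is denoted $\|\cdot\|_{(\mathcal F,\theta)}$. **Ordering.** Every ordinal $\alpha>0$ is uniquely $\alpha=\omega^{\lambda(\alpha)}k(\alpha)+\xi(\alpha)$ with $1\le k(\alpha)<\omega$ and $\xi(\alpha)<\omega^{\lambda(\alpha)}$; put $\xi(0)=0$. Let $\gamma(\alpha)=\alpha$, $n(\alpha)=1$ if $\alpha$ is finite, and $\gamma(\alpha)=\omega^{\omega^{\lambda(\lambda(\alpha))}}$, $n(\alpha)=k(\lambda(\alpha))$ if $\alpha$ is infinite. Write $(\alpha_0,\theta_0)\le_T(\alpha_1,\theta_1)$ if either $\alpha_0,\alpha_1$ are both finite and $\log_{\gamma(\alpha_0)}\theta_0\le\log_{\gamma(\alpha_1)}\theta_1$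 (where $\log_k\theta=-\infty$ if $k\le1$), or at least one of them is infinite and there are integers $m_0,m_1\ge1$ with $\gamma(\alpha_0)^{n(\alpha_0)m_0}\le\gamma(\alpha_1)^{n(\alpha_1)m_1}$ and $\theta_0^{m_0}\le\theta_1^{m_1}$. **Proposition.** Let $\mathcal F_1,\dots,\mathcal F_r$ be compact hereditary families, at least one of which has infinite index, let $0<\theta_i<1$, and put $\alpha_i=\iota(\mathcal F_i)$. Let $i_0$ be such that $(\alpha_i,\theta_i)\le_T(\alpha_{i_0},\theta_{i_0})$ for all $i$. Then for every infinite $M\subseteq\mathbb N$ there are an infinite $N\subseteq M$ and a regular family $\mathcal B$ with $\iota(\mathcal B)=\iota(\mathcal F_{i_0})$ such that for every finitely supported sequence $(a_n)_{n\in N}$ of real scalars $$\Big\|\sum_{n\in N}a_ne_n\Big\|_{(\mathcal B,\theta_{i_0})}\le\Big\|\sum_{n\in N}a_ne_n\Big\|_{(\mathcal F_i,\theta_i)_{i=1}^r}\le 2C\,\Big\|\sum_{n\in N}a_ne_n\Big\|_{(\mathcal B,\theta_{i_0})},$$ where $$C=2\Big(1+\max_{\alpha_i\ge\omega}k(\alpha_i)\Big)\prod_{i\ne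 i_0}\frac1{\theta_i^{m_i-1}}\prod_{i\ne i_0,\ \xi(\lambda(\alpha_i))\neq0}\frac2{\theta_i},$$ with $m_i=\lfloor\log_{\theta_i}\theta_{i_0}\rfloor+1$ if $\gamma(\alpha_i)<\gamma(\alpha_{i_0})$ and $m_i=n(\alpha_{i_0})$ otherwise. -/

import Mathlib

open scoped Topology

noncomputable section

/-! ### Families of finite sets of integers -/

namespace Tsirelson

/-- The characteristic function of a finite set of integers, as a point of the Cantor space
`ℕ → Bool` (with the product topology). -/
def charFun (s : Finset ℕ) : ℕ → Bool := fun n => decide (n ∈ s)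

/-- A family of finite sets as a subset of the Cantor space. -/
def toCantor (F : Set (Finset ℕ)) : Set (ℕ → Bool) := charFun '' F

/-- `F` is compact: it is closed in the (compact) Cantor space. -/
def IsCompactFamily (F : Set (Finset ℕ)) : Prop := IsClosed (toCantor F)

def IsHereditary (F : Set (Finset ℕ)) : Prop :=
  ∀ s t : Finset ℕ, s ⊆ t → t ∈ F → s ∈ F

/-- `s ⪯ t`: the sets `s = {a 0 < a 1 < …}` and `t = {b 0 < b 1 < …}` have the same number of
elements and `a i ≤ b i` for all `i`. -/
def SpreadsTo (s t : Finset ℕ) : Prop :=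
  ∃ (n : ℕ) (a b : Fin n → ℕ), StrictMono a ∧ StrictMono b ∧
    Finset.univ.image a = s ∧ Finset.univ.image b = t ∧ ∀ i, a i ≤ b i

def IsSpreading (F : Set (Finset ℕ)) : Prop :=
  ∀ s t : Finset ℕ, SpreadsTo s t → s ∈ F → t ∈ F

structure IsRegular (F : Set (Finset ℕ)) : Prop where
  compact : IsCompactFamily F
  hereditary : IsHereditary F
  spreading : IsSpreading F

/-- The Cantor-Bendixson index `ι(F)`: the least ordinal `α` such that the `α`-th iterated
derivative of `F` is contained in `{∅}`. -/
def index (F : Set (Finset ℕ)) : Ordinal.{0} :=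
  sInf {α : Ordinal.{0} |
    CantorBendixson.iteratedDerivedSet (toCantor F) α ⊆ toCantor {∅}}

/-! ### Admissible sequences and mixed Tsirelson norms -/

/-- `E 0 < E 1 < … < E (n-1)` are nonempty and successive. -/
def IsBlock {n : ℕ} (E : Fin n → Finset ℕ) : Prop :=
  (∀ i, (E i).Nonempty) ∧ ∀ i j, i < j → ∀ a ∈ E i, ∀ b ∈ E j, a < b

/-- `t = {m 0 < … < m (n-1)}` interpolates the sequence `E`:
`m 0 ≤ E 0 < m 1 ≤ E 1 < … < m (n-1) ≤ E (n-1)`. -/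
def Interpolates {n : ℕ} (t : Finset ℕ) (E : Fin n → Finset ℕ) : Prop :=
  ∃ m : Fin n → ℕ, StrictMono m ∧ Finset.univ.image m = t ∧
    (∀ i, ∀ a ∈ E i, m i ≤ a) ∧ ∀ i j, i < j → ∀ a ∈ E i, a < m j

/-- The block sequence `E` is `F`-admissible. -/
def IsAdmissible (F : Set (Finset ℕ)) {n : ℕ} (E : Fin n → Finset ℕ) : Prop :=
  IsBlock E ∧ ∃ t ∈ F, Interpolates t E

/-- The norming set `K((F i, θ i)_i)`: the smallest set of finitely supported functionals that
contains the functionals `± e n*` and is closed under the `(F i, θ i)`-operations. -/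
inductive Norming {I : Type} (F : I → Set (Finset ℕ)) (θ : I → ℝ) : (ℕ →₀ ℝ) → Prop
  | basis (n : ℕ) : Norming F θ (Finsupp.single n 1)
  | neg_basis (n : ℕ) : Norming F θ (Finsupp.single n (-1))
  | op (i : I) {n : ℕ} (f : Fin (n + 1) → ℕ →₀ ℝ) (hf : ∀ j, Norming F θ (f j))
      (hadm : IsAdmissible (F i) fun j => (f j).support) :
      Norming F θ (θ i • ∑ j, f j)

/-- The action of a functional on a finitely supported vector. -/
def pairing (f x : ℕ →₀ ℝ) : ℝ := ∑ n ∈ x.support, f n * x n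

/-- The norm of the mixed Tsirelson space `T[(F i, θ i)_i]` on `c₀₀`. It is the norm determined by
the usual implicit equation: see `isLUB_mixedNorm` and `eq_mixedNorm` below. -/
def mixedNorm {I : Type} (F : I → Set (Finset ℕ)) (θ : I → ℝ) (x : ℕ →₀ ℝ) : ℝ :=
  sSup {v | ∃ f, Norming F θ f ∧ v = pairing f x}

/-- The norm of the Tsirelson type space `T(F, θ)` on `c₀₀`. -/
def tsirelsonNorm (F : Set (Finset ℕ)) (θ : ℝ) (x : ℕ →₀ ℝ) : ℝ :=
  mixedNorm (fun _ : Unit => F) (fun _ : Unit => θ) x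

/-- The restriction `E x` of a vector to a set of integers. -/
def restrict (E : Finset ℕ) (x : ℕ →₀ ℝ) : ℕ →₀ ℝ := x.filter (· ∈ E)

/-- The set whose supremum is the right-hand side of the implicit equation
`‖x‖ = max (‖x‖_∞, sup {θ i ∑ j, ‖E j x‖ : i, (E j) is F i-admissible})`. -/
def implicitSet {I : Type} (F : I → Set (Finset ℕ)) (θ : I → ℝ) (p : (ℕ →₀ ℝ) → ℝ)
    (x : ℕ →₀ ℝ) : Set ℝ :=
  {v | ∃ n, v = |x n|} ∪
    {v | ∃ (i : I) (n : ℕ) (E : Fin (n + 1) → Finset ℕ), IsAdmissible (F i) E ∧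
      v = θ i * ∑ j, p (restrict (E j) x)}

section Implicit

variable {I : Type} {F : I → Set (Finset ℕ)} {θ : I → ℝ}

theorem pairing_eq_sum (f x : ℕ →₀ ℝ) (s : Finset ℕ) (h : x.support ⊆ s) :
    pairing f x = ∑ n ∈ s, f n * x n := by
  refine Finset.sum_subset h fun n _ hn => ?_
  simp [Finsupp.notMem_support_iff.1 hn]

theorem pairing_smul_sum (c : ℝ) {n : ℕ} (f : Fin n → ℕ →₀ ℝ) (x : ℕ →₀ ℝ) :
    pairing (c • ∑ j, f j) x = c * ∑ j, pairing (f j) x := by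
  unfold pairing
  rw [Finset.sum_comm, Finset.mul_sum]
  refine Finset.sum_congr rfl fun k _ => ?_
  simp [Finset.sum_mul, mul_assoc]

theorem support_restrict (E : Finset ℕ) (x : ℕ →₀ ℝ) :
    (restrict E x).support = x.support.filter (· ∈ E) := by
  simp [restrict]

theorem pairing_restrict (f x : ℕ →₀ ℝ) (E : Finset ℕ) :
    pairing (restrict E f) x = pairing f (restrict E x) := by
  rw [pairing_eq_sum f (restrict E x) x.support
    (by rw [support_restrict]; exact Finset.filter_subset _ _)]
  unfold pairing
  refine Finset.sum_congr rfl fun k _ => ?_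
  simp only [restrict, Finsupp.filter_apply]
  split_ifs <;> simp

/-- On each coordinate at most one member of a block sequence is nonzero. -/
theorem abs_sum_block_le {n : ℕ} (f : Fin n → ℕ →₀ ℝ)
    (hb : IsBlock fun j => (f j).support) (h1 : ∀ j k, |f j k| ≤ 1) (k : ℕ) :
    |(∑ j, f j) k| ≤ 1 := by
  rw [Finsupp.finsetSum_apply]
  by_cases h : ∃ j, f j k ≠ 0
  · obtain ⟨j, hj⟩ := h
    rw [Finset.sum_eq_single j]
    · exact h1 j k
    · intro l _ hl
      by_contra hne
      rcases lt_or_gt_of_ne hl with h | h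
      · exact lt_irrefl _ (hb.2 l j h k (Finsupp.mem_support_iff.2 hne) k
          (Finsupp.mem_support_iff.2 hj))
      · exact lt_irrefl _ (hb.2 j l h k (Finsupp.mem_support_iff.2 hj) k
          (Finsupp.mem_support_iff.2 hne))
    · simp
  · push Not at h
    simp [h]

theorem Norming.abs_le_one (hθ : ∀ i, 0 < θ i ∧ θ i < 1) {f : ℕ →₀ ℝ} (hf : Norming F θ f) :
    ∀ k, |f k| ≤ 1 := by
  induction hf with
  | basis n => intro k; rw [Finsupp.single_apply]; split_ifs <;> simp
  | neg_basis n => intro k; rw [Finsupp.single_apply]; split_ifs <;> simp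
  | op i f hf hadm ih =>
    intro k
    have h := abs_sum_block_le f hadm.1 ih k
    rw [Finsupp.smul_apply, smul_eq_mul, abs_mul, abs_of_pos (hθ i).1]
    have := (hθ i).2
    have := (hθ i).1
    nlinarith [abs_nonneg ((∑ j, f j) k)]

theorem bddAbove_norming (hθ : ∀ i, 0 < θ i ∧ θ i < 1) (x : ℕ →₀ ℝ) :
    BddAbove {v | ∃ f, Norming F θ f ∧ v = pairing f x} := by
  refine ⟨∑ n ∈ x.support, |x n|, ?_⟩
  rintro _ ⟨f, hf, rfl⟩
  refine Finset.sum_le_sum fun n _ => ?_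
  calc f n * x n ≤ |f n * x n| := le_abs_self _
    _ = |f n| * |x n| := abs_mul _ _
    _ ≤ 1 * |x n| := mul_le_mul_of_nonneg_right (hf.abs_le_one hθ n) (abs_nonneg _)
    _ = |x n| := one_mul _

theorem pairing_le_mixedNorm (hθ : ∀ i, 0 < θ i ∧ θ i < 1) {f : ℕ →₀ ℝ} (hf : Norming F θ f)
    (x : ℕ →₀ ℝ) : pairing f x ≤ mixedNorm F θ x :=
  le_csSup (bddAbove_norming hθ x) ⟨f, hf, rfl⟩

theorem pairing_single (n : ℕ) (c : ℝ) (x : ℕ →₀ ℝ) :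
    pairing (Finsupp.single n c) x = c * x n := by
  rw [pairing_eq_sum _ x (insert n x.support) (Finset.subset_insert _ _),
    Finset.sum_eq_single n]
  · simp
  · intro k _ hk; simp [hk.symm]
  · simp

theorem abs_le_mixedNorm (hθ : ∀ i, 0 < θ i ∧ θ i < 1) (x : ℕ →₀ ℝ) (n : ℕ) :
    |x n| ≤ mixedNorm F θ x := by
  have h1 := pairing_le_mixedNorm hθ (Norming.basis (F := F) (θ := θ) n) x
  have h2 := pairing_le_mixedNorm hθ (Norming.neg_basis (F := F) (θ := θ) n) x
  rw [pairing_single] at h1 h2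
  exact abs_le.2 ⟨by linarith, by linarith⟩

theorem mixedNorm_nonneg (hθ : ∀ i, 0 < θ i ∧ θ i < 1) (x : ℕ →₀ ℝ) :
    0 ≤ mixedNorm F θ x :=
  (abs_nonneg _).trans (abs_le_mixedNorm hθ x 0)

/-- A subsequence of an admissible sequence, with its members shrunk, is admissible. -/
theorem IsAdmissible.shrink {G : Set (Finset ℕ)} (hG : IsHereditary G) {n k : ℕ}
    {E : Fin n → Finset ℕ} (hE : IsAdmissible G E) (e : Fin k → Fin n) (he : StrictMono e)
    (D : Fin k → Finset ℕ) (hD : ∀ j, D j ⊆ E (e j)) (hne : ∀ j, (D j).Nonempty) :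
    IsAdmissible G D := by
  obtain ⟨hb, t, ht, m, hm, rfl, h1, h2⟩ := hE
  refine ⟨⟨hne, fun i j hij a ha b hb' => hb.2 _ _ (he hij) a (hD i ha) b (hD j hb')⟩,
    Finset.univ.image (m ∘ e), hG _ _ ?_ ht, m ∘ e, hm.comp he, rfl,
    fun i a ha => h1 _ a (hD i ha), fun i j hij a ha => h2 _ _ (he hij) a (hD i ha)⟩
  intro a ha
  simp only [Finset.mem_image, Finset.mem_univ, true_and, Function.comp] at ha ⊢
  obtain ⟨j, rfl⟩ := ha
  exact ⟨_, rfl⟩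

/-- Applying an operation to an admissible sequence of functionals some of which may vanish. -/
theorem norming_op_of_zero_or (hF : ∀ i, IsHereditary (F i)) (i : I) {n : ℕ}
    (g : Fin n → ℕ →₀ ℝ) (E : Fin n → Finset ℕ) (hE : IsAdmissible (F i) E)
    (hsub : ∀ j, (g j).support ⊆ E j) (hg : ∀ j, g j = 0 ∨ Norming F θ (g j)) :
    (θ i • ∑ j, g j) = 0 ∨ Norming F θ (θ i • ∑ j, g j) := by
  classical
  set S : Finset (Fin n) := Finset.univ.filter fun j => g j ≠ 0 with hS
  have hsum : ∑ j, g j = ∑ j ∈ S, g j := by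
    rw [hS, Finset.sum_filter_ne_zero]
  rcases S.eq_empty_or_nonempty with h0 | hne
  · left; rw [hsum, h0]; simp
  right
  obtain ⟨k, hk⟩ : ∃ k, S.card = k + 1 := ⟨S.card - 1, by have := hne.card_pos; omega⟩
  have key : ∑ j ∈ S, g j = ∑ l, g (S.orderEmbOfFin hk l) := by
    conv_lhs => rw [← Finset.image_orderEmbOfFin_univ S hk]
    rw [Finset.sum_image (by intro a _ b _ h; exact (S.orderEmbOfFin hk).injective h)]
  rw [hsum, key]
  have hmem : ∀ l, g (S.orderEmbOfFin hk l) ≠ 0 := fun l =>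
    (Finset.mem_filter.1 (S.orderEmbOfFin_mem hk l)).2
  refine Norming.op i _ (fun l => (hg _).resolve_left (hmem l)) ?_
  exact hE.shrink (hF i) (S.orderEmbOfFin hk) (S.orderEmbOfFin hk).strictMono _
    (fun l => hsub _) (fun l => Finsupp.support_nonempty_iff.2 (hmem l))

theorem restrict_smul_sum (E : Finset ℕ) (c : ℝ) {n : ℕ} (f : Fin n → ℕ →₀ ℝ) :
    restrict E (c • ∑ j, f j) = c • ∑ j, restrict E (f j) := by
  ext k
  simp only [restrict, Finsupp.filter_apply, Finsupp.smul_apply, Finsupp.finsetSum_apply]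
  split_ifs <;> simp

theorem norming_restrict (hF : ∀ i, IsHereditary (F i)) (E : Finset ℕ) {f : ℕ →₀ ℝ}
    (hf : Norming F θ f) : restrict E f = 0 ∨ Norming F θ (restrict E f) := by
  induction hf with
  | basis n =>
    by_cases h : n ∈ E
    · right; rw [restrict, Finsupp.filter_single_of_pos _ h]; exact Norming.basis n
    · left; rw [restrict, Finsupp.filter_single_of_neg _ h]
  | neg_basis n =>
    by_cases h : n ∈ E
    · right; rw [restrict, Finsupp.filter_single_of_pos _ h]; exact Norming.neg_basis n
    · left; rw [restrict, Finsupp.filter_single_of_neg _ h]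
  | op i f hf hadm ih =>
    rw [restrict_smul_sum]
    refine norming_op_of_zero_or hF i _ _ hadm (fun j => ?_) ih
    rw [support_restrict]; exact Finset.filter_subset _ _

/-- The mixed Tsirelson norm satisfies the implicit equation. -/
theorem isLUB_mixedNorm (hF : ∀ i, IsHereditary (F i)) (hθ : ∀ i, 0 < θ i ∧ θ i < 1)
    (x : ℕ →₀ ℝ) : IsLUB (implicitSet F θ (mixedNorm F θ) x) (mixedNorm F θ x) := by
  constructor
  · rintro v (⟨n, rfl⟩ | ⟨i, n, E, hE, rfl⟩)
    · exact abs_le_mixedNorm hθ x n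
    · refine le_of_forall_pos_le_add fun ε hε => ?_
      have hn : (0 : ℝ) < n + 1 := by positivity
      have hex : ∀ j, ∃ g, (g = 0 ∨ Norming F θ g) ∧ g.support ⊆ E j ∧
          mixedNorm F θ (restrict (E j) x) ≤ pairing g x + ε / (n + 1) := by
        intro j
        obtain ⟨_, ⟨f, hf, rfl⟩, hlt⟩ := exists_lt_of_lt_csSup
          (s := {v | ∃ f, Norming F θ f ∧ v = pairing f (restrict (E j) x)})
          ⟨_, _, Norming.basis 0, rfl⟩
          (sub_lt_self (mixedNorm F θ (restrict (E j) x)) (div_pos hε hn))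
        refine ⟨restrict (E j) f, norming_restrict hF _ hf, ?_, ?_⟩
        · rw [support_restrict]; intro a ha; exact (Finset.mem_filter.1 ha).2
        · rw [pairing_restrict]; linarith
      choose g hg hsub hle using hex
      have hsum : ∑ j, mixedNorm F θ (restrict (E j) x) ≤ ∑ j, pairing (g j) x + ε := by
        calc _ ≤ ∑ j, (pairing (g j) x + ε / (n + 1)) := Finset.sum_le_sum fun j _ => hle j
          _ = _ := by
            rw [Finset.sum_add_distrib]; simp; field_simp
      have hpair : θ i * ∑ j, pairing (g j) x ≤ mixedNorm F θ x := by
        rw [← pairing_smul_sum]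
        rcases norming_op_of_zero_or hF i g E hE hsub hg with h | h
        · rw [h]; simpa [pairing] using mixedNorm_nonneg hθ x
        · exact pairing_le_mixedNorm hθ h x
      have h1 := mul_le_mul_of_nonneg_left hsum (hθ i).1.le
      nlinarith [(hθ i).2]
  · intro b hb
    refine csSup_le ⟨_, _, Norming.basis 0, rfl⟩ ?_
    rintro _ ⟨f, hf, rfl⟩
    cases hf with
    | basis n =>
      rw [pairing_single, one_mul]
      exact (le_abs_self _).trans (hb (Or.inl ⟨n, rfl⟩))
    | neg_basis n =>
      rw [pairing_single, neg_one_mul]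
      exact (neg_le_abs _).trans (hb (Or.inl ⟨n, rfl⟩))
    | @op i n f hf hadm =>
      refine le_trans ?_ (hb (Or.inr ⟨i, n, _, hadm, rfl⟩))
      rw [pairing_smul_sum]
      refine mul_le_mul_of_nonneg_left (Finset.sum_le_sum fun j _ => ?_) (hθ i).1.le
      have hres : restrict (f j).support (f j) = f j := by
        ext k; simp only [restrict, Finsupp.filter_apply]
        split_ifs with h
        · rfl
        · exact (Finsupp.notMem_support_iff.1 h).symm
      calc pairing (f j) x = pairing (restrict (f j).support (f j)) x := by rw [hres]
        _ = pairing (f j) (restrict (f j).support x) := pairing_restrict _ _ _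
        _ ≤ _ := pairing_le_mixedNorm hθ (hf j) _

/-- For finitely many families, solutions of the implicit equation vanishing at `0` are
unique. -/
theorem implicit_unique [Finite I] (hθ : ∀ i, 0 < θ i ∧ θ i < 1) (p q : (ℕ →₀ ℝ) → ℝ)
    (hp0 : p 0 = 0) (hq0 : q 0 = 0) (hp : ∀ x, IsLUB (implicitSet F θ p x) (p x))
    (hq : ∀ x, IsLUB (implicitSet F θ q x) (q x)) (x : ℕ →₀ ℝ) : p x = q x := by
  have main : ∀ (N : ℕ) (p q : (ℕ →₀ ℝ) → ℝ), p 0 = 0 → q 0 = 0 →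
      (∀ x, IsLUB (implicitSet F θ p x) (p x)) → (∀ x, IsLUB (implicitSet F θ q x) (q x)) →
      (∀ y : ℕ →₀ ℝ, y.support.card < N → p y = q y) →
      ∀ x : ℕ →₀ ℝ, x.support.card = N → p x ≤ q x := by
    intro N p q hp0 hq0 hp hq ih x hx
    by_contra hlt
    push Not at hlt
    have hppos : 0 < p x := ((abs_nonneg (x 0)).trans ((hq x).1 (Or.inl ⟨0, rfl⟩))).trans_lt hlt
    cases nonempty_fintype I
    obtain ⟨c, hc1, hc⟩ : ∃ c : ℝ, c < 1 ∧ ∀ i, θ i ≤ c := by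
      rcases isEmpty_or_nonempty I with h | h
      · exact ⟨0, one_pos, fun i => h.elim i⟩
      · obtain ⟨i, hi⟩ := Finite.exists_max θ
        exact ⟨θ i, (hθ i).2, hi⟩
    have hub : max (q x) (c * p x) ∈ upperBounds (implicitSet F θ p x) := by
      rintro v (⟨n, rfl⟩ | ⟨i, n, E, hE, rfl⟩)
      · exact ((hq x).1 (Or.inl ⟨n, rfl⟩)).trans (le_max_left _ _)
      · by_cases hfull : ∃ j, restrict (E j) x = x
        · obtain ⟨j, hj⟩ := hfull
          refine le_trans ?_ (le_max_right _ _)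
          rw [Finset.sum_eq_single j, hj]
          · exact mul_le_mul_of_nonneg_right (hc i) hppos.le
          · intro l _ hl
            rw [show restrict (E l) x = 0 from ?_, hp0]
            ext k
            simp only [restrict, Finsupp.filter_apply, Finsupp.coe_zero, Pi.zero_apply]
            split_ifs with hk
            · by_contra hne
              have hkj : k ∈ E j := by
                have := Finsupp.mem_support_iff.2 hne
                rw [← hj, support_restrict] at this
                exact (Finset.mem_filter.1 this).2
              rcases lt_or_gt_of_ne hl with h | h
              · exact lt_irrefl _ (hE.1.2 l j h k hk k hkj)
              · exact lt_irrefl _ (hE.1.2 j l h k hkj k hk)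
            · rfl
          · simp
        · push Not at hfull
          refine le_trans (le_of_eq ?_) (((hq x).1 (Or.inr ⟨i, n, E, hE, rfl⟩)).trans
            (le_max_left _ _))
          congr 1
          refine Finset.sum_congr rfl fun j _ => ih _ ?_
          rw [← hx, support_restrict]
          refine Finset.card_lt_card (Finset.filter_ssubset.2 ?_)
          by_contra hall
          push Not at hall
          refine hfull j ?_
          ext k
          simp only [restrict, Finsupp.filter_apply]
          split_ifs with hk
          · rfl
          · by_contra hne
            exact hk (hall k (Finsupp.mem_support_iff.2 fun h => hne h.symm))
    have := (hp x).2 hub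
    rcases le_max_iff.1 this with h | h
    · linarith
    · nlinarith
  have : ∀ (N : ℕ) (x : ℕ →₀ ℝ), x.support.card = N → p x = q x := by
    intro N
    induction N using Nat.strong_induction_on with
    | _ N ih =>
      intro x hx
      exact le_antisymm
        (main N p q hp0 hq0 hp hq (fun y hy => ih _ hy y rfl) x hx)
        (main N q p hq0 hp0 hq hp (fun y hy => (ih _ hy y rfl).symm) x hx)
  exact this _ x rfl

/-- The mixed Tsirelson norm is the only solution of the implicit equation. -/
theorem eq_mixedNorm [Finite I] (hF : ∀ i, IsHereditary (F i)) (hθ : ∀ i, 0 < θ i ∧ θ i < 1)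
    (p : (ℕ →₀ ℝ) → ℝ) (hp0 : p 0 = 0) (hp : ∀ x, IsLUB (implicitSet F θ p x) (p x))
    (x : ℕ →₀ ℝ) : p x = mixedNorm F θ x := by
  refine implicit_unique hθ p _ hp0 ?_ hp (isLUB_mixedNorm hF hθ) x
  refine le_antisymm (csSup_le ⟨_, _, Norming.basis 0, rfl⟩ ?_) (mixedNorm_nonneg hθ 0)
  rintro _ ⟨f, _, rfl⟩
  simp [pairing]

end Implicit

/-! ### Ordinals and the ordering of the pairs -/

open Ordinal in
/-- `λ(α)` in the decomposition `α = ω ^ λ(α) * k(α) + ξ(α)`. -/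
def lam (α : Ordinal.{0}) : Ordinal.{0} := Ordinal.log ω α

open Ordinal in
/-- The integer `k(α)` in the decomposition `α = ω ^ λ(α) * k(α) + ξ(α)`. -/
def coef (α : Ordinal.{0}) : ℕ := Cardinal.toNat (α / ω ^ lam α).card

open Ordinal in
/-- `ξ(α)` in the decomposition `α = ω ^ λ(α) * k(α) + ξ(α)`. -/
def rest (α : Ordinal.{0}) : Ordinal.{0} := α % ω ^ lam α

open Ordinal in
theorem decomposition (α : Ordinal.{0}) (hα : α ≠ 0) :
    α = ω ^ lam α * (coef α : Ordinal.{0}) + rest α ∧ 0 < coef α ∧ rest α < ω ^ lam α := by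
  have hlt : α / ω ^ lam α < ω := Ordinal.div_opow_log_lt α one_lt_omega0
  obtain ⟨n, hn⟩ := Ordinal.lt_omega0.1 hlt
  have hc : coef α = n := by simp [coef, hn]
  refine ⟨?_, ?_, Ordinal.mod_lt _ (Ordinal.opow_pos _ omega0_pos).ne'⟩
  · rw [hc, ← hn, rest, Ordinal.div_add_mod]
  · have := Ordinal.div_opow_log_pos ω hα
    rw [hc]
    change 0 < α / ω ^ lam α at this
    rw [hn] at this
    exact_mod_cast this

open Ordinal Classical in
/-- `γ(α)`: equal to `α` if `α` is finite, and to `ω ^ ω ^ λ(λ(α))` if `α` is infinite. -/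
def gam (α : Ordinal.{0}) : Ordinal.{0} :=
  if α < ω then α else ω ^ ω ^ lam (lam α)

open Ordinal Classical in
/-- `n(α)`: equal to `1` if `α` is finite, and to `k(λ(α))` if `α` is infinite. -/
def expo (α : Ordinal.{0}) : ℕ :=
  if α < ω then 1 else coef (lam α)

/-- The logarithm of `θ ∈ (0, 1)` to the integer base `k`, with `log_1 θ = -∞`. -/
def logBase (k : ℕ) (θ : ℝ) : EReal :=
  if 2 ≤ k then ((Real.logb k θ : ℝ) : EReal) else ⊥

open Ordinal in
/-- The relation `(α₀, θ₀) ≤_T (α₁, θ₁)`. For a finite ordinal `α` the integer `γ(α) = α` is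
`coef α`. -/
def LeT (α₀ : Ordinal.{0}) (θ₀ : ℝ) (α₁ : Ordinal.{0}) (θ₁ : ℝ) : Prop :=
  (α₀ < ω ∧ α₁ < ω ∧ logBase (coef α₀) θ₀ ≤ logBase (coef α₁) θ₁) ∨
  ((ω ≤ α₀ ∨ ω ≤ α₁) ∧ ∃ m₀ m₁ : ℕ, 0 < m₀ ∧ 0 < m₁ ∧
    gam α₀ ^ (expo α₀ * m₀) ≤ gam α₁ ^ (expo α₁ * m₁) ∧ θ₀ ^ m₀ ≤ θ₁ ^ m₁)

/-! ### The constant -/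

open Classical in
/-- The exponents `m i`: `[log_{θ i} θ i₀] + 1` if `γ(α i) < γ(α i₀)`, and `n(α i₀)` otherwise. -/
def mexp {r : ℕ} (α : Fin r → Ordinal.{0}) (θ : Fin r → ℝ) (i₀ i : Fin r) : ℕ :=
  if gam (α i) < gam (α i₀) then ⌊Real.logb (θ i) (θ i₀)⌋₊ + 1 else expo (α i₀)

open Ordinal Classical in
/-- The constant
`C = 2 (1 + max_{α i infinite} k(α i)) ∏_{i ≠ i₀} θ i ^ (-(m i - 1)) ∏_{i ≠ i₀, δ i > 1} 2 / θ i`,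
where `δ i = ω ^ ξ(λ(α i))`, so that `δ i > 1` means `ξ(λ(α i)) ≠ 0`. -/
def constC {r : ℕ} (α : Fin r → Ordinal.{0}) (θ : Fin r → ℝ) (i₀ : Fin r) : ℝ :=
  2 * (1 + (((Finset.univ.filter fun i => ω ≤ α i).sup fun i => coef (α i) : ℕ) : ℝ)) *
    (∏ i ∈ Finset.univ.erase i₀, (1 / θ i) ^ (mexp α θ i₀ i - 1)) *
    ∏ i ∈ (Finset.univ.erase i₀).filter (fun i => 1 < ω ^ rest (lam (α i))), 2 / θ i

end Tsirelson

end

noncomputable section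

namespace Tsirelson

/-! ### Cantor-Bendixson ranks of compact hereditary families -/

/-! Admissibility is encoded by decreasing ordinals. In a compact hereditary family every member has
a Cantor–Bendixson rank; all but finitely many one-point extensions have smaller rank, while every
ordinal below the rank is a lower bound for the rank of infinitely many extensions. The family
$\mathcal B$ consists of the sets whose points $a$ carry decreasing ordinals below $\alpha_{i_0}$,
taken from finite sets $A(a)$; it is regular of index $\alpha_{i_0}$ (`family_regular`,
`index_family`). The set $N$ and the sets $A$ are built together (`exists_sparseSystem`): $N$ is so
sparse that the ordinals in $A$ can be converted back into points of members of $\mathcal F_{i_0}$,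
yet $A(q)$ contains all ordinals that the proof computes at earlier points of $N$.

Lower estimate: given a $\mathcal B$-admissible sequence in $N$, a member of $\mathcal F_{i_0}$
interpolating it is built greedily, its rank staying above the ordinals still to be used
(`SparseSystem.isAdmissible_of_family`). So norming functionals for $\mathcal B$ supported by $N$
are norming for the mixed space.

Upper estimate: along an $\mathcal F_i$-admissible sequence in $N$ the ranks of the initial segments
of the interpolating set drop at least every second step, so the sequence carries decreasing
ordinals below $2\cdot\alpha_i$. A norming functional of the mixed space is unfolded into a sum of
pieces from the dual ball of $T(\mathcal B,\theta_{i_0})$ that carry decreasing ordinals (`DecSum`).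
An operation $i$ turns a bound $\kappa$ on these ordinals into $(\kappa+1)\cdot 2\cdot\alpha_i$
(`TailSum.sum`). Conversely, grouping the pieces by the quotient of their ordinals by
$\Lambda=\omega^{\lambda(\alpha_{i_0})}\le\alpha_{i_0}$ and applying the $\theta_{i_0}$-operation to
each group divides the bound by $\Lambda$ (`DecSum.reduce`). New ordinals are available only at
later points of $N$, so each is handed to the next piece, and the first coordinate is split off
(`TailSum`).

What remains is bookkeeping. Write $\theta_{i_0}=\vartheta^d$ and $\theta_i\le\vartheta^{q_i}$. A
power of $\vartheta$ not yet combined into a factor $\theta_{i_0}$ is a state $u<d$, with a bound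
$K(u)$ on the ordinals. If $(K(u')+1)\cdot2\cdot\alpha_i\le\Lambda^kK(u)$ whenever $u'+q_i=u+kd$,
the bounds persist through the whole norming set (`exists_tailSum`); the outermost operation is
arranged to end with a finite bound $y$, whence a factor $1+y$. The order $\le_T$ yields the
inequalities $\theta_i\le\vartheta^{q_i}$ (`exists_weights`), and suitable $K$ exist because
$\gamma(\alpha_{i_0})$ absorbs smaller ordinals under multiplication (`exists_sizes`,
`exists_parameters`). -/

theorem charFun_injective : Function.Injective charFun := by
  intro s t h
  ext n
  have := congrFun h n
  simpa [charFun] using this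

/-- The `β`-th derivative of a family, as a family. -/
def stage (F : Set (Finset ℕ)) (β : Ordinal.{0}) : Set (Finset ℕ) :=
  {s | charFun s ∈ CantorBendixson.iteratedDerivedSet (toCantor F) β}

theorem mem_stage_zero {F : Set (Finset ℕ)} {s : Finset ℕ} : s ∈ stage F 0 ↔ s ∈ F := by
  simp only [stage, CantorBendixson.iteratedDerivedSet_zero, toCantor, Set.mem_ofPred_eq]
  exact charFun_injective.mem_set_image

theorem stage_antitone (F : Set (Finset ℕ)) : Antitone (stage F) :=
  fun _ _ h _ hs => CantorBendixson.iteratedDerivedSet_antitone _ h hs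

theorem stage_subset (F : Set (Finset ℕ)) (β : Ordinal.{0}) : stage F β ⊆ F :=
  fun _ hs => mem_stage_zero.1 (stage_antitone F zero_le hs)

theorem iteratedDerivedSet_eq_image (F : Set (Finset ℕ)) (β : Ordinal.{0}) :
    CantorBendixson.iteratedDerivedSet (toCantor F) β = charFun '' stage F β := by
  ext x
  constructor
  · intro hx
    obtain ⟨s, -, rfl⟩ : x ∈ toCantor F := by
      have := CantorBendixson.iteratedDerivedSet_antitone (toCantor F) zero_le hx
      simpa using this
    exact ⟨s, hx, rfl⟩
  · rintro ⟨s, hs, rfl⟩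
    exact hs

theorem mem_stage_limit {F : Set (Finset ℕ)} {β : Ordinal.{0}} (hβ : Order.IsSuccLimit β)
    {s : Finset ℕ} : s ∈ stage F β ↔ ∀ δ < β, s ∈ stage F δ := by
  simp [stage, CantorBendixson.iteratedDerivedSet_limit hβ]

/-- A neighbourhood basis of a point of the Cantor space: the cylinders. -/
theorem exists_cylinder_subset {x : ℕ → Bool} {U : Set (ℕ → Bool)} (hU : U ∈ 𝓝 x) :
    ∃ K : ℕ, ∀ y : ℕ → Bool, (∀ n < K, y n = x n) → y ∈ U := by
  rw [nhds_pi, Filter.mem_pi'] at hU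
  obtain ⟨I, t, ht, hsub⟩ := hU
  refine ⟨I.sup id + 1, fun y hy => hsub fun n hn => ?_⟩
  rw [hy n (Nat.lt_succ_of_le (Finset.le_sup (f := id) hn))]
  exact mem_of_mem_nhds (ht n)

theorem cylinder_mem_nhds (x : ℕ → Bool) (K : ℕ) : {y : ℕ → Bool | ∀ n < K, y n = x n} ∈ 𝓝 x := by
  have : {y : ℕ → Bool | ∀ n < K, y n = x n} = ⋂ n ∈ Finset.range K, {y | y n = x n} := by
    ext y; simp
  rw [this, Filter.biInter_finset_mem]
  intro n _
  have h : IsOpen ((fun y : ℕ → Bool => y n) ⁻¹' {x n}) :=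
    (isOpen_discrete _).preimage (continuous_apply n)
  exact h.mem_nhds rfl

/-- A member close to `s` contains `s`, and heredity cuts it down to `s` and one further point; so
accumulation at `s` amounts to infinitely many one-point extensions. Heredity of the stage is a
hypothesis here because `stage_hereditary` is proved by means of this lemma. -/
theorem mem_stage_add_one_of_hereditary {F : Set (Finset ℕ)} {β : Ordinal.{0}}
    (hβ : IsHereditary (stage F β)) {s : Finset ℕ} :
    s ∈ stage F (β + 1) ↔ {m | m ∉ s ∧ insert m s ∈ stage F β}.Infinite := by
  have key : s ∈ stage F (β + 1) ↔
      AccPt (charFun s) (Filter.principal (charFun '' stage F β)) ∧ s ∈ stage F β := by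
    rw [← iteratedDerivedSet_eq_image]
    simp [stage, mem_derivedSet]
  rw [key]
  constructor
  · rintro ⟨h, -⟩
    rw [accPt_iff_nhds] at h
    rw [Set.infinite_iff_exists_gt]
    intro K
    obtain ⟨_, ⟨hyU, t, ht, rfl⟩, hne⟩ :=
      -- Agreement up to `s.sup id` forces `s ⊆ t`; agreement up to `K` forces the new point beyond
      -- `K`.
      h _ (cylinder_mem_nhds (charFun s) (max (K + 1) (s.sup id + 1)))
    have hagree : ∀ n < max (K + 1) (s.sup id + 1), (n ∈ t ↔ n ∈ s) := by
      intro n hn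
      have := hyU n hn
      simpa [charFun] using this
    have hst : s ⊆ t := fun n hn => (hagree n (lt_max_of_lt_right
      (Nat.lt_succ_of_le (Finset.le_sup (f := id) hn)))).2 hn
    obtain ⟨m, hmt, hms⟩ : ∃ m ∈ t, m ∉ s := by
      by_contra hcon
      push Not at hcon
      exact hne (congrArg charFun (Finset.Subset.antisymm hcon hst))
    refine ⟨m, ⟨hms, hβ _ t (Finset.insert_subset hmt hst) ht⟩, ?_⟩
    by_contra hle
    exact hms ((hagree m (lt_max_of_lt_left (by omega))).1 hmt)
  · intro h
    obtain ⟨m, hm⟩ := h.nonempty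
    refine ⟨?_, hβ _ _ (Finset.subset_insert _ _) hm.2⟩
    rw [accPt_iff_nhds]
    intro U hU
    obtain ⟨K, hK⟩ := exists_cylinder_subset hU
    obtain ⟨m, ⟨hms, hm⟩, hKm⟩ := h.exists_gt K
    refine ⟨charFun (insert m s), ⟨hK _ fun n hn => ?_, _, hm, rfl⟩, fun he => ?_⟩
    · have : n ≠ m := by omega
      simp [charFun, this]
    · have := charFun_injective he
      exact hms (this ▸ Finset.mem_insert_self m s)

theorem stage_hereditary {F : Set (Finset ℕ)} (hF : IsHereditary F) (β : Ordinal.{0}) :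
    IsHereditary (stage F β) := by
  induction β using Ordinal.limitRecOn with
  | zero => intro s t hst ht; rw [mem_stage_zero] at *; exact hF s t hst ht
  | add_one β ih =>
    intro s t hst ht
    rw [mem_stage_add_one_of_hereditary ih] at *
    exact ht.mono fun m hm => ⟨fun h => hm.1 (hst h), ih _ _ (Finset.insert_subset_insert _ hst) hm.2⟩
  | limit β hβ ih =>
    intro s t hst ht
    rw [mem_stage_limit hβ] at *
    exact fun δ hδ => ih δ hδ s t hst (ht δ hδ)

theorem mem_stage_add_one {F : Set (Finset ℕ)} (hF : IsHereditary F) {β : Ordinal.{0}}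
    {s : Finset ℕ} :
    s ∈ stage F (β + 1) ↔ {m | m ∉ s ∧ insert m s ∈ stage F β}.Infinite :=
  mem_stage_add_one_of_hereditary (stage_hereditary hF β)

/-- A compact family has no strictly increasing sequence. -/
theorem IsCompactFamily.not_strictMono {F : Set (Finset ℕ)} (hc : IsCompactFamily F)
    (f : ℕ → Finset ℕ) (hf : ∀ k, f k ∈ F) : ¬ StrictMono f := by
  classical
  intro hmono
  set x : ℕ → Bool := fun n => decide (∃ k, n ∈ f k) with hx
  have hmem : x ∈ toCantor F := by
    rw [← hc.closure_eq, mem_closure_iff_nhds]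
    intro U hU
    obtain ⟨K, hK⟩ := exists_cylinder_subset hU
    have : ∀ n, ∃ k, (∃ j, n ∈ f j) → n ∈ f k := by
      intro n
      by_cases h : ∃ j, n ∈ f j
      · exact ⟨h.choose, fun _ => h.choose_spec⟩
      · exact ⟨0, fun h' => absurd h' h⟩
    choose k hk using this
    refine ⟨charFun (f ((Finset.range K).sup k)), hK _ fun n hn => ?_, _, hf _, rfl⟩
    simp only [charFun, hx, decide_eq_decide]
    exact ⟨fun h => ⟨_, h⟩, fun h => hmono.monotone
      (Finset.le_sup (Finset.mem_range.2 hn)) (hk n h)⟩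
  obtain ⟨s, -, hs⟩ := hmem
  have hsub : ∀ k, f k ⊆ s := by
    intro k n hn
    have := congrFun hs n
    simp only [charFun, hx, decide_eq_decide] at this
    exact this.2 ⟨k, hn⟩
  have hcard : ∀ k, k ≤ (f k).card := by
    intro k
    induction k with
    | zero => simp
    | succ k ih => exact ih.trans_lt (Finset.card_lt_card (hmono k.lt_succ_self))
  have h1 := hcard (s.card + 1)
  have h2 := Finset.card_le_card (hsub (s.card + 1))
  omega

/-- This allows induction from larger members to smaller ones, and the choice of members maximal for
inclusion. -/
theorem IsCompactFamily.wellFounded {F : Set (Finset ℕ)} (hc : IsCompactFamily F) :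
    WellFounded fun s t : F => t.1 ⊂ s.1 := by
  have : IsStrictOrder F fun s t : F => t.1 ⊂ s.1 :=
    { irrefl := fun s h => h.ne rfl, trans := fun _ _ _ h1 h2 => h2.trans h1 }
  rw [RelEmbedding.wellFounded_iff_isEmpty]
  refine ⟨fun e => hc.not_strictMono (fun k => (e k).1) (fun k => (e k).2) ?_⟩
  exact strictMono_nat_of_lt_succ fun k => e.map_rel_iff.2 k.lt_succ_self

/-- By induction along proper supersets: once all one-point extensions have disappeared, one more
derivative removes `s`. Hence the supremum defining `rank` is over a bounded set. -/
theorem exists_notMem_stage {F : Set (Finset ℕ)} (hc : IsCompactFamily F) (hF : IsHereditary F)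
    (s : Finset ℕ) : ∃ β, s ∉ stage F β := by
  by_cases hs : s ∈ F
  swap
  · exact ⟨0, fun h => hs (mem_stage_zero.1 h)⟩
  suffices H : ∀ s : F, ∃ β, s.1 ∉ stage F β from H ⟨s, hs⟩
  intro s
  induction s using hc.wellFounded.induction with
  | _ s ih =>
    have : ∀ m, ∃ β, m ∉ s.1 → insert m s.1 ∉ stage F β := by
      intro m
      by_cases hm : m ∉ s.1 ∧ insert m s.1 ∈ F
      · obtain ⟨β, hβ⟩ := ih ⟨_, hm.2⟩ (Finset.ssubset_insert hm.1)
        exact ⟨β, fun _ => hβ⟩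
      · exact ⟨0, fun h1 h2 => hm ⟨h1, mem_stage_zero.1 h2⟩⟩
    choose β hβ using this
    refine ⟨(⨆ m, β m) + 1, ?_⟩
    rw [mem_stage_add_one hF]
    intro h
    obtain ⟨m, hm⟩ := h.nonempty
    exact hβ m hm.1 (stage_antitone F (Ordinal.le_iSup β m) hm.2)

/-- The Cantor-Bendixson rank of a member of a compact hereditary family. -/
def rank (F : Set (Finset ℕ)) (s : Finset ℕ) : Ordinal.{0} := sSup {β | s ∈ stage F β}

section Rank

variable {F : Set (Finset ℕ)} (hc : IsCompactFamily F) (hF : IsHereditary F)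

include hc hF

/-- The supremum defining the rank is attained: limit stages are intersections, and at a successor a
missing stage would lower the supremum. -/
theorem mem_stage_iff {s : Finset ℕ} (hs : s ∈ F) {β : Ordinal.{0}} :
    s ∈ stage F β ↔ β ≤ rank F s := by
  obtain ⟨β₀, hβ₀⟩ := exists_notMem_stage hc hF s
  have hbdd : BddAbove {β | s ∈ stage F β} :=
    ⟨β₀, fun β hβ => le_of_not_gt fun h => hβ₀ (stage_antitone F h.le hβ)⟩
  have hmem : s ∈ stage F (rank F s) := by
    have hlt : ∀ δ < rank F s, s ∈ stage F δ := by
      intro δ hδ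
      obtain ⟨β, hβ, hlt⟩ := exists_lt_of_lt_csSup
        (s := {β | s ∈ stage F β}) ⟨0, mem_stage_zero.2 hs⟩ hδ
      exact stage_antitone F hlt.le hβ
    rcases Ordinal.zero_or_succ_or_isSuccLimit (rank F s) with h | ⟨δ, h⟩ | h
    · rw [h]; exact mem_stage_zero.2 hs
    · by_contra hcon
      have hle : rank F s ≤ δ := by
        refine csSup_le ⟨0, mem_stage_zero.2 hs⟩ fun β hβ => ?_
        by_contra hlt'
        push Not at hlt'
        refine hcon (stage_antitone F ?_ hβ)
        rw [← h]
        exact Order.succ_le_of_lt hlt'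
      rw [← h] at hle
      exact absurd (Order.lt_succ δ) (not_lt_of_ge hle)
    · exact (mem_stage_limit h).2 hlt
  exact ⟨fun h => le_csSup hbdd h, fun h => stage_antitone F h hmem⟩

theorem rank_anti {s t : Finset ℕ} (hst : s ⊆ t) (ht : t ∈ F) : rank F t ≤ rank F s :=
  (mem_stage_iff hc hF (hF s t hst ht)).1
    (stage_hereditary hF _ s t hst ((mem_stage_iff hc hF ht).2 le_rfl))

/-- Otherwise `s` would survive one more derivative. Together with `infinite_le_rank_insert` this is
the form in which derivatives are used later. -/
theorem finite_rank_le_rank_insert {s : Finset ℕ} (hs : s ∈ F) :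
    {m | m ∉ s ∧ insert m s ∈ F ∧ rank F s ≤ rank F (insert m s)}.Finite := by
  by_contra h
  have : s ∈ stage F (rank F s + 1) := by
    rw [mem_stage_add_one hF]
    exact Set.Infinite.mono (fun m hm => ⟨hm.1, (mem_stage_iff hc hF hm.2.1).2 hm.2.2⟩) h
  have := (mem_stage_iff hc hF hs).1 this
  exact absurd (Order.lt_add_one_iff.2 le_rfl) (not_lt_of_ge this)

theorem infinite_le_rank_insert {s : Finset ℕ} (hs : s ∈ F) {β : Ordinal.{0}}
    (hβ : β < rank F s) :
    {m | m ∉ s ∧ insert m s ∈ F ∧ β ≤ rank F (insert m s)}.Infinite := by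
  have : s ∈ stage F (β + 1) := (mem_stage_iff hc hF hs).2 (Order.add_one_le_of_lt hβ)
  rw [mem_stage_add_one hF] at this
  exact this.mono fun m hm => ⟨hm.1, stage_subset F _ hm.2,
    (mem_stage_iff hc hF (stage_subset F _ hm.2)).1 hm.2⟩

theorem iteratedDerivedSet_subset_iff {β : Ordinal.{0}} :
    CantorBendixson.iteratedDerivedSet (toCantor F) β ⊆ toCantor {∅} ↔
      ∀ s ∈ F, s.Nonempty → rank F s < β := by
  rw [iteratedDerivedSet_eq_image, toCantor, Set.image_subset_image_iff charFun_injective]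
  constructor
  · intro h s hs hne
    by_contra hle
    exact hne.ne_empty (h ((mem_stage_iff hc hF hs).2 (not_lt.1 hle)))
  · intro h s hs
    by_contra hne
    have hsF := stage_subset F _ hs
    exact absurd ((mem_stage_iff hc hF hsF).1 hs)
      (not_le_of_gt (h s hsF (Finset.nonempty_iff_ne_empty.2 hne)))

theorem index_le_iff {β : Ordinal.{0}} : index F ≤ β ↔ ∀ s ∈ F, s.Nonempty → rank F s < β := by
  have hne : {α | CantorBendixson.iteratedDerivedSet (toCantor F) α ⊆ toCantor {∅}}.Nonempty := by
    refine ⟨⨆ s : Finset ℕ, (rank F s + 1), (iteratedDerivedSet_subset_iff hc hF).2 ?_⟩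
    intro s _ _
    exact (Order.lt_add_one_iff.2 le_rfl).trans_le
      (Ordinal.le_iSup (fun s : Finset ℕ => rank F s + 1) s)
  have hmem : ∀ s ∈ F, s.Nonempty → rank F s < index F :=
    (iteratedDerivedSet_subset_iff hc hF).1 (csInf_mem hne)
  exact ⟨fun h s hs hn => (hmem s hs hn).trans_le h,
    fun h => csInf_le' ((iteratedDerivedSet_subset_iff hc hF).2 h)⟩

theorem rank_lt_index {s : Finset ℕ} (hs : s ∈ F) (hne : s.Nonempty) : rank F s < index F :=
  (index_le_iff hc hF).1 le_rfl s hs hne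

theorem exists_le_rank_of_lt_index {β : Ordinal.{0}} (hβ : β < index F) :
    ∃ s ∈ F, s.Nonempty ∧ β ≤ rank F s := by
  by_contra h
  push Not at h
  exact absurd ((index_le_iff hc hF).2 h) (not_le_of_gt hβ)

theorem exists_singleton_of_lt_index {β : Ordinal.{0}} (hβ : β < index F) :
    ∃ m, {m} ∈ F ∧ β ≤ rank F {m} := by
  obtain ⟨s, hs, ⟨m, hm⟩, hle⟩ := exists_le_rank_of_lt_index hc hF hβ
  have hsub : {m} ⊆ s := Finset.singleton_subset_iff.2 hm
  exact ⟨m, hF _ _ hsub hs, hle.trans (rank_anti hc hF hsub hs)⟩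

/-- Every ordinal below the index is a rank. -/
theorem exists_rank_eq_of_lt_index {β : Ordinal.{0}} (hβ : β < index F) :
    ∃ s ∈ F, rank F s = β := by
  obtain ⟨s, hs, -, hle⟩ := exists_le_rank_of_lt_index hc hF hβ
  -- A member maximal for inclusion among those of rank at least `β`: if its rank were larger, it
  -- would have a proper extension of the same kind.
  obtain ⟨t, ht, hmin⟩ := hc.wellFounded.has_min {t : F | β ≤ rank F t.1} ⟨⟨s, hs⟩, hle⟩
  refine ⟨t.1, t.2, (le_antisymm ?_ ht)⟩
  by_contra hlt
  obtain ⟨m, hm⟩ := (infinite_le_rank_insert hc hF t.2 (not_le.1 hlt)).nonempty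
  exact hmin ⟨_, hm.2.1⟩ hm.2.2 (Finset.ssubset_insert hm.1)

end Rank

end Tsirelson

end

noncomputable section

namespace Tsirelson

/-! ### Regular families of prescribed index -/

/-- The finite sets `{a 0 < … < a d}` which carry ordinals `α > β 0 > … > β d` with
`β j ∈ A (a j)`. -/
def family (α : Ordinal.{0}) (A : ℕ → Set Ordinal.{0}) : Set (Finset ℕ) :=
  {s | ∃ β : ℕ → Ordinal.{0}, StrictAntiOn β s ∧ ∀ a ∈ s, β a < α ∧ β a ∈ A a}

/-- All finite subsets of a limit point belong to `F` by heredity, so the hypothesis makes the limit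
point a finite set, and then a member. -/
theorem isCompactFamily_of_initial {F : Set (Finset ℕ)} (hF : IsHereditary F)
    (h : ∀ S : Set ℕ, (∀ s : Finset ℕ, (s : Set ℕ) ⊆ S → s ∈ F) → S.Finite) :
    IsCompactFamily F := by
  refine isClosed_of_closure_subset fun x hx => ?_
  have hsub : ∀ s : Finset ℕ, (s : Set ℕ) ⊆ {n | x n = true} → s ∈ F := by
    intro s hs
    obtain ⟨_, hy, t, ht, rfl⟩ :=
      mem_closure_iff_nhds.1 hx _ (cylinder_mem_nhds x (s.sup id + 1))
    refine hF s t (fun n hn => ?_) ht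
    have h1 := hy n (Nat.lt_succ_of_le (Finset.le_sup (f := id) hn))
    have h2 : x n = true := hs hn
    simpa [charFun, h2] using h1
  have hfin := h _ hsub
  refine ⟨hfin.toFinset, hsub _ (by simp), ?_⟩
  ext n
  simp [charFun]

section Family

variable {α : Ordinal.{0}} {A : ℕ → Set Ordinal.{0}}

theorem family_hereditary : IsHereditary (family α A) := by
  rintro s t hst ⟨β, hβ, h⟩
  exact ⟨β, hβ.mono (by exact_mod_cast hst), fun a ha => h a (hst ha)⟩

theorem family_spreading (hmono : Monotone A) : IsSpreading (family α A) := by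
  rintro _ _ ⟨n, a, b, ha, hb, rfl, rfl, hab⟩ ⟨β, hβ, h⟩
  -- Each point inherits the ordinal of the point it was moved from; the value `0` elsewhere plays
  -- no role.
  refine ⟨fun m => if hm : ∃ i, b i = m then β (a hm.choose) else 0, ?_, ?_⟩
  · intro x hx y hy hxy
    simp only [Finset.coe_image, Finset.coe_univ, Set.image_univ, Set.mem_range] at hx hy
    simp only [hx, hy, dif_pos]
    refine hβ (by simp) (by simp) (ha ?_)
    rw [← hb.lt_iff_lt, hx.choose_spec, hy.choose_spec]
    exact hxy
  · intro m hm
    have hm' : ∃ i, b i = m := by simpa using hm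
    simp only [hm', dif_pos]
    have h1 := h (a hm'.choose) (by simp)
    refine ⟨h1.1, hmono ?_ h1.2⟩
    exact (hab _).trans_eq hm'.choose_spec

/-- Only finitely many ordinals are allowed at `m`. The largest one possible there serves both for
compactness and for the rank. -/
theorem exists_max_witness (hfin : ∀ n, (A n).Finite) {s : Finset ℕ} (hs : s ∈ family α A)
    {m : ℕ} (hm : m ∈ s) : ∃ β : ℕ → Ordinal.{0}, (StrictAntiOn β s ∧ ∀ a ∈ s, β a < α ∧ β a ∈ A a) ∧
      ∀ β' : ℕ → Ordinal.{0}, (StrictAntiOn β' s ∧ ∀ a ∈ s, β' a < α ∧ β' a ∈ A a) →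
        β' m ≤ β m := by
  have hV : {v | ∃ β : ℕ → Ordinal.{0}, (StrictAntiOn β s ∧ ∀ a ∈ s, β a < α ∧ β a ∈ A a) ∧
      β m = v}.Finite := by
    refine (hfin m).subset ?_
    rintro _ ⟨β, hβ, rfl⟩
    exact (hβ.2 m hm).2
  obtain ⟨_, ⟨β, hβ, rfl⟩, hmax⟩ := Set.exists_max_image _ id hV
    (by obtain ⟨β, hβ⟩ := hs; exact ⟨_, β, hβ, rfl⟩)
  exact ⟨β, hβ, fun β' hβ' => hmax _ ⟨β', hβ', rfl⟩⟩

/-- If all finite subsets of an infinite set were members, the largest ordinals that can be placed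
on the last points of its initial segments would decrease strictly forever. -/
theorem family_compact (hfin : ∀ n, (A n).Finite) : IsCompactFamily (family α A) := by
  refine isCompactFamily_of_initial family_hereditary fun S hS => ?_
  by_contra hinf
  have hinf' : S.Infinite := hinf
  have := hinf'.to_subtype
  classical
  set e := Nat.orderEmbeddingOfSet S
  have heS : ∀ k, e k ∈ S := fun k => by
    have : e k ∈ Set.range e := ⟨k, rfl⟩
    rwa [Nat.orderEmbeddingOfSet_range] at this
  set s : ℕ → Finset ℕ := fun k => (Finset.range (k + 1)).image e
  have hmem : ∀ k, e k ∈ s k := fun k => Finset.mem_image.2 ⟨k, by simp, rfl⟩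
  have hs : ∀ k, s k ∈ family α A := fun k => hS _ (by
    intro n hn
    simp only [s, Finset.coe_image, Set.mem_image] at hn
    obtain ⟨j, -, rfl⟩ := hn
    exact heS j)
  choose β hβ hmax using fun k => exists_max_witness hfin (hs k) (hmem k)
  have hanti : StrictAnti fun k => β k (e k) := by
    refine strictAnti_nat_of_succ_lt fun k => ?_
    have hsub : s k ⊆ s (k + 1) := Finset.image_subset_image (Finset.range_mono (by omega))
    have h1 := hmax k (β (k + 1)) ⟨(hβ (k + 1)).1.mono (by exact_mod_cast hsub),
      fun a ha => (hβ (k + 1)).2 a (hsub ha)⟩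
    refine lt_of_lt_of_le ((hβ (k + 1)).1 (hsub (hmem k)) (hmem (k + 1)) ?_) h1
    exact e.strictMono (Nat.lt_succ_self k)
  exact not_strictAnti_of_wellFoundedLT _ hanti

theorem family_regular (hfin : ∀ n, (A n).Finite) (hmono : Monotone A) :
    IsRegular (family α A) :=
  ⟨family_compact hfin, family_hereditary, family_spreading hmono⟩

theorem insert_mem_family {s : Finset ℕ} {β : ℕ → Ordinal.{0}}
    (hβ : StrictAntiOn β s ∧ ∀ a ∈ s, β a < α ∧ β a ∈ A a) {m : ℕ} (hm : ∀ a ∈ s, a < m)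
    {v : Ordinal.{0}} (hv : v < α) (hvA : v ∈ A m) (hlt : ∀ a ∈ s, v < β a) :
    (StrictAntiOn (Function.update β m v) ↑(insert m s) ∧
      ∀ a ∈ insert m s, Function.update β m v a < α ∧ Function.update β m v a ∈ A a) := by
  have hne : ∀ a ∈ s, Function.update β m v a = β a := fun a ha =>
    Function.update_of_ne (hm a ha).ne _ _
  constructor
  · intro x hx y hy hxy
    simp only [Finset.coe_insert, Set.mem_insert_iff, Finset.mem_coe] at hx hy
    rcases hx with rfl | hx
    · rcases hy with rfl | hy
      · exact absurd hxy (lt_irrefl _)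
      · exact absurd hxy (hm y hy).not_gt
    · rcases hy with rfl | hy
      · rw [hne x hx, Function.update_self]; exact hlt x hx
      · rw [hne x hx, hne y hy]; exact hβ.1 hx hy hxy
  · intro a ha
    rcases Finset.mem_insert.1 ha with rfl | ha
    · simpa using ⟨hv, hvA⟩
    · rw [hne a ha]; exact hβ.2 a ha

variable (hfin : ∀ n, (A n).Finite) (hmono : Monotone A) (hex : ∀ β < α, ∃ n, β ∈ A n)

include hfin hmono hex

/-- If the rank `w` were below the last ordinal, `w` could be placed on every sufficiently large new
point; by induction these infinitely many extensions have rank at least `w`, which is impossible. -/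
theorem le_rank_family {s : Finset ℕ} {β : ℕ → Ordinal.{0}}
    (hβ : StrictAntiOn β s ∧ ∀ a ∈ s, β a < α ∧ β a ∈ A a) {m : ℕ} (hm : m ∈ s)
    (hmax : ∀ a ∈ s, a ≤ m) : β m ≤ rank (family α A) s := by
  have hc : IsCompactFamily (family α A) := family_compact hfin
  suffices H : ∀ (v : Ordinal.{0}) (s : Finset ℕ) (β : ℕ → Ordinal.{0}),
      (StrictAntiOn β s ∧ ∀ a ∈ s, β a < α ∧ β a ∈ A a) → ∀ m ∈ s, (∀ a ∈ s, a ≤ m) → β m = v →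
      v ≤ rank (family α A) s from H _ s β hβ m hm hmax rfl
  intro v
  induction v using WellFoundedLT.induction with
  | _ v ih =>
    rintro s β hβ m hm hmax rfl
    by_contra hlt
    push Not at hlt
    set w := rank (family α A) s
    have hw : w < α := hlt.trans (hβ.2 m hm).1
    obtain ⟨n, hn⟩ := hex w hw
    have hsF : s ∈ family α A := ⟨β, hβ⟩
    refine Set.Infinite.mono ?_ (Set.Ioi_infinite (max m n))
      (finite_rank_le_rank_insert hc family_hereditary hsF)
    intro k hk
    have hmk : m < k := (le_max_left _ _).trans_lt hk
    have hlast : ∀ a ∈ s, a < k := fun a ha => (hmax a ha).trans_lt hmk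
    have hwit := insert_mem_family hβ hlast hw (hmono ((le_max_right m n).trans (le_of_lt hk)) hn)
      (fun a ha => lt_of_lt_of_le hlt (hβ.1.antitoneOn ha hm (hmax a ha)))
    refine ⟨fun h => lt_irrefl _ (hlast k h), ⟨_, hwit⟩, ?_⟩
    refine ih w hlt _ _ hwit k (Finset.mem_insert_self _ _) ?_ (by simp)
    intro a ha
    rcases Finset.mem_insert.1 ha with rfl | ha
    · exact le_rfl
    · exact (hlast a ha).le

-- The converse of `le_rank_family`: for `w < v`, some extension by a point beyond `m` has rank at
-- least `w`, so by induction it has a witness with an ordinal at least `w` there, and hence a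
-- larger one at `m`; the maximal witness at `m` works for all `w` at once.
omit hmono hex in
theorem exists_witness_of_le_rank (v : Ordinal.{0}) : ∀ s ∈ family α A, ∀ m ∈ s,
    v ≤ rank (family α A) s → ∃ β : ℕ → Ordinal.{0},
      (StrictAntiOn β s ∧ ∀ a ∈ s, β a < α ∧ β a ∈ A a) ∧ v ≤ β m := by
  induction v using WellFoundedLT.induction with
  | _ v ih =>
    intro s hs m hm hv
    have hc : IsCompactFamily (family α A) := family_compact hfin
    obtain ⟨β, hβ, hmax⟩ := exists_max_witness hfin hs hm
    refine ⟨β, hβ, le_of_forall_lt fun w hw => ?_⟩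
    obtain ⟨k, ⟨hks, hkF, hkr⟩, hmk⟩ :=
      (infinite_le_rank_insert hc family_hereditary hs (hw.trans_le hv)).exists_gt m
    obtain ⟨β', hβ', hwβ⟩ := ih w hw _ hkF k (Finset.mem_insert_self _ _) hkr
    have hsub : s ⊆ insert k s := Finset.subset_insert _ _
    refine lt_of_lt_of_le ?_ (hmax β' ⟨hβ'.1.mono (by exact_mod_cast hsub),
      fun a ha => hβ'.2 a (hsub ha)⟩)
    exact hwβ.trans_lt (hβ'.1 (hsub hm) (Finset.mem_insert_self _ _) hmk)

theorem index_family : index (family α A) = α := by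
  have hc : IsCompactFamily (family α A) := family_compact hfin
  refine le_antisymm ((index_le_iff hc family_hereditary).2 fun s hs hne => ?_) ?_
  · obtain ⟨m, hm⟩ := hne
    obtain ⟨β, hβ, hle⟩ := exists_witness_of_le_rank hfin _ s hs m hm le_rfl
    exact hle.trans_lt (hβ.2 m hm).1
  · refine le_of_forall_lt fun v hv => ?_
    obtain ⟨n, hn⟩ := hex v hv
    have hw : StrictAntiOn (fun _ : ℕ => v) (({n} : Finset ℕ) : Set ℕ) ∧
        ∀ a ∈ ({n} : Finset ℕ), v < α ∧ v ∈ A a := by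
      refine ⟨?_, by simp [hv, hn]⟩
      rw [Finset.coe_singleton]
      exact Set.subsingleton_singleton.strictAntiOn _
    exact (le_rank_family hfin hmono hex hw (Finset.mem_singleton_self n) (by simp)).trans_lt
      (rank_lt_index hc family_hereditary ⟨_, hw⟩ (Finset.singleton_nonempty n))

end Family

end Tsirelson

end

noncomputable section

namespace Tsirelson

/-! ### Sparse sets of integers -/

/-- The ranks of the members of the families `F i` that are contained in `[0, p]`. -/
def rankSet {I : Type} (F : I → Set (Finset ℕ)) (p : ℕ) : Set Ordinal.{0} :=
  {ρ | ∃ i, ∃ t ∈ F i, t ⊆ Finset.range (p + 1) ∧ rank (F i) t = ρ}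

theorem finite_subsets_range (p : ℕ) : {t : Finset ℕ | t ⊆ Finset.range (p + 1)}.Finite :=
  ((Finset.range (p + 1)).powerset.finite_toSet).subset fun _ ht =>
    Finset.mem_coe.2 (Finset.mem_powerset.2 ht)

theorem finite_rankSet {I : Type} [Finite I] (F : I → Set (Finset ℕ)) (p : ℕ) :
    (rankSet F p).Finite := by
  have : (⋃ i, (fun t => rank (F i) t) '' {t | t ⊆ Finset.range (p + 1)}).Finite := by
    exact Set.finite_iUnion fun i => Set.Finite.image _ (finite_subsets_range p)
  refine this.subset ?_
  rintro _ ⟨i, t, -, ht, rfl⟩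
  exact Set.mem_iUnion.2 ⟨i, t, ht, rfl⟩

/-- `q` is so large compared with `p` that a member of `F` contained in `[0, p]` drops rank when
extended beyond `q`. -/
def DropsBeyond (F : Set (Finset ℕ)) (p q : ℕ) : Prop :=
  ∀ t ∈ F, t ⊆ Finset.range (p + 1) → ∀ m, q < m → insert m t ∈ F → rank F (insert m t) < rank F t

/-- A set of integers that is sparse for the families `F i`, together with finite sets `A n` of
ordinals that grow slowly with respect to `F i₀` but fast with respect to `Φ`. -/
structure SparseSystem {I : Type} (F : I → Set (Finset ℕ)) (i₀ : I)
    (Φ : ℕ → Set Ordinal.{0} → Set Ordinal.{0}) (N : Set ℕ) (A : ℕ → Set Ordinal.{0}) : Prop where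
  infinite : N.Infinite
  finite : ∀ n, (A n).Finite
  mono : Monotone A
  exhaust : ∀ β < index (F i₀), ∃ n, β ∈ A n
  lag : ∀ p ∈ N, ∀ q ∈ N, p < q → Φ p (A p) ⊆ A q
  drop : ∀ p ∈ N, ∀ q ∈ N, p < q → ∀ i, DropsBeyond (F i) p q
  first : ∀ q ∈ N, ∀ β ∈ A q, β < index (F i₀) →
    ∃ m ≤ q, {m} ∈ F i₀ ∧ β ≤ rank (F i₀) {m}
  next : ∀ p ∈ N, ∀ q ∈ N, p < q → ∀ t ∈ F i₀, t ⊆ Finset.range (p + 1) → ∀ β ∈ A q,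
    β < rank (F i₀) t → ∃ m ≤ q, (∀ p' ∈ N, p' < q → p' < m) ∧ insert m t ∈ F i₀ ∧
      β ≤ rank (F i₀) (insert m t)

/-! ### Construction of the sparse set and of the sets of ordinals -/

section Construction

variable {I : Type} [Finite I] {F : I → Set (Finset ℕ)} (hc : ∀ i, IsCompactFamily (F i))
  (hF : ∀ i, IsHereditary (F i))

include hc hF

omit [Finite I] in
theorem eventually_dropsBeyond (i : I) (p : ℕ) : ∀ᶠ q in Filter.atTop, DropsBeyond (F i) p q := by
  have h : ∀ t ∈ {t : Finset ℕ | t ⊆ Finset.range (p + 1)}, ∀ᶠ q in Filter.atTop,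
      t ∈ F i → ∀ m, q < m → insert m t ∈ F i → rank (F i) (insert m t) < rank (F i) t := by
    intro t ht
    by_cases htF : t ∈ F i
    · obtain ⟨b, hb⟩ := (finite_rank_le_rank_insert (hc i) (hF i) htF).bddAbove
      filter_upwards [Filter.eventually_ge_atTop (max b p)] with q hq _ m hm hmF
      by_contra hle
      have hmt : m ∉ t := fun h => by
        have := Finset.mem_range.1 (ht h)
        have := (le_max_right b p).trans hq
        omega
      have := hb ⟨hmt, hmF, not_lt.1 hle⟩
      have := (le_max_left b p).trans hq
      omega
    · exact Filter.Eventually.of_forall fun q h => absurd h htF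
  filter_upwards [(Filter.eventually_all_finite (finite_subsets_range p)).2 h] with q hq t htF ht
  exact hq t ht htF

omit [Finite I] in
theorem eventually_exists_singleton (i₀ : I) {S : Set Ordinal.{0}} (hS : S.Finite) :
    ∀ᶠ q in Filter.atTop, ∀ β ∈ S, β < index (F i₀) →
      ∃ m ≤ q, {m} ∈ F i₀ ∧ β ≤ rank (F i₀) {m} := by
  rw [Filter.eventually_all_finite hS]
  intro β _
  by_cases hβ : β < index (F i₀)
  · obtain ⟨m, hm⟩ := exists_singleton_of_lt_index (hc i₀) (hF i₀) hβ
    filter_upwards [Filter.eventually_ge_atTop m] with q hq _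
    exact ⟨m, hq, hm⟩
  · exact Filter.Eventually.of_forall fun q h => absurd h hβ

omit [Finite I] in
theorem eventually_exists_insert (i₀ : I) (p : ℕ) {S : Set Ordinal.{0}} (hS : S.Finite) :
    ∀ᶠ q in Filter.atTop, ∀ t ∈ {t : Finset ℕ | t ⊆ Finset.range (p + 1)}, ∀ β ∈ S, t ∈ F i₀ →
      β < rank (F i₀) t → ∃ m ≤ q, p < m ∧ insert m t ∈ F i₀ ∧
        β ≤ rank (F i₀) (insert m t) := by
  rw [Filter.eventually_all_finite (finite_subsets_range p)]
  intro t _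
  rw [Filter.eventually_all_finite hS]
  intro β _
  by_cases h : t ∈ F i₀ ∧ β < rank (F i₀) t
  · obtain ⟨m, hm, hpm⟩ := (infinite_le_rank_insert (hc i₀) (hF i₀) h.1 h.2).exists_gt p
    filter_upwards [Filter.eventually_ge_atTop m] with q hq _ _
    exact ⟨m, hq, hpm, hm.2⟩
  · exact Filter.Eventually.of_forall fun q h1 h2 => absurd ⟨h1, h2⟩ h

/-- The ordinals admitted at the next point are determined by the current point, before the next
point is chosen. Every requirement on the next point then concerns finitely many sets and ordinals
and holds for all large integers, so a recursion inside `M` succeeds. -/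
theorem exists_sparseSystem (i₀ : I) (Φ : ℕ → Set Ordinal.{0} → Set Ordinal.{0})
    (hΦ : ∀ p S, S.Finite → (Φ p S).Finite) {M : Set ℕ} (hM : M.Infinite) :
    ∃ N ⊆ M, ∃ A, SparseSystem F i₀ Φ N A := by
  have step : ∀ x : ℕ × {S : Set Ordinal.{0} // S.Finite}, ∃ y : ℕ × {S : Set Ordinal.{0} // S.Finite},
      (x.2.1 ∪ Φ x.1 x.2.1 ∪ rankSet F x.1 = y.2.1) ∧ y.1 ∈ M ∧ x.1 < y.1 ∧
      (∀ i, DropsBeyond (F i) x.1 y.1) ∧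
      (∀ β ∈ y.2.1, β < index (F i₀) → ∃ m ≤ y.1, {m} ∈ F i₀ ∧ β ≤ rank (F i₀) {m}) ∧
      (∀ t ∈ {t : Finset ℕ | t ⊆ Finset.range (x.1 + 1)}, ∀ β ∈ y.2.1, t ∈ F i₀ →
        β < rank (F i₀) t → ∃ m ≤ y.1, x.1 < m ∧ insert m t ∈ F i₀ ∧
          β ≤ rank (F i₀) (insert m t)) := by
    rintro ⟨p, S, hS⟩
    have hT : (S ∪ Φ p S ∪ rankSet F p).Finite := (hS.union (hΦ p S hS)).union (finite_rankSet F p)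
    have hfreq : ∃ᶠ q in Filter.atTop, q ∈ M := Nat.frequently_atTop_iff_infinite.2 hM
    obtain ⟨q, hqM, hpq, h1, h2, h3⟩ := (hfreq.and_eventually
      ((Filter.eventually_gt_atTop p).and
        ((Filter.eventually_all.2 fun i => eventually_dropsBeyond hc hF i p).and
          ((eventually_exists_singleton hc hF i₀ hT).and
            (eventually_exists_insert hc hF i₀ p hT))))).exists
    exact ⟨⟨q, _, hT⟩, rfl, hqM, hpq, h1, h2, h3⟩
  choose next hA hM' hlt hdrop hfirst hnext using step
  obtain ⟨m₀, hm₀⟩ := hM.nonempty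
  obtain ⟨x, hx0, hx1⟩ : ∃ x : ℕ → ℕ × {S : Set Ordinal.{0} // S.Finite},
      -- Starting with no ordinals makes the field `first` vacuous at the first point.
      x 0 = ⟨m₀, ∅, Set.finite_empty⟩ ∧ ∀ k, x (k + 1) = next (x k) :=
    ⟨fun k => Nat.rec ⟨m₀, ∅, Set.finite_empty⟩ (fun _ y => next y) k, rfl, fun _ => rfl⟩
  have hmono : StrictMono fun k => (x k).1 :=
    strictMono_nat_of_lt_succ fun k => by rw [hx1]; exact hlt _
  have hAmono : Monotone fun k => (x k).2.1 := by
    refine monotone_nat_of_le_succ fun k => ?_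
    simp only [hx1, ← hA]
    exact Set.subset_union_left.trans Set.subset_union_left
  obtain ⟨A, hAdef⟩ : ∃ A : ℕ → Set Ordinal.{0},
      ∀ n β, β ∈ A n ↔ ∃ k, (x k).1 ≤ n ∧ β ∈ (x k).2.1 :=
    ⟨fun n => {β | ∃ k, (x k).1 ≤ n ∧ β ∈ (x k).2.1}, fun _ _ => Iff.rfl⟩
  have hAx : ∀ k, A (x k).1 = (x k).2.1 := by
    intro k
    ext β
    rw [hAdef]
    exact ⟨fun ⟨j, hj, hβ⟩ => hAmono (hmono.le_iff_le.1 hj) hβ, fun h => ⟨k, le_rfl, h⟩⟩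
  refine ⟨Set.range fun k => (x k).1, ?_, A, ?_⟩
  · rintro _ ⟨k, rfl⟩
    cases k with
    | zero => simpa [hx0] using hm₀
    | succ k => simpa only [hx1] using hM' (x k)
  refine ⟨Set.infinite_range_of_injective hmono.injective, ?_, ?_, ?_, ?_, ?_, ?_, ?_⟩
  · intro n
    refine ((Set.finite_Iic n).biUnion fun k _ => (x k).2.2).subset ?_
    intro β hβ
    obtain ⟨k, hk, hβ⟩ := (hAdef _ _).1 hβ
    exact Set.mem_biUnion (hmono.id_le k |>.trans hk) hβ
  · intro n n' h β hβ
    obtain ⟨k, hk, hβ⟩ := (hAdef _ _).1 hβ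
    exact (hAdef _ _).2 ⟨k, hk.trans h, hβ⟩
  · intro β hβ
    -- Every ordinal below the index is the rank of some member, and `rankSet` was included at each
    -- step.
    obtain ⟨t, ht, rfl⟩ := exists_rank_eq_of_lt_index (hc i₀) (hF i₀) hβ
    refine ⟨(x (t.sup id + 1)).1, ?_⟩
    rw [hAx, hx1, ← hA]
    refine Or.inr ⟨i₀, t, ht, fun n hn => Finset.mem_range.2 (Nat.lt_succ_of_le ?_), rfl⟩
    exact (Finset.le_sup (f := id) hn).trans (hmono.id_le _)
  · rintro _ ⟨j, rfl⟩ _ ⟨k, rfl⟩ hjk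
    have hjk' : j + 1 ≤ k := hmono.lt_iff_lt.1 hjk
    simp only [hAx]
    refine Set.Subset.trans ?_ (hAmono hjk')
    simp only [hx1, ← hA]
    exact Set.subset_union_right.trans Set.subset_union_left
  · rintro _ ⟨j, rfl⟩ _ ⟨k, rfl⟩ hjk i t ht htp m hm hmt
    refine hdrop (x j) i t ht htp m (lt_of_le_of_lt ?_ hm) hmt
    rw [← hx1]
    exact hmono.monotone (hmono.lt_iff_lt.1 hjk)
  · rintro _ ⟨k, rfl⟩ β hβ
    simp only [hAx] at hβ
    cases k with
    | zero => simp [hx0] at hβ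
    | succ k =>
      simp only [hx1] at hβ ⊢
      exact hfirst (x k) β hβ
  · rintro _ ⟨j, rfl⟩ _ ⟨k, rfl⟩ hjk t ht htp β hβ hlt'
    simp only [hAx] at hβ
    have hjk' : j < k := hmono.lt_iff_lt.1 hjk
    obtain ⟨k, rfl⟩ : ∃ l, k = l + 1 := ⟨k - 1, by omega⟩
    have hjk'' : (x j).1 ≤ (x k).1 := hmono.monotone (by omega)
    simp only [hx1] at hβ ⊢
    obtain ⟨m, hm, hkm, h⟩ := hnext (x k) t
      (htp.trans (Finset.range_mono (Nat.succ_le_succ hjk''))) β hβ ht hlt'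
    refine ⟨m, hm, ?_, h⟩
    rintro _ ⟨l, rfl⟩ hl
    have hl' : l < k + 1 := hmono.lt_iff_lt.1 (show (x l).1 < (x (k + 1)).1 by rwa [hx1])
    exact lt_of_le_of_lt (hmono.monotone (Nat.lt_succ_iff.1 hl')) hkm

end Construction

end Tsirelson

end

noncomputable section

namespace Tsirelson

/-! ### Admissible sequences supported by a sparse set -/

theorem two_mul_add_one_lt {ρ σ : Ordinal.{0}} (h : ρ < σ) : 2 * ρ + 1 < 2 * σ := by
  calc 2 * ρ + 1 < 2 * ρ + 2 := by
        rw [add_lt_add_iff_left]; exact_mod_cast Nat.lt_succ_self 1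
    _ = 2 * (ρ + 1) := by rw [mul_add, mul_one]
    _ ≤ 2 * σ := mul_le_mul_right (Order.add_one_le_of_lt h) 2

section Admissible

variable {I : Type} {F : I → Set (Finset ℕ)} {i₀ : I} {Φ : ℕ → Set Ordinal.{0} → Set Ordinal.{0}}
  {N : Set ℕ} {A : ℕ → Set Ordinal.{0}}

/-- Greedy choice: the current member of `F i₀` has rank above the ordinals still to be used, and
`next` adds a point without destroying this. The new point lies above all points of `N` before `q
j`, as interpolation requires. -/
theorem SparseSystem.exists_union_mem (hS : SparseSystem F i₀ Φ N A) (n : ℕ) :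
    ∀ t ∈ F i₀, ∀ p ∈ N, t ⊆ Finset.range (p + 1) → ∀ q : Fin n → ℕ, StrictMono q →
      (∀ j, q j ∈ N ∧ p < q j) → ∀ β : Fin n → Ordinal.{0}, StrictAnti β →
      (∀ j, β j ∈ A (q j) ∧ β j < rank (F i₀) t) →
      ∃ m : Fin n → ℕ, (∀ j, m j ≤ q j ∧ ∀ p' ∈ N, p' < q j → p' < m j) ∧
        t ∪ Finset.univ.image m ∈ F i₀ := by
  induction n with
  | zero => intro t ht p _ _ q _ _ β _ _; exact ⟨Fin.elim0, fun j => j.elim0, by simpa using ht⟩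
  | succ n ih =>
    intro t ht p hp htp q hq hqN β hβ hβA
    obtain ⟨m, hmq, hm, hmF, hr⟩ := hS.next p hp (q 0) (hqN 0).1 (hqN 0).2 t ht htp (β 0)
      (hβA 0).1 (hβA 0).2
    obtain ⟨m', hm', hF'⟩ := ih (insert m t) hmF (q 0) (hqN 0).1 (by
        intro a ha
        rcases Finset.mem_insert.1 ha with rfl | ha
        · exact Finset.mem_range.2 (by omega)
        · have := Finset.mem_range.1 (htp ha)
          have := (hqN 0).2
          exact Finset.mem_range.2 (by omega))
      (fun j => q j.succ) (fun i j h => hq (Fin.succ_lt_succ_iff.2 h))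
      (fun j => ⟨(hqN _).1, hq (Fin.succ_pos j)⟩) (fun j => β j.succ)
      (fun i j h => hβ (Fin.succ_lt_succ_iff.2 h))
      (fun j => ⟨(hβA _).1, (hβ (Fin.succ_pos j)).trans_le hr⟩)
    refine ⟨Fin.cons m m', fun j => ?_, ?_⟩
    · refine Fin.cases ?_ (fun j => ?_) j
      · exact ⟨hmq, hm⟩
      · exact hm' j
    · convert hF' using 1
      ext a
      simp [Fin.exists_fin_succ, eq_comm, or_left_comm]

/-- On a sparse set, admissibility for the family of slow growth implies admissibility for the
given family. -/
theorem SparseSystem.isAdmissible_of_family (hS : SparseSystem F i₀ Φ N A) {n : ℕ}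
    {E : Fin n → Finset ℕ} (hE : IsAdmissible (family (index (F i₀)) A) E)
    (hEN : ∀ j, (E j : Set ℕ) ⊆ N) (hn : n ≠ 0) : IsAdmissible (F i₀) E := by
  obtain ⟨k, rfl⟩ := Nat.exists_eq_succ_of_ne_zero hn
  obtain ⟨hb, t, ⟨β, hβ, hβA⟩, m, hm, rfl, h1, h2⟩ := hE
  refine ⟨hb, ?_⟩
  have hmt : ∀ j, m j ∈ Finset.univ.image m := fun j => Finset.mem_image_of_mem _ (Finset.mem_univ j)
  set q : Fin (k + 1) → ℕ := fun j => (E j).min' (hb.1 j) with hq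
  have hqE : ∀ j, q j ∈ E j := fun j => Finset.min'_mem _ _
  have hqN : ∀ j, q j ∈ N := fun j => hEN j (hqE j)
  have hqmono : StrictMono q := fun i j h => hb.2 i j h _ (hqE i) _ (hqE j)
  have hβq : ∀ j, β (m j) ∈ A (q j) := fun j =>
    hS.mono (h1 j _ (hqE j)) (hβA _ (hmt j)).2
  obtain ⟨a, haq, haF, har⟩ := hS.first (q 0) (hqN 0) (β (m 0)) (hβq 0) (hβA _ (hmt 0)).1
  obtain ⟨m', hm', hF'⟩ := hS.exists_union_mem k {a} haF (q 0) (hqN 0)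
    (by rw [Finset.singleton_subset_iff, Finset.mem_range]; omega)
    (fun j => q j.succ) (fun i j h => hqmono (Fin.succ_lt_succ_iff.2 h))
    (fun j => ⟨hqN _, hqmono (Fin.succ_pos j)⟩) (fun j => β (m j.succ))
    (fun i j h => hβ (hmt _) (hmt _) (hm (Fin.succ_lt_succ_iff.2 h)))
    (fun j => ⟨hβq _, (hβ (hmt _) (hmt _) (hm (Fin.succ_pos j))).trans_le har⟩)
  set m'' : Fin (k + 1) → ℕ := Fin.cons a m' with hm''
  have hle : ∀ j, m'' j ≤ q j := fun j => by
    refine Fin.cases haq (fun j => ?_) j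
    exact (hm' j).1
  have hlt : ∀ i j, i < j → ∀ p ∈ N, p < q j → p < m'' j := fun i j hij => by
    obtain ⟨j, rfl⟩ := Fin.exists_succ_eq.2 (Fin.ne_zero_of_lt hij)
    exact (hm' j).2
  refine ⟨Finset.univ.image m'', ?_, m'', ?_, rfl, ?_, ?_⟩
  · convert hF' using 1
    ext b
    simp [hm'', Fin.exists_fin_succ, eq_comm]
  · exact fun i j h => (hle i).trans_lt (hlt i j h _ (hqN i) (hqmono h))
  · exact fun j b hbj => (hle j).trans (Finset.min'_le _ _ hbj)
  · exact fun i j hij b hbi => hlt i j hij b (hEN i hbi) (hb.2 i j hij b hbi _ (hqE j))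

/-- On a sparse set, the members of an admissible sequence carry decreasing ordinals. -/
theorem SparseSystem.exists_ordinals_of_isAdmissible (hS : SparseSystem F i₀ Φ N A)
    (hc : ∀ i, IsCompactFamily (F i)) (hF : ∀ i, IsHereditary (F i)) (i : I) {n : ℕ}
    {E : Fin n → Finset ℕ} (hE : IsAdmissible (F i) E) (hEN : ∀ j, (E j : Set ℕ) ⊆ N)
    (p : Fin n → ℕ) (hp : ∀ j, p j ∈ E j) :
    ∃ β : Fin n → Ordinal.{0}, StrictAnti β ∧ (∀ j, β j < 2 * index (F i)) ∧
      ∀ j, ∃ ρ ∈ rankSet F (p j), β j = 2 * ρ ∨ β j = 2 * ρ + 1 := by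
  classical
  obtain ⟨hb, t, ht, m, hm, rfl, h1, h2⟩ := hE
  set T : Fin n → Finset ℕ := fun j => (Finset.Iic j).image m with hT
  have hTmono : ∀ i j, i ≤ j → T i ⊆ T j := fun i j h =>
    Finset.image_subset_image (Finset.Iic_subset_Iic.2 h)
  have hTF : ∀ j, T j ∈ F i := fun j =>
    hF i _ _ (Finset.image_subset_image (Finset.subset_univ _)) ht
  have hmT : ∀ j, m j ∈ T j := fun j => Finset.mem_image_of_mem _ (by simp)
  have hTp : ∀ j, T j ⊆ Finset.range (p j + 1) := by
    intro j a ha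
    obtain ⟨k, hk, rfl⟩ := Finset.mem_image.1 ha
    have := hm.monotone (Finset.mem_Iic.1 hk)
    have := h1 j _ (hp j)
    exact Finset.mem_range.2 (by omega)
  set ρ : Fin n → Ordinal.{0} := fun j => rank (F i) (T j) with hρ
  have hanti : ∀ j k, j ≤ k → ρ k ≤ ρ j := fun j k h => rank_anti (hc i) (hF i) (hTmono j k h) (hTF k)
  -- Two steps are needed: `m k` is only known to lie beyond `E j`, perhaps before the next point of
  -- `N`, whereas `m l` lies beyond `p k`, a point of `N` after `p j`.
  have hdrop : ∀ j k l, j < k → k < l → ρ l < ρ j := by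
    intro j k l hjk hkl
    have hsub : insert (m l) (T j) ⊆ T l :=
      Finset.insert_subset (hmT l) (hTmono j l (hjk.trans hkl).le)
    refine (rank_anti (hc i) (hF i) hsub (hTF l)).trans_lt ?_
    exact hS.drop (p j) (hEN j (hp j)) (p k) (hEN k (hp k)) (hb.2 j k hjk _ (hp j) _ (hp k)) i
      (T j) (hTF j) (hTp j) (m l) (h2 k l hkl _ (hp k)) (hF i _ _ hsub (hTF l))
  have hindex : ∀ j, ρ j < index (F i) := fun j => rank_lt_index (hc i) (hF i) (hTF j) ⟨_, hmT j⟩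
  -- A rank occurs at most twice; the first of two occurrences gets `2 * ρ + 1` and the second `2 *
  -- ρ`.
  refine ⟨fun j => if ∃ k, j < k ∧ ρ k = ρ j then 2 * ρ j + 1 else 2 * ρ j, ?_, ?_, ?_⟩
  · intro j k hjk
    rcases (hanti j k hjk.le).lt_or_eq with h | h
    · have h3 := two_mul_add_one_lt h
      have h4 : 2 * ρ k < 2 * ρ k + 1 := Order.lt_add_one_iff.2 le_rfl
      have h5 : 2 * ρ j < 2 * ρ j + 1 := Order.lt_add_one_iff.2 le_rfl
      dsimp only
      split_ifs
      · exact h3.trans h5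
      · exact h3
      · exact h4.trans (h3.trans h5)
      · exact h4.trans h3
    · have hj : ∃ l, j < l ∧ ρ l = ρ j := ⟨k, hjk, h⟩
      have hk : ¬ ∃ l, k < l ∧ ρ l = ρ k := by
        rintro ⟨l, hkl, hl⟩
        exact (hdrop j k l hjk hkl).ne (hl.trans h)
      dsimp only
      rw [if_pos hj, if_neg hk, h]
      exact Order.lt_add_one_iff.2 le_rfl
  · intro j
    have h3 := two_mul_add_one_lt (hindex j)
    dsimp only
    split_ifs
    · exact h3
    · exact (Order.lt_add_one_iff.2 le_rfl).trans h3
  · intro j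
    refine ⟨ρ j, ⟨i, T j, hTF j, hTp j, rfl⟩, ?_⟩
    dsimp only
    split_ifs
    · exact Or.inr rfl
    · exact Or.inl rfl

end Admissible

end Tsirelson

end

noncomputable section

namespace Tsirelson

/-! ### Sums of successive functionals marked by decreasing ordinals -/

/-- `f` is a sum of successive functionals with the property `P`, supported by `[l, u)`, which carry
marks `p ∈ N` and ordinals `μ ∈ A p` that decrease and are less than `ν`. -/
inductive DecSum (N : Set ℕ) (A : ℕ → Set Ordinal.{0}) (P : (ℕ →₀ ℝ) → Prop) :
    Ordinal.{0} → ℕ → ℕ → (ℕ →₀ ℝ) → Prop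
  | zero {ν : Ordinal.{0}} {l u : ℕ} (hlu : l ≤ u) : DecSum N A P ν l u 0
  | cons {ν μ : Ordinal.{0}} {l p l' u : ℕ} {g h : ℕ →₀ ℝ} (hlp : l ≤ p) (hp : p ∈ N)
      (hμ : μ < ν) (hA : μ ∈ A p) (hg : P g) (hs : ∀ a ∈ g.support, p ≤ a ∧ a < l')
      (hpl : p < l') (hh : DecSum N A P μ l' u h) : DecSum N A P ν l u (g + h)

section DecSum

variable {N : Set ℕ} {A D Z : ℕ → Set Ordinal.{0}} {P : (ℕ →₀ ℝ) → Prop} {ν κ : Ordinal.{0}}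
  {l u : ℕ} {f : ℕ →₀ ℝ}

theorem DecSum.le (h : DecSum N A P ν l u f) : l ≤ u := by
  induction h with
  | zero h => exact h
  | cons hlp _ _ _ _ _ hpl _ ih => omega

theorem DecSum.mono_left (h : DecSum N A P ν l u f) {l' : ℕ} (hl : l' ≤ l) {ν' : Ordinal.{0}}
    (hν : ν ≤ ν') : DecSum N A P ν' l' u f := by
  cases h with
  | zero h => exact .zero (hl.trans h)
  | cons hlp hp hμ hA hg hs hpl hh =>
    exact .cons (hl.trans hlp) hp (hμ.trans_le hν) hA hg hs hpl hh

theorem DecSum.mono_ordinals (h : DecSum N D P ν l u f) (hDA : ∀ p ∈ N, D p ⊆ A p) :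
    DecSum N A P ν l u f := by
  induction h with
  | zero h => exact .zero h
  | cons hlp hp hμ hA hg hs hpl _ ih => exact .cons hlp hp hμ (hDA _ hp hA) hg hs hpl ih

theorem DecSum.support (h : DecSum N A P ν l u f) : ∀ a ∈ f.support, l ≤ a ∧ a < u := by
  classical
  induction h with
  | zero h => simp
  | cons hlp hp hμ hA hg hs hpl hh ih =>
    intro a ha
    have hlu := hh.le
    rcases Finset.mem_union.1 (Finsupp.support_add ha) with ha | ha
    · have := hs a ha; omega
    · have := ih a ha; omega

theorem DecSum.smul (hP : ∀ (c : ℝ) g, |c| ≤ 1 → P g → P (c • g)) {c : ℝ} (hc : |c| ≤ 1)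
    (h : DecSum N A P ν l u f) : DecSum N A P ν l u (c • f) := by
  induction h with
  | zero h => rw [smul_zero]; exact .zero h
  | cons hlp hp hμ hA hg hs hpl hh ih =>
    rw [smul_add]
    exact .cons hlp hp hμ hA (hP c _ hc hg) (fun a ha => hs a (Finsupp.support_smul ha)) hpl ih

/-- Adding `σ` on the left lifts the ordinals of the first sum above those of the second and keeps
them decreasing. -/
theorem DecSum.append {σ : Ordinal.{0}} {v : ℕ} {g : ℕ →₀ ℝ} (hg : DecSum N D P κ l u g)
    (hf : DecSum N Z P σ u v f) (hZ : ∀ p ∈ N, l ≤ p → ∀ μ ∈ D p, σ + μ ∈ Z p) :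
    DecSum N Z P (σ + κ) l v (g + f) := by
  induction hg with
  | zero h => rw [zero_add]; exact hf.mono_left h le_self_add
  | cons hlp hp hμ hA hg hs hpl hh ih =>
    rw [add_assoc]
    refine .cons hlp hp (by gcongr) (hZ _ hp hlp _ hA) hg hs hpl (ih hf fun q hq hlq => hZ q hq ?_)
    omega

/-- Marking each functional by the ordinal of the preceding one. -/
theorem DecSum.lag (hZ : ∀ p ∈ N, ∀ q ∈ N, p < q → Z p ⊆ D q) (h : DecSum N Z P ν l u f) :
    ∀ μ : Ordinal.{0}, ν ≤ μ → (∀ p ∈ N, l ≤ p → μ ∈ D p) → DecSum N D P (μ + 1) l u f := by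
  induction h with
  | zero h => intro μ _ _; exact .zero h
  | cons hlp hp hμ hA hg hs hpl hh ih =>
    intro μ hνμ hD
    refine .cons hlp hp (Order.lt_add_one_iff.2 le_rfl) (hD _ hp hlp) hg hs hpl
      ((ih _ le_rfl fun q hq hlq => hZ _ hp q hq (by omega) hA).mono_left le_rfl ?_)
    exact Order.add_one_le_of_lt (hμ.trans_le hνμ)

theorem DecSum.eq_zero (h : DecSum N A P 0 l u f) : f = 0 := by
  cases h with
  | zero h => rfl
  | cons hlp hp hμ => exact absurd hμ not_lt_zero

variable {Λ : Ordinal.{0}} {θ : ℝ}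

/-- Pieces whose ordinals have the same quotient by `Λ` have remainders decreasing below `Λ`, so
each such group becomes one piece under an operation and keeps only the quotient. The part `g` is
the group still open, whose quotient is that of `ν` itself. -/
theorem DecSum.exists_div (hΛ : Λ ≠ 0) (hD : ∀ p ∈ N, ∀ μ ∈ D p, μ / Λ ∈ D p ∧ μ % Λ ∈ D p)
    (hop : ∀ l u f, DecSum N D P Λ l u f → P (θ • f)) (h : DecSum N D P ν l u f) :
    ∃ l' g h, f = g + h ∧ l ≤ l' ∧ DecSum N D P (ν % Λ) l l' g ∧
      DecSum N D P (ν / Λ) l' u (θ • h) := by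
  classical
  induction h with
  | @zero ν l u h =>
    exact ⟨u, 0, 0, by simp, h, .zero h, by rw [smul_zero]; exact .zero le_rfl⟩
  | @cons ν μ l p l' u g₀ h₀ hlp hp hμ hA hg hs hpl hh ih =>
    obtain ⟨l'', g, h, rfl, hl, hg', hh'⟩ := ih
    have hle : μ / Λ ≤ ν / Λ := Ordinal.div_le_left hμ.le Λ
    -- If the quotient of the new ordinal is below that of `ν`, its group is complete and is closed
    -- by an operation; otherwise the group stays open.
    rcases hle.lt_or_eq with hlt | heq
    · have hblock : DecSum N D P Λ l l'' (g₀ + g) :=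
        .cons hlp hp (Ordinal.mod_lt μ hΛ) (hD p hp μ hA).2 hg hs hpl hg'
      refine ⟨l, 0, (g₀ + g) + h, by rw [zero_add, add_assoc], le_rfl, .zero le_rfl, ?_⟩
      rw [smul_add]
      refine .cons hlp hp hlt (hD p hp μ hA).1 (hop _ _ _ hblock) (fun a ha => ?_) (hpl.trans_le hl)
        hh'
      rcases Finset.mem_union.1 (Finsupp.support_add (Finsupp.support_smul ha)) with ha | ha
      · have := hs a ha; omega
      · have := hg'.support a ha; omega
    · refine ⟨l'', g₀ + g, h, by rw [add_assoc], by omega, .cons hlp hp ?_ (hD p hp μ hA).2 hg hs hpl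
        hg', by rwa [← heq]⟩
      have h1 := Ordinal.div_add_mod μ Λ
      have h2 := Ordinal.div_add_mod ν Λ
      rw [heq] at h1
      have h3 : Λ * (ν / Λ) + μ % Λ < Λ * (ν / Λ) + ν % Λ := by rwa [h1, h2]
      exact lt_of_add_lt_add_left h3

/-- The bound is a left multiple of `Λ`, so its remainder is zero and no group stays open. -/
theorem DecSum.reduce (hΛ : Λ ≠ 0) (hD : ∀ p ∈ N, ∀ μ ∈ D p, μ / Λ ∈ D p ∧ μ % Λ ∈ D p)
    (hop : ∀ l u f, DecSum N D P Λ l u f → P (θ • f)) {k : ℕ} (h : DecSum N D P (Λ ^ k * ν) l u f) :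
    DecSum N D P ν l u (θ ^ k • f) := by
  induction k generalizing f with
  | zero => simpa using h
  | succ k ih =>
    rw [pow_succ', mul_assoc] at h
    obtain ⟨l', g, h', rfl, hl, hg, hh⟩ := h.exists_div hΛ hD hop
    rw [Ordinal.mul_mod] at hg
    rw [Ordinal.mul_div_cancel _ hΛ] at hh
    rw [hg.eq_zero, zero_add, pow_succ, mul_smul]
    exact ih (hh.mono_left hl le_rfl)

theorem pairing_add (f g x : ℕ →₀ ℝ) : pairing (f + g) x = pairing f x + pairing g x := by
  simp [pairing, add_mul, Finset.sum_add_distrib]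

theorem DecSum.abs_pairing_le {x : ℕ →₀ ℝ} {c : ℝ} (hc : 0 ≤ c) (hP : ∀ g, P g → |pairing g x| ≤ c)
    (h : DecSum N A P ν l u f) : ∀ k : ℕ, ν ≤ k → |pairing f x| ≤ k * c := by
  induction h with
  | zero h => intro k _; simp only [pairing, Finsupp.coe_zero, Pi.zero_apply, zero_mul,
      Finset.sum_const_zero, abs_zero]; positivity
  | cons hlp hp hμ hA hg hs hpl hh ih =>
    intro k hk
    obtain ⟨j, rfl⟩ : ∃ j, k = j + 1 := by
      cases k with
      | zero => simp only [Nat.cast_zero] at hk; exact absurd (hμ.trans_le hk) not_lt_zero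
      | succ j => exact ⟨j, rfl⟩
    have h1 := ih j (Order.lt_add_one_iff.1 (by exact_mod_cast hμ.trans_le hk))
    rw [pairing_add]
    push_cast
    exact (abs_add_le _ _).trans (by linarith [hP _ hg])

end DecSum

/-! ### The step from the members of an admissible sequence to their sum -/

section Step

variable {N : Set ℕ} {D Z : ℕ → Set Ordinal.{0}} {P : (ℕ →₀ ℝ) → Prop} {κ : Ordinal.{0}} {s : ℝ}

/-- The multiple `s • f` is, up to the first coordinate `p` of `f`, a marked sum. -/
structure TailSum (N : Set ℕ) (D : ℕ → Set Ordinal.{0}) (P : (ℕ →₀ ℝ) → Prop) (κ : Ordinal.{0})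
    (s : ℝ) (p : ℕ) (f : ℕ →₀ ℝ) : Prop where
  mem_support : p ∈ f.support
  le : ∀ a ∈ f.support, p ≤ a
  mem : p ∈ N
  head : P (Finsupp.single p (s * f p))
  tail : ∀ u, (∀ a ∈ f.support, a < u) → DecSum N D P κ (p + 1) u (s • f.erase p)

theorem TailSum.smul_eq {p : ℕ} {f : ℕ →₀ ℝ} :
    s • f = Finsupp.single p (s * f p) + s • f.erase p := by
  rw [← smul_eq_mul, ← Finsupp.smul_single, ← smul_add, Finsupp.single_add_erase]

/-- Block `j` receives the ordinals `(κ + 1) * β j + μ` with `μ ≤ κ`: the value `κ` goes to its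
first coordinate and smaller values to its tail. -/
theorem DecSum.sum_blocks {n : ℕ} : ∀ (f : Fin n → ℕ →₀ ℝ) (p : Fin n → ℕ),
    (∀ j, TailSum N D P κ s (p j) (f j)) → (∀ i j, i < j → ∀ a ∈ (f i).support, a < p j) →
    ∀ β : Fin n → Ordinal.{0}, StrictAnti β →
    (∀ j, ∀ q ∈ N, p j ≤ q → ∀ μ ∈ insert κ (D q), (κ + 1) * β j + μ ∈ Z q) →
    ∀ σ, (∀ j, β j < σ) → ∀ l u, l ≤ u → (∀ j, l ≤ p j) → (∀ j, ∀ a ∈ (f j).support, a < u) →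
      DecSum N Z P ((κ + 1) * σ) l u (s • ∑ j, f j) := by
  classical
  induction n with
  | zero => intro f p _ _ β _ _ σ _ l u hlu _ _; simpa using .zero hlu
  | succ n ih =>
    intro f p hf hfp β hβ hZ σ hσ l u hlu hl hu
    set v := (f 0).support.sup id + 1 with hv
    have hv1 : ∀ a ∈ (f 0).support, a < v := fun a ha =>
      Nat.lt_succ_of_le (Finset.le_sup (f := id) ha)
    have hvle : ∀ b, (∀ a ∈ (f 0).support, a < b) → v ≤ b := by
      intro b hb
      have hb0 : 0 < b := (Nat.zero_le _).trans_lt (hb _ (hf 0).mem_support)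
      have : (f 0).support.sup id < b := (Finset.sup_lt_iff hb0).2 hb
      omega
    have hrest := ih (fun j => f j.succ) (fun j => p j.succ) (fun j => hf _)
      (fun i j h => hfp _ _ (Fin.succ_lt_succ_iff.2 h)) (fun j => β j.succ)
      (fun i j h => hβ (Fin.succ_lt_succ_iff.2 h)) (fun j => hZ _) (β 0)
      (fun j => hβ (Fin.succ_pos j)) v u (hvle u (hu 0))
      (fun j => hvle _ (hfp 0 j.succ (Fin.succ_pos j))) (fun j => hu _)
    have htail := ((hf 0).tail v hv1).append hrest fun q hq hpq μ hμ =>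
      hZ 0 q hq (by omega) μ (Set.mem_insert_of_mem _ hμ)
    rw [Fin.sum_univ_succ, smul_add, TailSum.smul_eq (p := p 0), add_assoc]
    refine .cons (hl 0) (hf 0).mem ?_ (hZ 0 _ (hf 0).mem le_rfl κ (Set.mem_insert _ _)) (hf 0).head
      ?_ (Nat.lt_succ_self _) htail
    · calc (κ + 1) * β 0 + κ < (κ + 1) * β 0 + (κ + 1) := by
            rw [add_lt_add_iff_left]; exact Order.lt_add_one_iff.2 le_rfl
        _ = (κ + 1) * (β 0 + 1) := by rw [mul_add, mul_one]
        _ ≤ (κ + 1) * σ := mul_le_mul_right (Order.add_one_le_of_lt (hσ 0)) _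
    · intro a ha
      have := Finset.mem_singleton.1 (Finsupp.support_single_subset ha)
      omega

/-- The sum of an admissible sequence of functionals, up to its first coordinate. -/
theorem TailSum.sum {n : ℕ} {f : Fin (n + 1) → ℕ →₀ ℝ} {p : Fin (n + 1) → ℕ}
    (hlag : ∀ p ∈ N, ∀ q ∈ N, p < q → Z p ⊆ D q)
    (hf : ∀ j, TailSum N D P κ s (p j) (f j))
    (hfp : ∀ i j, i < j → ∀ a ∈ (f i).support, a < p j)
    {β : Fin (n + 1) → Ordinal.{0}} (hβ : StrictAnti β)
    (hZ : ∀ j, ∀ q ∈ N, p j ≤ q → ∀ μ ∈ insert κ (D q), (κ + 1) * β j + μ ∈ Z q)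
    {σ : Ordinal.{0}} (hσ : ∀ j, β j < σ) :
    TailSum N D P ((κ + 1) * σ) s (p 0) (∑ j, f j) := by
  classical
  have heval : ∀ j, ∀ a ∈ (f j).support, (∑ j, f j) a = f j a := by
    intro j a ha
    rw [Finsupp.finsetSum_apply]
    refine Finset.sum_eq_single j (fun k _ hk => ?_) (by simp)
    by_contra h
    have hak := Finsupp.mem_support_iff.2 h
    have h1 := (hf j).le a ha
    have h2 := (hf k).le a hak
    rcases lt_or_gt_of_ne hk with h | h
    · have := hfp _ _ h a hak; omega
    · have := hfp _ _ h a ha; omega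
  have hmem : ∀ j, ∀ a ∈ (f j).support, a ∈ (∑ j, f j).support := fun j a ha =>
    Finsupp.mem_support_iff.2 (by rw [heval j a ha]; exact Finsupp.mem_support_iff.1 ha)
  have hsupp : ∀ a ∈ (∑ j, f j).support, ∃ j, a ∈ (f j).support := by
    intro a ha
    by_contra h
    push Not at h
    refine Finsupp.mem_support_iff.1 ha ?_
    rw [Finsupp.finsetSum_apply]
    exact Finset.sum_eq_zero fun j _ => Finsupp.notMem_support_iff.1 (h j)
  have hp0 : ∀ j, p 0 ≤ p j := fun j => by
    rcases eq_or_ne j 0 with rfl | hj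
    · exact le_rfl
    · exact (hfp 0 j (Fin.pos_iff_ne_zero.2 hj) _ (hf 0).mem_support).le
  refine ⟨hmem 0 _ (hf 0).mem_support, fun a ha => ?_, (hf 0).mem, ?_, fun u hu => ?_⟩
  · obtain ⟨j, hj⟩ := hsupp a ha
    exact (hp0 j).trans ((hf j).le a hj)
  · rw [heval 0 _ (hf 0).mem_support]
    exact (hf 0).head
  have herase : (∑ j, f j).erase (p 0) = (f 0).erase (p 0) + ∑ j : Fin n, f j.succ := by
    ext a
    by_cases ha : a = p 0
    · have h0 : ∀ j : Fin n, f j.succ (p 0) = 0 := fun j => by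
        by_contra h
        have h1 := (hf j.succ).le _ (Finsupp.mem_support_iff.2 h)
        have h2 := hfp 0 j.succ (Fin.succ_pos j) _ (hf 0).mem_support
        omega
      simp [ha, h0]
    · rw [Finsupp.erase_ne ha, Fin.sum_univ_succ, Finsupp.add_apply, Finsupp.add_apply,
        Finsupp.erase_ne ha]
  set v := (f 0).support.sup id + 1 with hv
  have hv1 : ∀ a ∈ (f 0).support, a < v := fun a ha =>
    Nat.lt_succ_of_le (Finset.le_sup (f := id) ha)
  have hvle : ∀ b, (∀ a ∈ (f 0).support, a < b) → v ≤ b := by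
    intro b hb
    have hb0 : 0 < b := (Nat.zero_le _).trans_lt (hb _ (hf 0).mem_support)
    have : (f 0).support.sup id < b := (Finset.sup_lt_iff hb0).2 hb
    omega
  have hrest := DecSum.sum_blocks (fun j => f j.succ) (fun j => p j.succ) (fun j => hf _)
    (fun i j h => hfp _ _ (Fin.succ_lt_succ_iff.2 h)) (fun j => β j.succ)
    (fun i j h => hβ (Fin.succ_lt_succ_iff.2 h)) (fun j => hZ _) (β 0)
    (fun j => hβ (Fin.succ_pos j)) v u (hvle u fun a ha => hu a (hmem 0 a ha))
    (fun j => hvle _ (hfp 0 j.succ (Fin.succ_pos j))) (fun j a ha => hu a (hmem _ a ha))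
  have htail := ((hf 0).tail v hv1).append hrest fun q hq hpq μ hμ =>
    hZ 0 q hq (by omega) μ (Set.mem_insert_of_mem _ hμ)
  rw [herase, smul_add]
  -- The split-off first coordinate leaves its ordinal to the next piece. The shift raises the bound
  -- by one, which still fits because `(κ + 1) * β 0 + κ + 1 = (κ + 1) * (β 0 + 1)`.
  refine (htail.lag hlag ((κ + 1) * β 0 + κ) le_rfl fun q hq hpq => ?_).mono_left le_rfl ?_
  · exact hlag _ (hf 0).mem q hq (by omega) (hZ 0 _ (hf 0).mem le_rfl κ (Set.mem_insert _ _))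
  · calc (κ + 1) * β 0 + κ + 1 = (κ + 1) * (β 0 + 1) := by rw [mul_add, mul_one, add_assoc]
      _ ≤ (κ + 1) * σ := mul_le_mul_right (Order.add_one_le_of_lt (hσ 0)) _

end Step

end Tsirelson

end

noncomputable section

namespace Tsirelson

/-! ### The dual ball of a Tsirelson type space -/

/-- The functionals of norm at most one on the Tsirelson type space `T(B, θ)`. -/
def DualBall (B : Set (Finset ℕ)) (θ : ℝ) (g : ℕ →₀ ℝ) : Prop :=
  ∀ x, |pairing g x| ≤ tsirelsonNorm B θ x

theorem pairing_smul (c : ℝ) (f x : ℕ →₀ ℝ) : pairing (c • f) x = c * pairing f x := by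
  simp [pairing, Finset.mul_sum, mul_assoc]

section DualBall

variable {B : Set (Finset ℕ)} {θ : ℝ}

theorem DualBall.smul {c : ℝ} {g : ℕ →₀ ℝ} (hc : |c| ≤ 1) (hg : DualBall B θ g) :
    DualBall B θ (c • g) := by
  intro x
  rw [pairing_smul, abs_mul]
  exact (mul_le_of_le_one_left (abs_nonneg _) hc).trans (hg x)

theorem dualBall_single (hθ : 0 < θ ∧ θ < 1) (n : ℕ) {c : ℝ} (hc : |c| ≤ 1) :
    DualBall B θ (Finsupp.single n c) := by
  intro x
  rw [pairing_single, abs_mul]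
  exact (mul_le_of_le_one_left (abs_nonneg _) hc).trans (abs_le_mixedNorm (fun _ => hθ) x n)

theorem restrict_eq_self {E : Finset ℕ} {f : ℕ →₀ ℝ} (h : f.support ⊆ E) : restrict E f = f := by
  ext k
  simp only [restrict, Finsupp.filter_apply]
  split_ifs with hk
  · rfl
  · by_contra hne
    exact hk (h (Finsupp.mem_support_iff.2 fun h0 => hne h0.symm))

theorem dualBall_op (hB : IsHereditary B) (hθ : 0 < θ ∧ θ < 1) {n : ℕ} (g : Fin (n + 1) → ℕ →₀ ℝ)
    (E : Fin (n + 1) → Finset ℕ) (hE : IsAdmissible B E) (hgE : ∀ j, (g j).support ⊆ E j)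
    (hg : ∀ j, DualBall B θ (g j)) : DualBall B θ (θ • ∑ j, g j) := by
  intro x
  have hle := (isLUB_mixedNorm (F := fun _ : Unit => B) (θ := fun _ : Unit => θ)
    (fun _ => hB) (fun _ => hθ) x).1 (Or.inr ⟨(), n, E, hE, rfl⟩)
  refine le_trans ?_ hle
  rw [pairing_smul_sum, abs_mul, abs_of_pos hθ.1]
  refine mul_le_mul_of_nonneg_left ((Finset.abs_sum_le_sum_abs _ _).trans
    (Finset.sum_le_sum fun j _ => ?_)) hθ.1.le
  rw [← restrict_eq_self (hgE j), pairing_restrict]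
  exact hg j _

end DualBall

theorem strictMono_cons {n : ℕ} {α : Type*} [Preorder α] {a : α} {p : Fin n → α}
    (hp : StrictMono p) (ha : ∀ j, a < p j) : StrictMono (Fin.cons a p : Fin (n + 1) → α) := by
  intro i j hij
  obtain ⟨j, rfl⟩ := Fin.exists_succ_eq.2 (Fin.ne_zero_of_lt hij)
  refine Fin.cases (fun _ => ha j) (fun i h => ?_) i hij
  exact hp (Fin.succ_lt_succ_iff.1 h)

theorem strictAnti_cons {n : ℕ} {α : Type*} [Preorder α] {a : α} {p : Fin n → α}
    (hp : StrictAnti p) (ha : ∀ j, p j < a) : StrictAnti (Fin.cons a p : Fin (n + 1) → α) := by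
  intro i j hij
  obtain ⟨j, rfl⟩ := Fin.exists_succ_eq.2 (Fin.ne_zero_of_lt hij)
  refine Fin.cases (fun _ => ha j) (fun i h => ?_) i hij
  exact hp (Fin.succ_lt_succ_iff.1 h)

theorem DecSum.exists_fin {N : Set ℕ} {A : ℕ → Set Ordinal.{0}} {P : (ℕ →₀ ℝ) → Prop}
    {ν : Ordinal.{0}} {l u : ℕ} {f : ℕ →₀ ℝ} (h : DecSum N A P ν l u f) :
    ∃ (n : ℕ) (g : Fin n → ℕ →₀ ℝ) (p : Fin n → ℕ) (β : Fin n → Ordinal.{0}),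
      f = ∑ j, g j ∧ StrictMono p ∧ StrictAnti β ∧ (∀ j, l ≤ p j) ∧ (∀ j, β j < ν) ∧
      (∀ j, β j ∈ A (p j)) ∧ (∀ j, P (g j)) ∧ (∀ j, ∀ a ∈ (g j).support, p j ≤ a) ∧
      ∀ i j, i < j → ∀ a ∈ (g i).support, a < p j := by
  induction h with
  | zero h =>
    exact ⟨0, Fin.elim0, Fin.elim0, Fin.elim0, by simp, fun i => i.elim0, fun i => i.elim0,
      fun i => i.elim0, fun i => i.elim0, fun i => i.elim0, fun i => i.elim0, fun i => i.elim0,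
      fun i => i.elim0⟩
  | @cons ν μ l p₀ l' u g₀ h₀ hlp hp hμ hA hg hs hpl hh ih =>
    obtain ⟨n, g, p, β, rfl, hpm, hβ, hl, hβν, hβA, hgP, hgp, hgg⟩ := ih
    refine ⟨n + 1, Fin.cons g₀ g, Fin.cons p₀ p, Fin.cons μ β, by simp [Fin.sum_univ_succ],
      ?_, ?_, ?_, ?_, ?_, ?_, ?_, ?_⟩
    · exact strictMono_cons hpm fun j => hpl.trans_le (hl j)
    · exact strictAnti_cons hβ hβν
    · exact Fin.cases hlp fun j => by have := hl j; simp only [Fin.cons_succ]; omega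
    · exact Fin.cases hμ fun j => (hβν j).trans hμ
    · exact Fin.cases hA hβA
    · exact Fin.cases hg hgP
    · exact Fin.cases (fun a ha => (hs a ha).1) hgp
    · intro i j hij
      obtain ⟨j, rfl⟩ := Fin.exists_succ_eq.2 (Fin.ne_zero_of_lt hij)
      refine Fin.cases (fun _ a ha => ?_) (fun i h => ?_) i hij
      · exact (hs a ha).2.trans_le (hl j)
      · exact hgg i j (Fin.succ_lt_succ_iff.1 h)

/-- The marks of the pieces form a member of the family, witnessed by their ordinals, and
interpolate the pieces. -/
theorem DecSum.dualBall_op {N : Set ℕ} {A : ℕ → Set Ordinal.{0}} {α : Ordinal.{0}} {θ : ℝ}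
    (hθ : 0 < θ ∧ θ < 1) {l u : ℕ} {f : ℕ →₀ ℝ}
    (h : DecSum N A (DualBall (family α A) θ) α l u f) : DualBall (family α A) θ (θ • f) := by
  obtain ⟨n, g, p, β, rfl, hp, hβ, -, hβα, hβA, hg, hgp, hgg⟩ := h.exists_fin
  rcases n with _ | n
  · intro x
    simpa [pairing, tsirelsonNorm] using
      mixedNorm_nonneg (F := fun _ : Unit => family α A) (fun _ => hθ) x
  -- The marks are added to the supports because a piece may vanish, and admissible sets must be
  -- nonempty.
  refine Tsirelson.dualBall_op family_hereditary hθ g (fun j => insert (p j) (g j).support)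
    ⟨⟨fun j => Finset.insert_nonempty _ _, ?_⟩, Finset.univ.image p, ?_, p, hp, rfl, ?_, ?_⟩
    (fun j => Finset.subset_insert _ _) hg
  · intro i j hij a ha b hb
    have h1 : a < p j := by
      rcases Finset.mem_insert.1 ha with rfl | ha
      · exact hp hij
      · exact hgg i j hij a ha
    rcases Finset.mem_insert.1 hb with rfl | hb
    · exact h1
    · exact h1.trans_le (hgp j b hb)
  · have hext : ∀ j, Function.extend p β (fun _ => 0) (p j) = β j :=
      hp.injective.extend_apply β _
    refine ⟨Function.extend p β (fun _ => 0), ?_, ?_⟩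
    · intro a ha b hb hab
      obtain ⟨i, -, rfl⟩ := Finset.mem_image.1 (Finset.mem_coe.1 ha)
      obtain ⟨j, -, rfl⟩ := Finset.mem_image.1 (Finset.mem_coe.1 hb)
      rw [hext, hext]
      exact hβ (hp.lt_iff_lt.1 hab)
    · intro a ha
      obtain ⟨i, -, rfl⟩ := Finset.mem_image.1 ha
      rw [hext]
      exact ⟨hβα i, hβA i⟩
  · intro j a ha
    rcases Finset.mem_insert.1 ha with rfl | ha
    · exact le_rfl
    · exact hgp j a ha
  · intro i j hij a ha
    rcases Finset.mem_insert.1 ha with rfl | ha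
    · exact hp hij
    · exact hgg i j hij a ha

/-! ### The lower estimate -/

theorem support_smul_sum {c : ℝ} (hc : c ≠ 0) {n : ℕ} {f : Fin n → ℕ →₀ ℝ}
    (hf : IsBlock fun j => (f j).support) (j : Fin n) :
    (f j).support ⊆ (c • ∑ j, f j).support := by
  intro a ha
  rw [Finsupp.mem_support_iff, Finsupp.smul_apply, smul_eq_mul, Finsupp.finsetSum_apply]
  refine mul_ne_zero hc ?_
  rw [Finset.sum_eq_single j _ (by simp)]
  · exact Finsupp.mem_support_iff.1 ha
  · intro k _ hk
    by_contra h
    rcases lt_or_gt_of_ne hk with h' | h'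
    · exact lt_irrefl _ (hf.2 k j h' a (Finsupp.mem_support_iff.2 h) a ha)
    · exact lt_irrefl _ (hf.2 j k h' a ha a (Finsupp.mem_support_iff.2 h))

section Lower

variable {I : Type} {F : I → Set (Finset ℕ)} {θ : I → ℝ} {i₀ : I}
  {Φ : ℕ → Set Ordinal.{0} → Set Ordinal.{0}} {N : Set ℕ} {A : ℕ → Set Ordinal.{0}}

/-- Each operation for the family is an operation for `F i₀` as long as the supports stay in `N`. -/
theorem SparseSystem.norming_of_family (hS : SparseSystem F i₀ Φ N A) (hθ : 0 < θ i₀)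
    {f : ℕ →₀ ℝ}
    (hf : Norming (fun _ : Unit => family (index (F i₀)) A) (fun _ : Unit => θ i₀) f) :
    (f.support : Set ℕ) ⊆ N → Norming F θ f := by
  induction hf with
  | basis n => exact fun _ => .basis n
  | neg_basis n => exact fun _ => .neg_basis n
  | op i f hf hadm ih =>
    intro hN
    have hfN : ∀ j, ((f j).support : Set ℕ) ⊆ N := fun j =>
      (Finset.coe_subset.2 (support_smul_sum hθ.ne' hadm.1 j)).trans hN
    exact .op i₀ f (fun j => ih j (hfN j)) (hS.isAdmissible_of_family hadm hfN (Nat.succ_ne_zero _))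

/-- By heredity functionals may be restricted to the support of `x`; thus only those supported by
the sparse set have to be estimated. -/
theorem mixedNorm_le_of_norming {J : Type} {G : J → Set (Finset ℕ)} {η : J → ℝ}
    (hG : ∀ i, IsHereditary (G i)) {x : ℕ →₀ ℝ} {c : ℝ} (hc : 0 ≤ c)
    (h : ∀ f, Norming G η f → (f.support : Set ℕ) ⊆ x.support → pairing f x ≤ c) :
    mixedNorm G η x ≤ c := by
  refine csSup_le ⟨_, _, Norming.basis 0, rfl⟩ ?_
  rintro _ ⟨f, hf, rfl⟩
  have hx : pairing f x = pairing (restrict x.support f) x := by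
    rw [pairing_restrict, restrict_eq_self (Finset.Subset.refl _)]
  rw [hx]
  rcases norming_restrict hG x.support hf with h0 | hf'
  · rw [h0]; simpa [pairing] using hc
  · refine h _ hf' ?_
    rw [support_restrict]
    intro a ha
    exact (Finset.mem_filter.1 (Finset.mem_coe.1 ha)).2

theorem SparseSystem.tsirelsonNorm_le (hS : SparseSystem F i₀ Φ N A)
    (hθ : ∀ i, 0 < θ i ∧ θ i < 1) {x : ℕ →₀ ℝ} (hx : (x.support : Set ℕ) ⊆ N) :
    tsirelsonNorm (family (index (F i₀)) A) (θ i₀) x ≤ mixedNorm F θ x := by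
  refine mixedNorm_le_of_norming (fun _ => family_hereditary) (mixedNorm_nonneg hθ x)
    fun f hf hfx => ?_
  exact pairing_le_mixedNorm hθ (hS.norming_of_family (hθ i₀).1 hf (hfx.trans hx)) x

end Lower

end Tsirelson

end

noncomputable section

namespace Tsirelson

/-! ### Closing a finite set of ordinals under division -/

/-- The set `T` contains the quotients and the remainders of its members on division by `Λ`. -/
def DivClosed (Λ : Ordinal.{0}) (T : Set Ordinal.{0}) : Prop :=
  ∀ μ ∈ T, μ / Λ ∈ T ∧ μ % Λ ∈ T

/-- The smallest set containing `S` and closed under division by `Λ`. -/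
def divClosure (Λ : Ordinal.{0}) (S : Set Ordinal.{0}) : Set Ordinal.{0} :=
  {ν | ∀ T, S ⊆ T → DivClosed Λ T → ν ∈ T}

theorem subset_divClosure (Λ : Ordinal.{0}) (S : Set Ordinal.{0}) : S ⊆ divClosure Λ S :=
  fun _ hν _ hST _ => hST hν

theorem divClosed_divClosure (Λ : Ordinal.{0}) (S : Set Ordinal.{0}) :
    DivClosed Λ (divClosure Λ S) :=
  fun μ hμ => ⟨fun T hST hT => (hT μ (hμ T hST hT)).1, fun T hST hT => (hT μ (hμ T hST hT)).2⟩

theorem exists_finite_divClosed {Λ : Ordinal.{0}} (hΛ : 1 < Λ) (ν : Ordinal.{0}) :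
    ∃ T : Set Ordinal.{0}, T.Finite ∧ ν ∈ T ∧ 0 ∈ T ∧ DivClosed Λ T := by
  have hΛ0 : Λ ≠ 0 := (zero_lt_one.trans hΛ).ne'
  induction ν using WellFoundedLT.induction with
  | _ ν ih =>
    rcases eq_or_ne ν 0 with rfl | hν
    · exact ⟨{0}, Set.finite_singleton 0, rfl, rfl, by
        rintro _ rfl; simp [Ordinal.zero_div, Ordinal.zero_mod]⟩
    · have h0 : (0 : Ordinal.{0}) / Λ = 0 := Ordinal.zero_div Λ
      have hmod : ν % Λ / Λ = 0 := Ordinal.div_eq_zero_of_lt (Ordinal.mod_lt ν hΛ0)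
      have hle : ν / Λ ≤ ν := Ordinal.div_le_of_le_mul
        (by simpa using mul_le_mul_left hΛ.le ν)
      -- The quotient can equal `ν`, as for `ω ^ ω` divided by `ω`; the process then stops.
      rcases hle.eq_or_lt with heq | hlt
      · refine ⟨{ν, ν % Λ, 0}, by simp, by simp, by simp, ?_⟩
        rintro μ (rfl | rfl | rfl)
        · simp [heq]
        · simp [hmod, Ordinal.mod_mod]
        · simp [h0, Ordinal.zero_mod]
      obtain ⟨T, hT, hmem, hT0, hcl⟩ := ih _ hlt
      refine ⟨insert ν (insert (ν % Λ) T), (hT.insert _).insert _, Set.mem_insert _ _, by simp [hT0], ?_⟩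
      intro μ hμ
      simp only [Set.mem_insert_iff] at hμ ⊢
      rcases hμ with rfl | rfl | hμ
      · simp [hmem]
      · simp [hmod, Ordinal.mod_mod, hT0]
      · exact ⟨Or.inr (Or.inr (hcl μ hμ).1), Or.inr (Or.inr (hcl μ hμ).2)⟩

theorem finite_divClosure {Λ : Ordinal.{0}} (hΛ : 1 < Λ) {S : Set Ordinal.{0}} (hS : S.Finite) :
    (divClosure Λ S).Finite := by
  choose T hT hmem _ hcl using exists_finite_divClosed hΛ
  refine (hS.biUnion fun ν _ => hT ν).subset fun ν hν => hν _ ?_ ?_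
  · exact fun μ hμ => Set.mem_biUnion hμ (hmem μ)
  · intro μ hμ
    obtain ⟨ρ, hρ, hμ⟩ := Set.mem_iUnion₂.1 hμ
    exact ⟨Set.mem_biUnion hρ (hcl ρ μ hμ).1, Set.mem_biUnion hρ (hcl ρ μ hμ).2⟩

/-! ### The upper estimate -/

section Upper

variable {I : Type} {F : I → Set (Finset ℕ)} {θ : I → ℝ} {i₀ : I}

/-- The ordinals that mark the sums of admissible sequences. -/
def markSet (F : I → Set (Finset ℕ)) (Λ : Ordinal.{0}) (d : ℕ) (K : ℕ → Ordinal.{0}) (p : ℕ)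
    (S : Set Ordinal.{0}) : Set Ordinal.{0} :=
  divClosure Λ {ν | ∃ u < d, ∃ ρ ∈ rankSet F p, ∃ μ ∈ insert (K u) S,
    ν = (K u + 1) * (2 * ρ) + μ ∨ ν = (K u + 1) * (2 * ρ + 1) + μ}

theorem finite_markSet [Finite I] {Λ : Ordinal.{0}} (hΛ : 1 < Λ) (d : ℕ) (K : ℕ → Ordinal.{0})
    (p : ℕ) {S : Set Ordinal.{0}} (hS : S.Finite) : (markSet F Λ d K p S).Finite := by
  refine finite_divClosure hΛ ?_
  have h : ∀ u, {x : Ordinal.{0} × Ordinal.{0} | x.1 ∈ rankSet F p ∧ x.2 ∈ insert (K u) S}.Finite :=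
    fun u => (finite_rankSet F p).prod (hS.insert _)
  refine ((Set.finite_Iio d).biUnion fun u _ => ((h u).image
    fun x => (K u + 1) * (2 * x.1) + x.2).union ((h u).image
      fun x => (K u + 1) * (2 * x.1 + 1) + x.2)).subset ?_
  rintro ν ⟨u, hu, ρ, hρ, μ, hμ, h | h⟩
  · exact Set.mem_biUnion hu (Or.inl ⟨(ρ, μ), ⟨hρ, hμ⟩, h.symm⟩)
  · exact Set.mem_biUnion hu (Or.inr ⟨(ρ, μ), ⟨hρ, hμ⟩, h.symm⟩)

theorem rankSet_mono (F : I → Set (Finset ℕ)) : Monotone (rankSet F) := by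
  rintro p q hpq _ ⟨i, t, ht, htp, rfl⟩
  exact ⟨i, t, ht, htp.trans (Finset.range_mono (by omega)), rfl⟩

/-- Uses `k` rounds of grouping to bring the bound from `κ` down to `ν`; the factor `c` makes up for
the weight being smaller than a power of `ϑ`. The first coordinate takes no part in the grouping and
is handled by `hhead`. -/
theorem TailSum.scale {N : Set ℕ} {D : ℕ → Set Ordinal.{0}} {P : (ℕ →₀ ℝ) → Prop}
    {Λ κ ν : Ordinal.{0}} {η s s' c t : ℝ} {p k : ℕ} {f : ℕ →₀ ℝ}
    (hΛ : Λ ≠ 0) (hD : ∀ p ∈ N, DivClosed Λ (D p))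
    (hop : ∀ l u f, DecSum N D P Λ l u f → P (η • f))
    (hP : ∀ (c : ℝ) g, |c| ≤ 1 → P g → P (c • g)) (hf : TailSum N D P κ s p f)
    (hκ : κ ≤ Λ ^ k * ν) (hc : |c| ≤ 1) (ht : t ≠ 0) (hs : s' * t = c * η ^ k * s)
    (hhead : P (Finsupp.single p (s' * (t • f) p))) : TailSum N D P ν s' p (t • f) where
  mem_support := by rw [Finsupp.support_smul_eq ht]; exact hf.mem_support
  le := by rw [Finsupp.support_smul_eq ht]; exact hf.le
  mem := hf.mem
  head := hhead
  tail u hu := by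
    rw [Finsupp.support_smul_eq ht] at hu
    have h := (((hf.tail u hu).mono_left le_rfl hκ).reduce hΛ hD hop).smul hP hc
    have herase : (t • f).erase p = t • f.erase p := by
      ext a
      by_cases ha : a = p
      · simp [ha]
      · simp [Finsupp.erase_ne ha]
    rwa [smul_smul, smul_smul, ← hs, ← smul_smul, ← herase] at h

theorem exists_residue (d q u : ℕ) (hu : u < d) : ∃ u' < d, ∃ k, u' + q = u + k * d := by
  have hd : 0 < d := by omega
  -- In the natural numbers `(d - 1) * q` stands for `-q` modulo `d`.
  refine ⟨(u + (d - 1) * q) % d, Nat.mod_lt _ hd, q - (u + (d - 1) * q) / d, ?_⟩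
  have h1 := Nat.div_add_mod (u + (d - 1) * q) d
  have h2 : (u + (d - 1) * q) / d ≤ q := by
    rw [← Nat.lt_succ_iff, Nat.div_lt_iff_lt_mul hd]
    obtain ⟨e, rfl⟩ : ∃ e, d = e + 1 := ⟨d - 1, by omega⟩
    simp only [Nat.add_sub_cancel]
    nlinarith
  obtain ⟨e, rfl⟩ : ∃ e, d = e + 1 := ⟨d - 1, by omega⟩
  obtain ⟨b, hb⟩ := Nat.exists_eq_add_of_le h2
  set a := (u + (e + 1 - 1) * q) / (e + 1)
  set m := (u + (e + 1 - 1) * q) % (e + 1)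
  rw [hb, Nat.add_sub_cancel_left]
  simp only [Nat.add_sub_cancel] at h1
  rw [hb] at h1
  nlinarith

variable [Finite I] {Λ : Ordinal.{0}} {d : ℕ} {K : ℕ → Ordinal.{0}} {q : I → ℕ} {ϑ : ℝ}
  {N : Set ℕ} {A : ℕ → Set Ordinal.{0}}

/-- The ordinals that may mark the position `p`. -/
def laggedSet (F : I → Set (Finset ℕ)) (Λ : Ordinal.{0}) (d : ℕ) (K : ℕ → Ordinal.{0})
    (N : Set ℕ) (A : ℕ → Set Ordinal.{0}) (p : ℕ) : Set Ordinal.{0} :=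
  {ν | ∃ p' ∈ N, p' < p ∧ ν ∈ markSet F Λ d K p' (A p')}

omit [Finite I] in
theorem SparseSystem.laggedSet_subset (hS : SparseSystem F i₀ (markSet F Λ d K) N A) {p : ℕ}
    (hp : p ∈ N) : laggedSet F Λ d K N A p ⊆ A p := by
  rintro ν ⟨p', hp', hlt, hν⟩
  exact hS.lag p' hp' p hp hlt hν

omit [Finite I] in
theorem divClosed_laggedSet (p : ℕ) : DivClosed Λ (laggedSet F Λ d K N A p) := by
  rintro μ ⟨p', hp', hlt, hμ⟩
  exact ⟨⟨p', hp', hlt, (divClosed_divClosure Λ _ μ hμ).1⟩,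
    ⟨p', hp', hlt, (divClosed_divClosure Λ _ μ hμ).2⟩⟩

variable (hS : SparseSystem F i₀ (markSet F Λ d K) N A) (hc : ∀ i, IsCompactFamily (F i))
  (hF : ∀ i, IsHereditary (F i)) (hθ : ∀ i, 0 < θ i ∧ θ i < 1) (hΛ : 1 < Λ)
  (hΛα : Λ ≤ index (F i₀))

-- The ordinals of the sequence are built from ranks known at `p j`, hence at every later mark, so
-- the combined ordinals lie in `markSet` by its definition.
omit [Finite I] in
include hS hc hF in
theorem tailSum_sum_of_isAdmissible {P : (ℕ →₀ ℝ) → Prop} (i : I) {n : ℕ}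
    {f : Fin (n + 1) → ℕ →₀ ℝ} (hadm : IsAdmissible (F i) fun j => (f j).support)
    (hN : ∀ j, ((f j).support : Set ℕ) ⊆ N) {u : ℕ} (hu : u < d) {s : ℝ} {p : Fin (n + 1) → ℕ}
    (hf : ∀ j, TailSum N (laggedSet F Λ d K N A) P (K u) s (p j) (f j)) :
    TailSum N (laggedSet F Λ d K N A) P ((K u + 1) * (2 * index (F i))) s (p 0) (∑ j, f j) := by
  obtain ⟨β, hβ, hβlt, hβF⟩ := hS.exists_ordinals_of_isAdmissible hc hF i hadm hN p
    fun j => (hf j).mem_support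
  refine TailSum.sum (D := laggedSet F Λ d K N A) (Z := fun p => markSet F Λ d K p (A p))
    (fun p hp q _ hpq ν hν => ⟨p, hp, hpq, hν⟩) hf
    (fun i j hij a ha => hadm.1.2 i j hij a ha _ (hf j).mem_support) hβ ?_ hβlt
  intro j q hq hpq μ hμ
  obtain ⟨ρ, hρ, h⟩ := hβF j
  refine subset_divClosure _ _ ⟨u, hu, ρ, rankSet_mono F hpq hρ, μ,
    Set.insert_subset_insert (hS.laggedSet_subset hq) hμ, ?_⟩
  rcases h with h | h
  · exact Or.inl (by rw [h])
  · exact Or.inr (by rw [h])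

-- The invariant of the norming set: the same first coordinate serves for all states `u`
-- simultaneously. All states are needed, since the state used for the members of a sequence depends
-- on the operation applied afterwards.
omit [Finite I] in
include hS hc hF hθ hΛ hΛα in
theorem exists_tailSum (hϑ : 0 < ϑ ∧ ϑ < 1) (hθq : ∀ i, θ i ≤ ϑ ^ q i) (hθd : θ i₀ = ϑ ^ d)
    (hK : ∀ i, ∀ u < d, ∀ u' < d, ∀ k, u' + q i = u + k * d →
      (K u' + 1) * (2 * index (F i)) ≤ Λ ^ k * K u)
    {f : ℕ →₀ ℝ} (hf : Norming F θ f) : (f.support : Set ℕ) ⊆ N → ∃ p, ∀ u < d,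
      TailSum N (laggedSet F Λ d K N A) (DualBall (family (index (F i₀)) A) (θ i₀)) (K u)
        (ϑ ^ (d - 1 - u)) p f := by
  have hhead : ∀ (f : ℕ →₀ ℝ), Norming F θ f → ∀ (p k : ℕ),
      DualBall (family (index (F i₀)) A) (θ i₀) (Finsupp.single p (ϑ ^ k * f p)) := by
    intro f hf p k
    refine dualBall_single (hθ i₀) p ?_
    rw [abs_mul, abs_of_pos (pow_pos hϑ.1 k)]
    exact mul_le_one₀ (pow_le_one₀ hϑ.1.le hϑ.2.le) (abs_nonneg _) (hf.abs_le_one hθ p)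
  have hsingle : ∀ (n : ℕ) (c : ℝ), c ≠ 0 → Norming F θ (Finsupp.single n c) → n ∈ N → ∀ u < d,
      TailSum N (laggedSet F Λ d K N A) (DualBall (family (index (F i₀)) A) (θ i₀)) (K u)
        (ϑ ^ (d - 1 - u)) n (Finsupp.single n c) := by
    intro n c hc0 hnorm hn u _
    refine ⟨by simp [hc0], fun a ha => ?_, hn, hhead _ hnorm _ _, fun v hv => ?_⟩
    · exact (Finset.mem_singleton.1 (Finsupp.support_single_subset ha)).ge
    · rw [Finsupp.erase_single, smul_zero]
      exact .zero (hv n (by simp [hc0]))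
  induction hf with
  | basis n => exact fun hn => ⟨n, hsingle n 1 one_ne_zero (.basis n) (hn (by simp))⟩
  | neg_basis n => exact fun hn => ⟨n, hsingle n (-1) (by norm_num) (.neg_basis n) (hn (by simp))⟩
  | @op i n f hf hadm ih =>
    intro hN
    have hfN : ∀ j, ((f j).support : Set ℕ) ⊆ N := fun j =>
      (Finset.coe_subset.2 (support_smul_sum (hθ i).1.ne' hadm.1 j)).trans hN
    choose p hp using fun j => ih j (hfN j)
    refine ⟨p 0, fun u hu => ?_⟩
    -- The weight `q i` leads from state `u'` to state `u` and completes `k` factors `θ i₀`.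
    obtain ⟨u', hu', k, hk⟩ := exists_residue d (q i) u hu
    have hsum := tailSum_sum_of_isAdmissible hS hc hF i hadm hfN hu' fun j => hp j u' hu'
    have hpow : ϑ ^ (d - 1 - u) * ϑ ^ q i = θ i₀ ^ k * ϑ ^ (d - 1 - u') := by
      rw [hθd, ← pow_mul, ← pow_add, ← pow_add]
      congr 1
      have : d * k = k * d := mul_comm _ _
      omega
    refine hsum.scale (η := θ i₀) (k := k) (c := θ i / ϑ ^ q i) (zero_lt_one.trans hΛ).ne'
      (fun p _ => divClosed_laggedSet p) ?_ (fun c g hc hg => hg.smul hc)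
      (hK i u hu u' hu' k hk) ?_ (hθ i).1.ne' ?_ ?_
    · intro l u f h
      exact ((h.mono_ordinals fun p hp => hS.laggedSet_subset hp).mono_left le_rfl hΛα).dualBall_op
        (hθ i₀)
    · rw [abs_of_nonneg (div_nonneg (hθ i).1.le (pow_pos hϑ.1 _).le)]
      exact div_le_one_of_le₀ (hθq i) (pow_pos hϑ.1 _).le
    · have := (pow_pos hϑ.1 (q i)).ne'
      rw [mul_assoc, ← hpow]
      field_simp
    · exact hhead _ (.op i f hf hadm) _ _

-- The outermost operation is treated separately: with `e` additional factors `θ i`, the weights add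
-- up to a full power of `θ i₀` and the bound becomes a finite number `y`. The tail then has at most
-- `y` pieces, and the first coordinate accounts for the `1` in `1 + y`.
omit [Finite I] in
include hS hc hF hθ hΛ hΛα in
theorem abs_pairing_le_of_norming (hϑ : 0 < ϑ ∧ ϑ < 1) (hθq : ∀ i, θ i ≤ ϑ ^ q i)
    (hθd : θ i₀ = ϑ ^ d)
    (hK : ∀ i, ∀ u < d, ∀ u' < d, ∀ k, u' + q i = u + k * d →
      (K u' + 1) * (2 * index (F i)) ≤ Λ ^ k * K u)
    {C : ℝ} (hC : 1 ≤ C)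
    (htop : ∀ i, ∃ u < d, ∃ k e y : ℕ, u + q i * (1 + e) = k * d ∧
      (K u + 1) * (2 * index (F i)) ≤ Λ ^ k * y ∧
        (1 + y) * (1 / ϑ) ^ (d - 1) * (1 / θ i) ^ e ≤ C)
    {f : ℕ →₀ ℝ} (hf : Norming F θ f) (hN : (f.support : Set ℕ) ⊆ N) (x : ℕ →₀ ℝ) :
    pairing f x ≤ C * tsirelsonNorm (family (index (F i₀)) A) (θ i₀) x := by
  set T := tsirelsonNorm (family (index (F i₀)) A) (θ i₀) x with hT
  have hcoord : ∀ n, |x n| ≤ T := fun n => abs_le_mixedNorm (fun _ => hθ i₀) x n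
  have hT0 : 0 ≤ T := (abs_nonneg _).trans (hcoord 0)
  have hTC : T ≤ C * T := le_mul_of_one_le_left hT0 hC
  cases hf with
  | basis n =>
    rw [pairing_single, one_mul]
    exact (le_abs_self _).trans ((hcoord n).trans hTC)
  | neg_basis n =>
    rw [pairing_single, neg_one_mul]
    exact (neg_le_abs _).trans ((hcoord n).trans hTC)
  | @op i n f hf hadm =>
    have hfN : ∀ j, ((f j).support : Set ℕ) ⊆ N := fun j =>
      (Finset.coe_subset.2 (support_smul_sum (hθ i).1.ne' hadm.1 j)).trans hN
    choose p hp using fun j =>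
      exists_tailSum hS hc hF hθ hΛ hΛα hϑ hθq hθd hK (hf j) (hfN j)
    obtain ⟨u, hu, k, e, y, hk, hy, hCy⟩ := htop i
    have hnorm : Norming F θ (θ i • ∑ j, f j) := .op i f hf hadm
    have habs := hnorm.abs_le_one hθ (p 0)
    have hs0 : 0 < θ i ^ e * ϑ ^ (d - 1) := mul_pos (pow_pos (hθ i).1 e) (pow_pos hϑ.1 _)
    have hs1 : θ i ^ e * ϑ ^ (d - 1) ≤ 1 :=
      mul_le_one₀ (pow_le_one₀ (hθ i).1.le (hθ i).2.le) (pow_pos hϑ.1 _).le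
        (pow_le_one₀ hϑ.1.le hϑ.2.le)
    have hpow : ϑ ^ (d - 1) * (ϑ ^ q i) ^ (1 + e) = θ i₀ ^ k * ϑ ^ (d - 1 - u) := by
      rw [hθd, ← pow_mul, ← pow_mul, ← pow_add, ← pow_add]
      congr 1
      have : d * k = k * d := mul_comm _ _
      omega
    have hsum : TailSum N (laggedSet F Λ d K N A) (DualBall (family (index (F i₀)) A) (θ i₀)) y
        (θ i ^ e * ϑ ^ (d - 1)) (p 0) (θ i • ∑ j, f j) := by
      refine (tailSum_sum_of_isAdmissible hS hc hF i hadm hfN hu fun j => hp j u hu).scale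
        (η := θ i₀) (k := k) (c := (θ i / ϑ ^ q i) ^ (1 + e)) (zero_lt_one.trans hΛ).ne'
        (fun p _ => divClosed_laggedSet p) ?_ (fun c g hc hg => hg.smul hc) hy ?_ (hθ i).1.ne' ?_ ?_
      · intro l u f h
        exact ((h.mono_ordinals fun p hp => hS.laggedSet_subset hp).mono_left le_rfl
          hΛα).dualBall_op (hθ i₀)
      · rw [abs_of_nonneg (pow_nonneg (div_nonneg (hθ i).1.le (pow_pos hϑ.1 _).le) _)]
        exact pow_le_one₀ (div_nonneg (hθ i).1.le (pow_pos hϑ.1 _).le)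
          (div_le_one_of_le₀ (hθq i) (pow_pos hϑ.1 _).le)
      · have := (pow_pos hϑ.1 (q i)).ne'
        rw [mul_assoc (_ ^ (1 + e)), ← hpow, div_pow, pow_add (θ i), pow_one]
        field_simp
      · refine dualBall_single (hθ i₀) _ ?_
        rw [abs_mul, abs_of_pos hs0]
        exact mul_le_one₀ hs1 (abs_nonneg _) habs
    set g := θ i • ∑ j, f j
    have htail := (hsum.tail (g.support.sup id + 1) fun a ha =>
      Nat.lt_succ_of_le (Finset.le_sup (f := id) ha)).abs_pairing_le hT0 (fun g hg => hg x) y le_rfl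
    rw [pairing_smul, abs_mul, abs_of_pos hs0, ← le_div_iff₀' hs0] at htail
    have hdec : pairing g x = g (p 0) * x (p 0) + pairing (g.erase (p 0)) x := by
      conv_lhs => rw [← Finsupp.single_add_erase (p 0) g]
      rw [pairing_add, pairing_single]
    have hhead : g (p 0) * x (p 0) ≤ T / (θ i ^ e * ϑ ^ (d - 1)) := by
      refine (le_abs_self _).trans ?_
      rw [abs_mul]
      refine (mul_le_of_le_one_left (abs_nonneg _) habs).trans ((hcoord _).trans ?_)
      rw [le_div_iff₀ hs0]
      exact mul_le_of_le_one_right hT0 hs1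
    calc pairing g x ≤ T / (θ i ^ e * ϑ ^ (d - 1)) + y * T / (θ i ^ e * ϑ ^ (d - 1)) := by
          rw [hdec]; exact add_le_add hhead ((le_abs_self _).trans htail)
      _ = ((1 + y) * (1 / ϑ) ^ (d - 1) * (1 / θ i) ^ e) * T := by
          have := (hθ i).1.ne'
          have := hϑ.1.ne'
          simp only [one_div, inv_pow]
          field_simp
      _ ≤ C * T := mul_le_mul_of_nonneg_right hCy hT0

omit hS in
include hc hF hθ hΛ hΛα in
/-- The comparison of a mixed Tsirelson norm with the norm of a Tsirelson type space, in terms of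
the weights `q i` of the operations and the sizes `K u` of the sums that are waiting for
completion. -/
theorem exists_family_equivalent (hϑ : 0 < ϑ ∧ ϑ < 1) (hθq : ∀ i, θ i ≤ ϑ ^ q i)
    (hθd : θ i₀ = ϑ ^ d)
    (hK : ∀ i, ∀ u < d, ∀ u' < d, ∀ k, u' + q i = u + k * d →
      (K u' + 1) * (2 * index (F i)) ≤ Λ ^ k * K u)
    {C : ℝ} (hC : 1 ≤ C)
    (htop : ∀ i, ∃ u < d, ∃ k e y : ℕ, u + q i * (1 + e) = k * d ∧
      (K u + 1) * (2 * index (F i)) ≤ Λ ^ k * y ∧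
        (1 + y) * (1 / ϑ) ^ (d - 1) * (1 / θ i) ^ e ≤ C)
    {M : Set ℕ} (hM : M.Infinite) :
    ∃ N ⊆ M, N.Infinite ∧ ∃ B, IsRegular B ∧ index B = index (F i₀) ∧
      ∀ x : ℕ →₀ ℝ, (x.support : Set ℕ) ⊆ N →
        tsirelsonNorm B (θ i₀) x ≤ mixedNorm F θ x ∧
          mixedNorm F θ x ≤ C * tsirelsonNorm B (θ i₀) x := by
  obtain ⟨N, hNM, A, hS⟩ := exists_sparseSystem hc hF i₀ (markSet F Λ d K)
    (fun p S hS => finite_markSet hΛ d K p hS) hM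
  refine ⟨N, hNM, hS.infinite, family (index (F i₀)) A, family_regular hS.finite hS.mono,
    index_family hS.finite hS.mono hS.exhaust, fun x hx => ⟨hS.tsirelsonNorm_le hθ hx, ?_⟩⟩
  refine mixedNorm_le_of_norming hF ?_ fun f hf hfx => ?_
  · exact mul_nonneg (zero_le_one.trans hC) (mixedNorm_nonneg (fun _ => hθ i₀) x)
  · exact abs_pairing_le_of_norming hS hc hF hθ hΛ hΛα hϑ hθq hθd hK hC htop hf
      (hfx.trans hx) x

end Upper

end Tsirelson

end

noncomputable section

namespace Tsirelson

/-! ### Ordinal arithmetic -/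

section OrdinalArithmetic

open Ordinal

variable {c : Ordinal.{0}} {a b : Ordinal.{0}}

theorem mul_lt_of_lt_opow_opow (ha : a < ω ^ ω ^ c) (hb : b < ω ^ ω ^ c) : a * b < ω ^ ω ^ c :=
  isPrincipal_mul_omega0_opow_opow c ha hb

theorem one_lt_opow_opow (c : Ordinal.{0}) : 1 < ω ^ ω ^ c :=
  Ordinal.one_lt_opow.2 ⟨one_lt_omega0, (opow_pos c omega0_pos).ne'⟩

theorem add_one_lt_of_lt_opow_opow (ha : a < ω ^ ω ^ c) : a + 1 < ω ^ ω ^ c :=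
  isPrincipal_add_omega0_opow (ω ^ c) ha (one_lt_opow_opow c)

theorem pow_lt_of_lt_opow_opow (ha : a < ω ^ ω ^ c) (n : ℕ) : a ^ n < ω ^ ω ^ c := by
  induction n with
  | zero => simp
  | succ n ih => rw [pow_succ]; exact mul_lt_of_lt_opow_opow ih ha

theorem omega0_le_opow_opow (c : Ordinal.{0}) : ω ≤ ω ^ ω ^ c := by
  conv_lhs => rw [← opow_one ω]
  exact opow_le_opow_right omega0_pos (Order.one_le_iff_pos.2 (opow_pos c omega0_pos))

theorem mul_pow_opow_opow (ha0 : 0 < a) (ha : a < ω ^ ω ^ c) {n : ℕ} (hn : n ≠ 0) :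
    a * (ω ^ ω ^ c) ^ n = (ω ^ ω ^ c) ^ n := by
  obtain ⟨m, rfl⟩ := Nat.exists_eq_succ_of_ne_zero hn
  rw [pow_succ', ← mul_assoc, mul_omega0_opow_opow ha0 ha]

theorem mul_add_one_le (ha : 1 ≤ a) : a * b + 1 ≤ a * (b + 1) := by
  rw [mul_add, mul_one]
  gcongr

/-- Sizes of marked sums for which the operations with index below `γ = ω ^ ω ^ c` and weight `q i`
between `1` and `Q`, and those with index about `γ ^ (ν * m i)` and weight `m i * Q`, are
absorbed. -/
theorem exists_sizes {I : Type} [Finite I] (c : Ordinal.{0}) (α σ : I → Ordinal.{0})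
    (S : Set I) {ν Q : ℕ} (hν : ν ≠ 0) (hQ : Q ≠ 0) (m q : I → ℕ) (hσ : ∀ i, σ i < ω ^ ω ^ c)
    (hS : ∀ i ∈ S, m i ≠ 0 ∧ q i = m i * Q ∧ 2 * α i ≤ (ω ^ ω ^ c) ^ (ν * m i) * σ i)
    (hS' : ∀ i ∉ S, 1 ≤ q i ∧ q i ≤ Q ∧ α i < ω ^ ω ^ c ∧ σ i = 1) :
    ∃ (κ : ℕ → Ordinal.{0}) (τ : Ordinal.{0}), κ 0 = 1 ∧ τ < ω ^ ω ^ c ∧ (∀ i, σ i ≤ τ) ∧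
      (∀ u, 1 ≤ κ u) ∧ (∀ u i, (κ u * τ + 1) * (2 * α i) ≤ κ (u + q i) * σ i) ∧
      (∀ u k, κ (u + k * Q) = (ω ^ ω ^ c) ^ (ν * k) * κ u) ∧
      ∀ u, ∀ s < ω ^ ω ^ c, κ u * s ≤ κ (u + Q) := by
  set γ : Ordinal.{0} := ω ^ ω ^ c with hγ
  have hγ1 : 1 < γ := one_lt_opow_opow c
  have hbound : ∀ f : I → Ordinal.{0}, (∀ i, f i < γ) → ∃ b < γ, 1 ≤ b ∧ ∀ i, f i ≤ b := by
    intro f hf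
    rcases isEmpty_or_nonempty I with h | h
    · exact ⟨1, hγ1, le_rfl, fun i => h.elim i⟩
    · obtain ⟨i, hi⟩ := Finite.exists_max f
      exact ⟨f i + 1, add_one_lt_of_lt_opow_opow (hf i), le_add_self,
        fun j => (hi j).trans le_self_add⟩
  obtain ⟨τ, hτ, hτ1, hστ⟩ := hbound σ hσ
  have h2 : (2 : Ordinal.{0}) < γ := (natCast_lt_omega0 2).trans_le (omega0_le_opow_opow c)
  classical
  -- One ordinal below `γ` dominating the growth caused by any operation of index below `γ`.
  obtain ⟨δ, hδ, hδ1, hαδ⟩ := hbound (fun i => if i ∈ S then 0 else (τ + 1) * (2 * α i)) (by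
    intro i
    split_ifs with h
    · exact zero_lt_one.trans hγ1
    · exact mul_lt_of_lt_opow_opow (add_one_lt_of_lt_opow_opow hτ)
        (mul_lt_of_lt_opow_opow h2 (hS' i h).2.2.1))
  have hαδ' : ∀ i ∉ S, (τ + 1) * (2 * α i) ≤ δ := fun i hi => by simpa [hi] using hαδ i
  -- A unit of weight is worth a factor `δ`, and `Q` units are worth `γ ^ ν`. Passing to the next
  -- multiple of `Q` is safe because `δ ^ n * s < γ` for `s < γ`.
  set κ : ℕ → Ordinal.{0} := fun u => γ ^ (ν * (u / Q)) * δ ^ (u % Q) with hκ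
  have hγpow : ∀ n, 1 ≤ γ ^ n := fun n => one_le_pow₀ hγ1.le
  have hδpow : ∀ n, 1 ≤ δ ^ n := fun n => one_le_pow₀ hδ1
  have hκ1 : ∀ u, 1 ≤ κ u := fun u => one_le_mul (hγpow _) (hδpow _)
  have hQ0 : 0 < Q := Nat.pos_of_ne_zero hQ
  have hshift : ∀ u k, κ (u + k * Q) = γ ^ (ν * k) * κ u := by
    intro u k
    simp only [hκ]
    rw [Nat.add_mul_div_right _ _ hQ0, Nat.add_mul_mod_self_right, ← mul_assoc, ← pow_add]
    congr 2
    ring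
  have hγle : ∀ n, n ≠ 0 → γ ≤ γ ^ (ν * n) := fun n hn => by
    conv_lhs => rw [← pow_one γ]
    exact pow_le_pow_right₀ hγ1.le (Nat.one_le_iff_ne_zero.2 (mul_ne_zero hν hn))
  have habs : ∀ u n, n ≠ 0 → ∀ s < γ, κ u * s ≤ γ ^ (ν * (u / Q + n)) := by
    intro u n hn s hs
    simp only [hκ]
    rw [mul_assoc, mul_add, pow_add]
    exact mul_le_mul_right ((mul_lt_of_lt_opow_opow (pow_lt_of_lt_opow_opow hδ _) hs).le.trans
      (hγle n hn)) _
  refine ⟨κ, τ, by simp [hκ], hτ, hστ, hκ1, ?_, hshift, ?_⟩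
  · intro u i
    by_cases hi : i ∈ S
    · obtain ⟨hm, hq, hα⟩ := hS i hi
      have h3 : κ u * τ + 1 ≤ γ ^ (ν * (u / Q)) * (δ ^ (u % Q) * τ + 1) := by
        simp only [hκ]
        rw [mul_assoc]
        exact mul_add_one_le (hγpow _)
      -- What earlier operations left on the right, including `τ`, is absorbed from the left by the
      -- power of `γ`.
      have h4 : (δ ^ (u % Q) * τ + 1) * γ ^ (ν * m i) = γ ^ (ν * m i) :=
        mul_pow_opow_opow (zero_lt_one.trans_le le_add_self) (add_one_lt_of_lt_opow_opow
          (mul_lt_of_lt_opow_opow (pow_lt_of_lt_opow_opow hδ _) hτ)) (mul_ne_zero hν hm)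
      calc (κ u * τ + 1) * (2 * α i)
          ≤ γ ^ (ν * (u / Q)) * (δ ^ (u % Q) * τ + 1) * (γ ^ (ν * m i) * σ i) :=
            mul_le_mul' h3 hα
        _ = γ ^ (ν * (u / Q)) * γ ^ (ν * m i) * 1 * σ i := by
            rw [mul_assoc, ← mul_assoc _ _ (σ i), h4, mul_one, mul_assoc]
        _ ≤ γ ^ (ν * (u / Q)) * γ ^ (ν * m i) * δ ^ (u % Q) * σ i :=
            mul_le_mul_left (mul_le_mul_right (hδpow _) _) _
        _ = κ (u + q i) * σ i := by
            rw [hq, hshift]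
            simp only [hκ]
            rw [← mul_assoc, ← pow_add, ← pow_add, add_comm]
    · obtain ⟨hq1, hq2, -, hσ1⟩ := hS' i hi
      rw [hσ1, mul_one]
      have h3 : (κ u * τ + 1) * (2 * α i) ≤ κ u * δ := by
        calc (κ u * τ + 1) * (2 * α i) ≤ κ u * (τ + 1) * (2 * α i) :=
              mul_le_mul_left (mul_add_one_le (hκ1 u)) _
          _ = κ u * ((τ + 1) * (2 * α i)) := mul_assoc _ _ _
          _ ≤ κ u * δ := mul_le_mul_right (hαδ' i hi) _
      refine h3.trans ?_
      by_cases hlt : u % Q + q i < Q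
      · have h7 : u + q i = (u % Q + q i) + u / Q * Q := by
          have := Nat.div_add_mod u Q
          have h8 : u / Q * Q = Q * (u / Q) := mul_comm _ _
          omega
        have h5 : (u + q i) / Q = u / Q := by
          rw [h7, Nat.add_mul_div_right _ _ hQ0, Nat.div_eq_of_lt hlt, zero_add]
        have h6 : (u + q i) % Q = u % Q + q i := by
          rw [h7, Nat.add_mul_mod_self_right, Nat.mod_eq_of_lt hlt]
        simp only [hκ]
        rw [h5, h6, mul_assoc, ← pow_succ]
        exact mul_le_mul_right (pow_le_pow_right₀ hδ1 (by omega)) _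
      · have h5 : u / Q + 1 ≤ (u + q i) / Q := by
          rw [Nat.le_div_iff_mul_le hQ0, add_mul, one_mul]
          have := Nat.div_add_mod u Q
          have h7 : u / Q * Q = Q * (u / Q) := mul_comm _ _
          omega
        calc κ u * δ ≤ γ ^ (ν * (u / Q + 1)) := habs u 1 one_ne_zero δ hδ
          _ ≤ γ ^ (ν * ((u + q i) / Q)) := pow_le_pow_right₀ hγ1.le (Nat.mul_le_mul_left _ h5)
          _ = γ ^ (ν * ((u + q i) / Q)) * 1 := (mul_one _).symm
          _ ≤ κ (u + q i) := mul_le_mul_right (hδpow _) _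
  · intro u s hs
    have h3 := hshift u 1
    rw [one_mul] at h3
    calc κ u * s ≤ γ ^ (ν * (u / Q + 1)) := habs u 1 one_ne_zero s hs
      _ = γ ^ (ν * 1) * γ ^ (ν * (u / Q)) * 1 := by rw [mul_one, ← pow_add, ← mul_add, add_comm]
      _ ≤ γ ^ (ν * 1) * γ ^ (ν * (u / Q)) * δ ^ (u % Q) := mul_le_mul_right (hδpow _) _
      _ = κ (u + Q) := by rw [h3, mul_assoc]

/-! ### The functions `γ`, `n`, `k` and `ξ` -/

theorem lam_ne_zero (h : ω ≤ a) : lam a ≠ 0 :=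
  (Ordinal.log_pos one_lt_omega0 (omega0_pos.trans_le h).ne' h).ne'

theorem gam_of_omega0_le (h : ω ≤ a) : gam a = ω ^ ω ^ lam (lam a) := if_neg (not_lt_of_ge h)

theorem expo_of_omega0_le (h : ω ≤ a) : expo a = coef (lam a) := if_neg (not_lt_of_ge h)

theorem opow_lam_eq (h : ω ≤ a) : ω ^ lam a = gam a ^ expo a * ω ^ rest (lam a) := by
  have h1 := (decomposition (lam a) (lam_ne_zero h)).1
  rw [gam_of_omega0_le h, expo_of_omega0_le h, ← opow_natCast, ← opow_mul, ← opow_add, ← h1]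

theorem expo_ne_zero (a : Ordinal.{0}) : expo a ≠ 0 := by
  by_cases h : a < ω
  · simp [expo, h]
  · rw [expo_of_omega0_le (not_lt.1 h)]
    exact (decomposition (lam a) (lam_ne_zero (not_lt.1 h))).2.1.ne'

theorem opow_rest_lam_lt (h : ω ≤ a) : ω ^ rest (lam a) < gam a := by
  rw [gam_of_omega0_le h]
  exact (opow_lt_opow_iff_right one_lt_omega0).2 (decomposition (lam a) (lam_ne_zero h)).2.2

/-- Left multiplication by `2` fixes `ω ^ lam a`, since `lam a ≥ 1`; only the remainder is enlarged,
to at most one further copy. This is the source of the term `1 + k(α)` in the constant. -/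
theorem two_mul_le_opow_lam (h : ω ≤ a) : 2 * a ≤ ω ^ lam a * (coef a + 1) := by
  have ha := decomposition a (omega0_pos.trans_le h).ne'
  have h2 : 2 * ω ^ lam a = ω ^ lam a := by
    have h3 : lam a = 1 + (lam a - 1) :=
      (Ordinal.add_sub_cancel_of_le (Order.one_le_iff_pos.2 (pos_iff_ne_zero.2 (lam_ne_zero h)))).symm
    rw [h3, opow_add, opow_one, ← mul_assoc]
    congr 1
    exact_mod_cast natCast_mul_omega0 (n := 2) two_pos
  have h4 : 2 * rest a ≤ ω ^ lam a := by
    rw [← h2]; exact mul_le_mul_right ha.2.2.le 2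
  calc 2 * a = 2 * (ω ^ lam a * coef a + rest a) := by rw [← ha.1]
    _ = ω ^ lam a * coef a + 2 * rest a := by rw [mul_add, ← mul_assoc, h2]
    _ ≤ ω ^ lam a * coef a + ω ^ lam a := by gcongr
    _ = ω ^ lam a * (coef a + 1) := by rw [mul_add, mul_one]

theorem opow_lam_le (h : ω ≤ a) : ω ^ lam a ≤ a :=
  Ordinal.opow_log_le_self ω (omega0_pos.trans_le h).ne'

theorem lt_opow_opow_lam_add_one (a : Ordinal.{0}) : a < ω ^ ω ^ (lam (lam a) + 1) := by
  have h1 : a < ω ^ (lam a + 1) := by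
    have := lt_opow_succ_log_self one_lt_omega0 a
    rwa [Order.succ_eq_add_one] at this
  have h2 : lam a < ω ^ (lam (lam a) + 1) := by
    have := lt_opow_succ_log_self one_lt_omega0 (lam a)
    rwa [Order.succ_eq_add_one] at this
  exact h1.trans_le (opow_le_opow_right omega0_pos (Order.add_one_le_of_lt h2))

/-- The infinite values of `gam` are `ω ^ ω ^ c`, and an infinite `a` lies below the value for `c =
lam (lam a) + 1`. -/
theorem lt_gam_of_gam_lt (hb : ω ≤ b) (h : gam a < gam b) : a < gam b := by
  rw [gam_of_omega0_le hb] at h ⊢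
  by_cases ha : a < ω
  · exact ha.trans_le (omega0_le_opow_opow _)
  · rw [gam_of_omega0_le (not_lt.1 ha), opow_lt_opow_iff_right one_lt_omega0,
      opow_lt_opow_iff_right one_lt_omega0] at h
    refine (lt_opow_opow_lam_add_one a).trans_le ?_
    exact opow_le_opow_right omega0_pos (opow_le_opow_right omega0_pos (Order.add_one_le_of_lt h))

theorem one_lt_gam (ha : ω ≤ a) : 1 < gam a := by
  rw [gam_of_omega0_le ha]; exact one_lt_opow_opow _

theorem LeT.omega0_le {s t : ℝ} (h : LeT a s b t) (ha : ω ≤ a) : ω ≤ b := by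
  rcases h with h | ⟨-, m₀, m₁, hm₀, hm₁, hle, -⟩
  · exact absurd h.1 (not_lt_of_ge ha)
  · by_contra hb
    push Not at hb
    have h1 : gam b = b := if_pos hb
    obtain ⟨n, rfl⟩ := lt_omega0.1 hb
    rw [h1, ← natCast_pow] at hle
    have h2 : ω ≤ gam a := by rw [gam_of_omega0_le ha]; exact omega0_le_opow_opow _
    have h3 : gam a ≤ gam a ^ (expo a * m₀) := by
      conv_lhs => rw [← pow_one (gam a)]
      exact pow_le_pow_right₀ (one_lt_gam ha).le
        (Nat.one_le_iff_ne_zero.2 (mul_ne_zero (expo_ne_zero a) hm₀.ne'))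
    exact absurd (h2.trans (h3.trans hle)) (not_le_of_gt (natCast_lt_omega0 _))

theorem omega0_le_of_gam_eq (hb : ω ≤ b) (h : gam a = gam b) : ω ≤ a := by
  by_contra ha
  push Not at ha
  have h1 : gam a = a := if_pos ha
  have h2 : ω ≤ gam b := by rw [gam_of_omega0_le hb]; exact omega0_le_opow_opow _
  rw [← h, h1] at h2
  exact absurd h2 (not_le_of_gt ha)

/-- Powers of an ordinal below `ω ^ ω ^ c` stay below it, so no choice of the exponents in `LeT`
compensates for a larger `gam`. -/
theorem LeT.gam_le {s t : ℝ} (h : LeT a s b t) (hb : ω ≤ b) : gam a ≤ gam b := by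
  by_contra hlt
  push Not at hlt
  by_cases ha : a < ω
  · have h1 : gam a = a := if_pos ha
    rw [h1, gam_of_omega0_le hb] at hlt
    exact absurd (ha.trans_le (omega0_le_opow_opow _)) (not_lt_of_ge hlt.le)
  push Not at ha
  rcases h with h | ⟨-, m₀, m₁, hm₀, hm₁, hle, -⟩
  · exact absurd h.1 (not_lt_of_ge ha)
  · have h3 : gam a ≤ gam a ^ (expo a * m₀) := by
      conv_lhs => rw [← pow_one (gam a)]
      exact pow_le_pow_right₀ (one_lt_gam ha).le
        (Nat.one_le_iff_ne_zero.2 (mul_ne_zero (expo_ne_zero a) hm₀.ne'))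
    have h4 : gam b ^ (expo b * m₁) < gam a := by
      have h5 := hlt
      rw [gam_of_omega0_le ha] at h5 ⊢
      exact pow_lt_of_lt_opow_opow h5 _
    exact absurd (h3.trans hle) (not_le_of_gt h4)

/-- With equal bases the ordinal inequality compares exponents, and taking an `m₀`-th root removes
the integers in `LeT`. -/
theorem LeT.pow_le {s t : ℝ} (h : LeT a s b t) (hb : ω ≤ b) (hab : gam a = gam b) (hs : 0 ≤ s)
    (ht : 0 < t) (ht1 : t < 1) : s ^ expo b ≤ t ^ expo a := by
  rcases h with h | ⟨-, m₀, m₁, hm₀, hm₁, hle, hst⟩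
  · exact absurd h.2.1 (not_lt_of_ge hb)
  · rw [hab] at hle
    have h1 : expo a * m₀ ≤ expo b * m₁ := (pow_le_pow_iff_right₀ (one_lt_gam hb)).1 hle
    refine le_of_pow_le_pow_left₀ hm₀.ne' (pow_nonneg ht.le _) ?_
    calc (s ^ expo b) ^ m₀ = (s ^ m₀) ^ expo b := by rw [← pow_mul, ← pow_mul, mul_comm]
      _ ≤ (t ^ m₁) ^ expo b := pow_le_pow_left₀ (pow_nonneg hs _) hst _
      _ = t ^ (expo b * m₁) := by rw [← pow_mul, mul_comm]
      _ ≤ t ^ (expo a * m₀) := pow_le_pow_of_le_one ht.le ht1.le h1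
      _ = (t ^ expo a) ^ m₀ := by rw [pow_mul]

end OrdinalArithmetic

end Tsirelson

end

noncomputable section

namespace Tsirelson

/-! ### The constants -/

/-- Telescoping over the factors. It splits the loss `(1 / ϑ) ^ (Q - 1)` into one contribution for
each family. -/
theorem prod_sub_one_le_sum {I : Type} [DecidableEq I] (s : Finset I) (m : I → ℕ)
    (hm : ∀ i, 1 ≤ m i) : ∏ i ∈ s, m i - 1 ≤ ∑ i ∈ s, (∏ i ∈ s, m i) / m i * (m i - 1) := by
  induction s using Finset.induction_on with
  | empty => simp
  | insert a s ha ih =>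
    rw [Finset.sum_insert ha, Finset.prod_insert ha, Nat.mul_div_cancel_left _ (hm a)]
    have h1 : ∑ i ∈ s, (∏ i ∈ s, m i) / m i * (m i - 1) ≤
        ∑ i ∈ s, (m a * ∏ i ∈ s, m i) / m i * (m i - 1) :=
      Finset.sum_le_sum fun i _ => Nat.mul_le_mul_right _
        (Nat.div_le_div_right (Nat.le_mul_of_pos_left _ (hm a)))
    have h2 : (∏ i ∈ s, m i) * (m a - 1) + ∏ i ∈ s, m i = m a * ∏ i ∈ s, m i := by
      obtain ⟨b, hb⟩ := Nat.exists_eq_add_of_le' (hm a)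
      rw [hb, Nat.add_sub_cancel]
      ring
    omega

theorem pow_floor_logb_add_one_le {s t : ℝ} (hs : 0 < s ∧ s < 1) (ht : 0 < t) :
    s ^ (⌊Real.logb s t⌋₊ + 1) ≤ t := by
  have h := Nat.lt_floor_add_one (Real.logb s t)
  rw [Real.logb_lt_iff_lt_rpow_of_base_lt_one hs.1 hs.2 ht] at h
  rw [← Real.rpow_natCast]
  push_cast
  exact h.le

section Constants

open Ordinal

variable {r : ℕ} {α : Fin r → Ordinal.{0}} {θ : Fin r → ℝ} {i₀ : Fin r}

theorem mexp_pos (i : Fin r) : 1 ≤ mexp α θ i₀ i := by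
  unfold mexp
  split_ifs
  · omega
  · exact Nat.one_le_iff_ne_zero.2 (expo_ne_zero _)


theorem one_le_two_div {t : ℝ} (ht : 0 < t ∧ t < 1) : 1 ≤ 2 / t := by
  rw [le_div_iff₀ ht.1]
  linarith [ht.2]

theorem one_le_prod_two_div (hθ : ∀ i, 0 < θ i ∧ θ i < 1) (s : Finset (Fin r)) :
    1 ≤ ∏ i ∈ s, 2 / θ i :=
  Finset.prod_induction _ (fun x => 1 ≤ x) (fun _ _ => one_le_mul_of_one_le_of_one_le) le_rfl
    fun i _ => one_le_two_div (hθ i)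

theorem two_div_le_prod_two_div (hθ : ∀ i, 0 < θ i ∧ θ i < 1) {s : Finset (Fin r)} {i : Fin r}
    (hi : i ∈ s) : 2 / θ i ≤ ∏ i ∈ s, 2 / θ i := by
  rw [← Finset.mul_prod_erase s _ hi]
  exact le_mul_of_one_le_right (zero_le_one.trans (one_le_two_div (hθ i)))
    (one_le_prod_two_div hθ _)

theorem mul_le_two_mul_constC (hθ : ∀ i, 0 < θ i ∧ θ i < 1) {c : ℝ} (hc : 0 ≤ c)
    (hcθ : c ≤ ∏ i ∈ Finset.univ.erase i₀, (1 / θ i) ^ (mexp α θ i₀ i - 1)) {a : ℝ} {i : Fin r}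
    (hi : ω ≤ α i) (ha : a ≤ 4 * (1 + coef (α i))) : a * c ≤ 2 * constC α θ i₀ := by
  classical
  have h1 := one_le_prod_two_div hθ
    ((Finset.univ.erase i₀).filter (fun i => 1 < ω ^ rest (lam (α i))))
  have h2 : coef (α i) ≤ (Finset.univ.filter fun i => ω ≤ α i).sup fun i => coef (α i) :=
    Finset.le_sup (f := fun i => coef (α i)) (by simp [hi])
  have h3 : (coef (α i) : ℝ) ≤ (((Finset.univ.filter fun i => ω ≤ α i).sup
    fun i => coef (α i) : ℕ) : ℝ) := by exact_mod_cast h2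
  have h4 := mul_le_mul (ha.trans (mul_le_mul_of_nonneg_left (add_le_add_right h3 1)
    zero_le_four)) hcθ hc (by positivity)
  refine h4.trans ((le_mul_of_one_le_right ?_ h1).trans (le_of_eq ?_))
  · exact mul_nonneg (by positivity) (hc.trans hcθ)
  · unfold constC
    ring

theorem two_mul_mul_le_two_mul_constC (hθ : ∀ i, 0 < θ i ∧ θ i < 1) {c : ℝ} (hc : 0 ≤ c)
    (hcθ : c ≤ ∏ i ∈ Finset.univ.erase i₀, (1 / θ i) ^ (mexp α θ i₀ i - 1)) {i : Fin r}
    (hi : i ≠ i₀) (hδ : rest (lam (α i)) ≠ 0) : 2 * c * (1 / θ i) ≤ 2 * constC α θ i₀ := by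
  classical
  have hmem : i ∈ (Finset.univ.erase i₀).filter (fun i => 1 < ω ^ rest (lam (α i))) := by
    simp [hi, Ordinal.one_lt_opow, one_lt_omega0, hδ]
  have h1 := two_div_le_prod_two_div hθ hmem
  have h2 : 0 ≤ 2 / θ i := zero_le_one.trans (one_le_two_div (hθ i))
  have h3 := mul_le_mul hcθ h1 h2 (hc.trans hcθ)
  have h4 := h2.trans h1
  have h5 := mul_nonneg (hc.trans hcθ) h4
  set X : ℝ := (((Finset.univ.filter fun i => ω ≤ α i).sup fun i => coef (α i) : ℕ) : ℝ) with hX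
  have hX0 : 0 ≤ X := Nat.cast_nonneg _
  calc 2 * c * (1 / θ i) = 1 * (c * (2 / θ i)) := by ring
    _ ≤ 4 * (1 + X) * ((∏ i ∈ Finset.univ.erase i₀, (1 / θ i) ^ (mexp α θ i₀ i - 1)) *
        ∏ i ∈ (Finset.univ.erase i₀).filter (fun i => 1 < ω ^ rest (lam (α i))), 2 / θ i) := by
      refine mul_le_mul (by linarith) h3 (mul_nonneg hc h2) (by positivity)
    _ = 2 * constC α θ i₀ := by
      unfold constC
      ring

/-- The exponent `n(α i₀)` splits so that `ν * m i = n(α i)` whenever `γ(α i) = γ(α i₀)`. -/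
theorem exists_exponents (α : Fin r → Ordinal.{0}) (i₀ : Fin r) :
    ∃ (ν : ℕ) (m : Fin r → ℕ), ν ≠ 0 ∧
      (∀ i, gam (α i) = gam (α i₀) → m i ≠ 0 ∧ ν * m i = expo (α i)) ∧
      (m i₀ = 1 ∨ m i₀ = expo (α i₀) ∧ ∃ i ≠ i₀, gam (α i) = gam (α i₀)) := by
  by_cases h : ∃ i ≠ i₀, gam (α i) = gam (α i₀)
  · exact ⟨1, fun i => expo (α i), one_ne_zero, fun i _ => ⟨expo_ne_zero _, one_mul _⟩,
      Or.inr ⟨rfl, h⟩⟩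
  · push Not at h
    refine ⟨expo (α i₀), fun _ => 1, expo_ne_zero _, fun i hi => ⟨one_ne_zero, ?_⟩, Or.inl rfl⟩
    by_cases hi₀ : i = i₀
    · rw [hi₀, mul_one]
    · exact absurd hi (h i hi₀)

/-- Each factor `1 / θ i` pays for `q i` factors `1 / ϑ`. -/
theorem one_div_pow_le_prod (hθ : ∀ i, 0 < θ i ∧ θ i < 1) {ϑ : ℝ} (hϑ : 0 < ϑ ∧ ϑ < 1)
    {q : Fin r → ℕ} (hθq : ∀ i, θ i ≤ ϑ ^ q i) (s : Finset (Fin r)) (M : Fin r → ℕ) {n : ℕ}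
    (hn : n ≤ ∑ i ∈ s, q i * M i) : (1 / ϑ) ^ n ≤ ∏ i ∈ s, (1 / θ i) ^ M i := by
  have h1 : 1 ≤ 1 / ϑ := by rw [le_div_iff₀ hϑ.1]; linarith [hϑ.2]
  refine (pow_le_pow_right₀ h1 hn).trans ?_
  rw [← Finset.prod_pow_eq_pow_sum]
  refine Finset.prod_le_prod (fun i _ => by positivity) fun i _ => ?_
  rw [pow_mul]
  refine pow_le_pow_left₀ (by positivity) ?_ _
  rw [one_div_pow]
  exact one_div_le_one_div_of_le (hθ i).1 (hθq i)

end Constants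

end Tsirelson

end

noncomputable section

namespace Tsirelson

/-! ### Choice of the weights and of the bounds -/

section Parameters

open Ordinal

variable {r : ℕ} {α : Fin r → Ordinal.{0}} {θ : Fin r → ℝ} {i₀ : Fin r}

/-- The weights: `θ i` is at most `ϑ ^ q i`, with equality for `i = i₀`. -/
theorem exists_weights (hθ : ∀ i, 0 < θ i ∧ θ i < 1) (h₀ : ω ≤ α i₀)
    (hmax : ∀ i, LeT (α i) (θ i) (α i₀) (θ i₀)) :
    ∃ (ν Q : ℕ) (m q : Fin r → ℕ) (ϑ : ℝ), ν ≠ 0 ∧ Q ≠ 0 ∧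
      (∀ i, gam (α i) = gam (α i₀) → m i ≠ 0 ∧ ν * m i = expo (α i) ∧ q i = m i * Q) ∧
      (∀ i, gam (α i) ≠ gam (α i₀) → 1 ≤ q i ∧ q i ≤ Q) ∧
      (0 < ϑ ∧ ϑ < 1) ∧ (∀ i, θ i ≤ ϑ ^ q i) ∧ θ i₀ = ϑ ^ q i₀ ∧
      (1 / ϑ) ^ (q i₀ - 1) ≤ ∏ i ∈ Finset.univ.erase i₀, (1 / θ i) ^ (mexp α θ i₀ i - 1) := by
  classical
  obtain ⟨ν, m, hν, hm, hm₀⟩ := exists_exponents α i₀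
  have hM : ∀ i, 1 ≤ mexp α θ i₀ i := mexp_pos
  set P : Finset (Fin r) := Finset.univ.filter fun i => gam (α i) ≠ gam (α i₀) with hP
  set Q : ℕ := ∏ i ∈ P, mexp α θ i₀ i with hQ
  have hQ0 : 0 < Q := Finset.prod_pos fun i _ => hM i
  -- With `θ i₀ = ϑ ^ (m i₀ * Q)`, weight `Q / mexp` is permitted when `gam` is smaller because `θ i
  -- ^ mexp ≤ θ i₀`; for equal `gam` the weight is proportional to `expo (α i)`.
  set q : Fin r → ℕ := fun i =>
    if gam (α i) = gam (α i₀) then m i * Q else Q / mexp α θ i₀ i with hq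
  have hqS : ∀ i, gam (α i) = gam (α i₀) → q i = m i * Q := fun i hi => if_pos hi
  have hqS' : ∀ i, gam (α i) ≠ gam (α i₀) → q i = Q / mexp α θ i₀ i := fun i hi => if_neg hi
  have hdvd : ∀ i, gam (α i) ≠ gam (α i₀) → mexp α θ i₀ i ∣ Q := fun i hi =>
    Finset.dvd_prod_of_mem _ (by simp [hP, hi])
  have hd : q i₀ ≠ 0 := by
    rw [hqS i₀ rfl]; exact mul_ne_zero (hm i₀ rfl).1 hQ0.ne'
  set ϑ : ℝ := θ i₀ ^ ((q i₀ : ℝ)⁻¹) with hϑdef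
  have hϑ : 0 < ϑ ∧ ϑ < 1 := ⟨Real.rpow_pos_of_pos (hθ i₀).1 _,
    Real.rpow_lt_one (hθ i₀).1.le (hθ i₀).2 (inv_pos.2 (by positivity))⟩
  have hϑd : ϑ ^ q i₀ = θ i₀ := Real.rpow_inv_natCast_pow (hθ i₀).1.le hd
  have hθq : ∀ i, θ i ≤ ϑ ^ q i := by
    intro i
    by_cases hi : gam (α i) = gam (α i₀)
    · refine le_of_pow_le_pow_left₀ (expo_ne_zero (α i₀)) (pow_nonneg hϑ.1.le _)
        (((hmax i).pow_le h₀ hi (hθ i).1.le (hθ i₀).1 (hθ i₀).2).trans (le_of_eq ?_))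
      rw [← hϑd, ← pow_mul, ← pow_mul, hqS i hi, hqS i₀ rfl, ← (hm i hi).2, ← (hm i₀ rfl).2]
      congr 1
      ring
    · have hlt : gam (α i) < gam (α i₀) := lt_of_le_of_ne ((hmax i).gam_le h₀) hi
      have h1 : θ i ^ mexp α θ i₀ i ≤ θ i₀ := by
        unfold mexp
        rw [if_pos hlt]
        exact pow_floor_logb_add_one_le (hθ i) (hθ i₀).1
      refine le_of_pow_le_pow_left₀ (Nat.one_le_iff_ne_zero.1 (hM i)) (pow_nonneg hϑ.1.le _)
        (h1.trans ?_)
      rw [← hϑd, ← pow_mul, hqS' i hi, Nat.div_mul_cancel (hdvd i hi), hqS i₀ rfl]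
      exact pow_le_pow_of_le_one hϑ.1.le hϑ.2.le
        (Nat.le_mul_of_pos_left _ (Nat.pos_of_ne_zero (hm i₀ rfl).1))
  refine ⟨ν, Q, m, q, ϑ, hν, hQ0.ne', fun i hi => ⟨(hm i hi).1, (hm i hi).2, hqS i hi⟩,
    fun i hi => ?_, hϑ, hθq, hϑd.symm, one_div_pow_le_prod hθ hϑ hθq _ _ ?_⟩
  · rw [hqS' i hi]
    exact ⟨Nat.div_pos (Nat.le_of_dvd hQ0 (hdvd i hi)) (hM i), Nat.div_le_self _ _⟩
  · have h1 : Q - 1 ≤ ∑ i ∈ P, q i * (mexp α θ i₀ i - 1) := by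
      refine (prod_sub_one_le_sum P _ hM).trans (le_of_eq (Finset.sum_congr rfl fun i hi => ?_))
      rw [hqS' i (Finset.mem_filter.1 hi).2]
    have h2 : P ⊆ Finset.univ.erase i₀ := fun i hi => by
      refine Finset.mem_erase.2 ⟨?_, Finset.mem_univ _⟩
      rintro rfl
      exact (Finset.mem_filter.1 hi).2 rfl
    -- Either `q i₀ = Q`, or some other family `j` has the same `gam`; its exponent `mexp = expo (α
    -- i₀)` then pays for the additional `Q * (m i₀ - 1)`.
    rcases hm₀ with h | ⟨hm₀, j, hj, hjg⟩
    · rw [hqS i₀ rfl, h, one_mul]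
      exact h1.trans (Finset.sum_le_sum_of_subset h2)
    · have hjP : j ∉ P := by simp [hP, hjg]
      have h3 : insert j P ⊆ Finset.univ.erase i₀ :=
        Finset.insert_subset (by simp [hj]) h2
      refine le_trans ?_ (Finset.sum_le_sum_of_subset h3)
      rw [Finset.sum_insert hjP]
      have h4 : mexp α θ i₀ j = m i₀ := by
        unfold mexp
        rw [if_neg (by rw [hjg]; exact lt_irrefl _), hm₀]
      have h5 : Q * (m i₀ - 1) ≤ q j * (mexp α θ i₀ j - 1) := by
        rw [h4, hqS j hjg]
        exact Nat.mul_le_mul_right _ (Nat.le_mul_of_pos_left _ (Nat.pos_of_ne_zero (hm j hjg).1))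
      have h6 : q i₀ = Q * (m i₀ - 1) + Q := by
        rw [hqS i₀ rfl]
        obtain ⟨b, hb⟩ := Nat.exists_eq_succ_of_ne_zero (hm i₀ rfl).1
        rw [hb, Nat.succ_sub_one, Nat.succ_eq_add_one]
        ring
      omega

/-- The division by `Λ` uses only the leading power of `α i₀`. The final bound `y` is finite at once
unless `rest (lam (α i)) ≠ 0` for a family `i ≠ i₀` with the same `gam`; such a family is charged an
additional `2 / θ i`. -/
theorem exists_parameters (hθ : ∀ i, 0 < θ i ∧ θ i < 1) (h₀ : ω ≤ α i₀)
    (hmax : ∀ i, LeT (α i) (θ i) (α i₀) (θ i₀)) :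
    ∃ (Λ : Ordinal.{0}) (d : ℕ) (K : ℕ → Ordinal.{0}) (q : Fin r → ℕ) (ϑ : ℝ),
      1 < Λ ∧ Λ ≤ α i₀ ∧ (0 < ϑ ∧ ϑ < 1) ∧ (∀ i, θ i ≤ ϑ ^ q i) ∧ θ i₀ = ϑ ^ d ∧
      (∀ i, ∀ u < d, ∀ u' < d, ∀ k, u' + q i = u + k * d →
        (K u' + 1) * (2 * α i) ≤ Λ ^ k * K u) ∧
      ∀ i, ∃ u < d, ∃ k e y : ℕ, u + q i * (1 + e) = k * d ∧
        (K u + 1) * (2 * α i) ≤ Λ ^ k * y ∧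
          (1 + y) * (1 / ϑ) ^ (d - 1) * (1 / θ i) ^ e ≤ 2 * constC α θ i₀ := by
  classical
  obtain ⟨ν, Q, m, q, ϑ, hν, hQ, hm, hq, hϑ, hθq, hϑd, hprod⟩ := exists_weights hθ h₀ hmax
  set γ := gam (α i₀) with hγ
  have hγc : γ = ω ^ ω ^ lam (lam (α i₀)) := gam_of_omega0_le h₀
  set Λ : Ordinal.{0} := ω ^ lam (α i₀) with hΛ
  have hΛ1 : 1 < Λ := one_lt_opow.2 ⟨one_lt_omega0, lam_ne_zero h₀⟩
  have hγ1 : 1 < γ := one_lt_gam h₀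
  have hlt : ∀ i, gam (α i) ≠ γ → α i < γ := fun i hi =>
    lt_gam_of_gam_lt h₀ (lt_of_le_of_ne ((hmax i).gam_le h₀) hi)
  have hω : ∀ i, gam (α i) = γ → ω ≤ α i := fun i hi => omega0_le_of_gam_eq h₀ hi
  have hone : ∀ a : Ordinal.{0}, 1 ≤ ω ^ a := fun a => Order.one_le_iff_pos.2 (opow_pos a omega0_pos)
  -- What an operation leaves beyond the power of `γ` that its weight pays for.
  set σ : Fin r → Ordinal.{0} := fun i =>
    if gam (α i) = γ then ω ^ rest (lam (α i)) * (coef (α i) + 1) else 1 with hσ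
  have hσS : ∀ i, gam (α i) = γ → σ i = ω ^ rest (lam (α i)) * (coef (α i) + 1) :=
    fun i hi => if_pos hi
  have hσS' : ∀ i, gam (α i) ≠ γ → σ i = 1 := fun i hi => if_neg hi
  have hσγ : ∀ i, σ i < γ := by
    intro i
    by_cases hi : gam (α i) = γ
    · rw [hσS i hi, hγc]
      refine mul_lt_of_lt_opow_opow ?_ ?_
      · rw [← hγc, ← hi]; exact opow_rest_lam_lt (hω i hi)
      · exact_mod_cast (natCast_lt_omega0 (coef (α i) + 1)).trans_le (omega0_le_opow_opow _)
    · rw [hσS' i hi]; exact hγ1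
  obtain ⟨κ, τ, hκ0, hτ, hστ, hκ1, hκ, hshift, habs⟩ := exists_sizes (lam (lam (α i₀))) α σ
    {i | gam (α i) = γ} hν hQ m q (fun i => by rw [← hγc]; exact hσγ i)
    (fun i hi => ⟨(hm i hi).1, (hm i hi).2.2, by
      rw [← hγc, (hm i hi).2.1, hσS i hi, ← mul_assoc, ← hi, ← opow_lam_eq (hω i hi)]
      exact two_mul_le_opow_lam (hω i hi)⟩)
    (fun i hi => ⟨(hq i hi).1, (hq i hi).2, by rw [← hγc]; exact hlt i hi, hσS' i hi⟩)
  rw [← hγc] at hτ hshift habs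
  obtain ⟨hm₀, hmν, hq₀⟩ := hm i₀ rfl
  have hΛeq : Λ = γ ^ expo (α i₀) * ω ^ rest (lam (α i₀)) := opow_lam_eq h₀
  have hd : 0 < q i₀ := by
    rw [hq₀]; exact Nat.pos_of_ne_zero (mul_ne_zero hm₀ hQ)
  have hΛle : γ ^ expo (α i₀) ≤ Λ := by
    rw [hΛeq]; exact le_mul_of_one_le_right' (hone _)
  have hpow : ∀ u k, κ (u + k * q i₀) ≤ Λ ^ k * κ u := by
    intro u k
    rw [hq₀, ← mul_assoc, hshift]
    refine mul_le_mul_left ?_ _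
    calc γ ^ (ν * (k * m i₀)) = (γ ^ expo (α i₀)) ^ k := by
          rw [← pow_mul, ← hmν]; congr 1; ring
      _ ≤ Λ ^ k := pow_le_pow_left' hΛle k
  have hpow0 : ∀ k, κ (k * q i₀) ≤ Λ ^ k := fun k => by
    simpa [hκ0] using hpow 0 k
  set c : ℝ := (1 / ϑ) ^ (q i₀ - 1) with hc
  have hc0 : 0 ≤ c := by have := hϑ.1; positivity
  have hnum : ∀ i, ω ≤ α i → ∀ a : ℝ, a ≤ 4 * (1 + coef (α i)) →
      a * c ≤ 2 * constC α θ i₀ := fun i hi a ha => mul_le_two_mul_constC hθ hc0 hprod hi ha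
  -- The factor `τ` in the bounds makes room for the remainder `σ i` of the latest operation,
  -- whichever it was.
  refine ⟨Λ, q i₀, fun u => κ u * τ, q, ϑ, hΛ1, opow_lam_le h₀, hϑ, hθq, hϑd, ?_, ?_⟩
  · intro i u _ u' _ k hk
    calc (κ u' * τ + 1) * (2 * α i) ≤ κ (u' + q i) * σ i := hκ u' i
      _ = κ (u + k * q i₀) * σ i := by rw [hk]
      _ ≤ Λ ^ k * κ u * τ := mul_le_mul' (hpow u k) (hστ i)
      _ = Λ ^ k * (κ u * τ) := mul_assoc _ _ _
  · intro i
    by_cases hi₀ : i = i₀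
    · subst hi₀
      refine ⟨0, hd, 1, 0, coef (α i) + 1, by ring, ?_, ?_⟩
      -- `Λ` starts with a positive power of `γ`, which absorbs `τ + 1`; no remainder from earlier
      -- operations survives.
      · have h1 : (τ + 1) * Λ = Λ := by
          rw [hΛeq, ← mul_assoc]
          congr 1
          rw [hγc] at hτ ⊢
          exact mul_pow_opow_opow (zero_lt_one.trans_le le_add_self)
            (add_one_lt_of_lt_opow_opow hτ) (expo_ne_zero _)
        change (κ 0 * τ + 1) * (2 * α i) ≤ _
        rw [hκ0, one_mul, pow_one]
        calc (τ + 1) * (2 * α i) ≤ (τ + 1) * (Λ * (coef (α i) + 1)) :=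
              mul_le_mul_right (two_mul_le_opow_lam h₀) _
          _ = Λ * ((coef (α i) + 1 : ℕ) : Ordinal.{0}) := by
              rw [← mul_assoc, h1]; push_cast; rfl
      · rw [pow_zero, mul_one]
        refine hnum i h₀ _ ?_
        push_cast
        have : (0 : ℝ) ≤ coef (α i) := Nat.cast_nonneg _
        linarith
    by_cases hi : gam (α i) = γ
    · obtain ⟨hmi, -, hqi⟩ := hm i hi
      by_cases hδ : rest (lam (α i)) = 0
      -- Here the remainder `σ i` is the integer `coef (α i) + 1`, which is the final bound.
      · obtain ⟨u, hu, k, hk⟩ := exists_residue (q i₀) (q i) 0 hd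
        rw [zero_add] at hk
        refine ⟨u, hu, k, 0, coef (α i) + 1, by omega, ?_, ?_⟩
        · refine (hκ u i).trans ?_
          rw [hk, hσS i hi, hδ, opow_zero, one_mul]
          push_cast
          exact mul_le_mul_left (hpow0 k) _
        · rw [pow_zero, mul_one]
          refine hnum i (hω i hi) _ ?_
          push_cast
          have : (0 : ℝ) ≤ coef (α i) := Nat.cast_nonneg _
          linarith
      -- The remainder is infinite. Counting the weight of the operation twice (`e = 1`) absorbs it
      -- into a further power of `γ`, at the price of a factor `1 / θ i`, and leaves a single piece.
      · obtain ⟨u, hu, k, hk⟩ := exists_residue (q i₀) (q i * (1 + 1)) 0 hd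
        rw [zero_add] at hk
        refine ⟨u, hu, k, 1, 1, hk, ?_, ?_⟩
        · have h1 : ∀ n, n ≠ 0 → κ (u + q i) * γ ≤ κ (u + q i) * γ ^ n := by
            intro n hn
            refine mul_le_mul_right ?_ _
            conv_lhs => rw [← pow_one γ]
            exact pow_le_pow_right₀ hγ1.le (Nat.one_le_iff_ne_zero.2 hn)
          have h2 : κ (u + q i + Q) ≤ κ (u + q i + m i * Q) := by
            have h3 := hshift (u + q i) 1
            rw [one_mul, mul_one] at h3
            rw [h3, hshift]
            exact mul_le_mul_left (pow_le_pow_right₀ hγ1.le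
              (Nat.le_mul_of_pos_right _ (Nat.pos_of_ne_zero hmi))) _
          calc (κ u * τ + 1) * (2 * α i) ≤ κ (u + q i) * σ i := hκ u i
            _ ≤ κ (u + q i + Q) := habs _ _ (hσγ i)
            _ ≤ κ (u + q i + m i * Q) := h2
            _ = κ (k * q i₀) := by rw [← hk, ← hqi]; congr 1; ring
            _ ≤ Λ ^ k * ((1 : ℕ) : Ordinal.{0}) := by rw [Nat.cast_one, mul_one]; exact hpow0 k
        · have h := two_mul_mul_le_two_mul_constC hθ hc0 hprod hi₀ hδ
          rwa [pow_one, Nat.cast_one, one_add_one_eq_two]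
    -- An operation of index below `γ` leaves no remainder, so `y = 1`; its cost is dominated by the
    -- term of `i₀`.
    · obtain ⟨u, hu, k, hk⟩ := exists_residue (q i₀) (q i) 0 hd
      rw [zero_add] at hk
      refine ⟨u, hu, k, 0, 1, by omega, ?_, ?_⟩
      · refine (hκ u i).trans ?_
        rw [hk, hσS' i hi, Nat.cast_one]
        exact mul_le_mul_left (hpow0 k) _
      · rw [pow_zero, mul_one]
        refine hnum i₀ h₀ _ ?_
        push_cast
        have : (0 : ℝ) ≤ coef (α i₀) := Nat.cast_nonneg _
        linarith

theorem one_le_two_mul_constC (hθ : ∀ i, 0 < θ i ∧ θ i < 1) (h₀ : ω ≤ α i₀) :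
    1 ≤ 2 * constC α θ i₀ := by
  have h : (1 : ℝ) ≤ ∏ i ∈ Finset.univ.erase i₀, (1 / θ i) ^ (mexp α θ i₀ i - 1) :=
    Finset.prod_induction _ (fun x => 1 ≤ x) (fun _ _ => one_le_mul_of_one_le_of_one_le) le_rfl
      fun i _ => one_le_pow₀ (by rw [le_div_iff₀ (hθ i).1]; linarith [(hθ i).2])
  have := mul_le_two_mul_constC hθ zero_le_one h h₀ (a := 1) (by
    have : (0 : ℝ) ≤ coef (α i₀) := Nat.cast_nonneg _
    linarith)
  linarith

end Parameters

end Tsirelson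

end

/-! ### The main theorem -/

theorem mainTheorem12 {r : ℕ} (F : Fin r → Set (Finset ℕ)) (θ : Fin r → ℝ)
    (hcompact : ∀ i, Tsirelson.IsCompactFamily (F i))
    (hhereditary : ∀ i, Tsirelson.IsHereditary (F i))
    (hθ : ∀ i, 0 < θ i ∧ θ i < 1)
    (hinf : ∃ i, Ordinal.omega0 ≤ Tsirelson.index (F i))
    (i₀ : Fin r)
    (hmax : ∀ i, Tsirelson.LeT (Tsirelson.index (F i)) (θ i)
      (Tsirelson.index (F i₀)) (θ i₀))
    (M : Set ℕ) (hM : M.Infinite) :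
    ∃ N : Set ℕ, N ⊆ M ∧ N.Infinite ∧
      ∃ B : Set (Finset ℕ), Tsirelson.IsRegular B ∧
        Tsirelson.index B = Tsirelson.index (F i₀) ∧
        ∀ a : ℕ →₀ ℝ, (a.support : Set ℕ) ⊆ N →
          Tsirelson.tsirelsonNorm B (θ i₀) a ≤ Tsirelson.mixedNorm F θ a ∧
          Tsirelson.mixedNorm F θ a ≤
            2 * Tsirelson.constC (fun i => Tsirelson.index (F i)) θ i₀ *
              Tsirelson.tsirelsonNorm B (θ i₀) a := by
  obtain ⟨j, hj⟩ := hinf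
  have h₀ := (hmax j).omega0_le hj
  obtain ⟨Λ, d, K, q, ϑ, hΛ, hΛα, hϑ, hθq, hθd, hK, htop⟩ :=
    Tsirelson.exists_parameters (α := fun i => Tsirelson.index (F i)) hθ h₀ hmax
  exact Tsirelson.exists_family_equivalent hcompact hhereditary hθ hΛ hΛα hϑ hθq hθd hK
    (Tsirelson.one_le_two_mul_constC hθ h₀) htop hM
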